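/- Let $L,T>0$, $\Omega=(-L,L)$, $Q_T=(0,T)\times\Omega$, and let $H(s)=s\log s-s$, so that $H'(s)=\log s$ for $s>0$. Let $V\in C^2([-L,L])$, $W\in C^2([-2L,2L])$, and let $\rho_0\in L^\infty(\Omega)$ be strictly positive, i.e. $\rho_0\ge\varepsilon$ a.e. in $\Omega$ for some $\varepsilon>0$. All convolutions are over $\Omega$: $(W*\rho)(t,x)=\int_\Omega W(x-y)\rho(t,y)\,dy$. **Scheme.** For integers $M\ge1$, $N\ge0$ put $\Delta x=L/M$, $\Delta t=T/(N+1)$, $t^n=n\Delta t$, $I^n=[t^n,t^{n+1})$, $x_{i+1/2}=-L+i\Delta x$, $C_i=[x_{i-1/2},x_{i+1/2})$, and let $x_i$ be the centre of $C_i$ ($1\le i\le 2M$). Write $s^+=\max\{s,0\}$ and $s^-=\min\{s,0\}$. A strictly positive solution of the scheme is a family $\rho_i^n>0$ ($0\le n\le N+1$, $1\le i\le 2M$) with $\rho_i^0=\frac1{\Delta x}\int_{C_i}\rho_0\,dx$ and, for $0\le n\le N$, $1\le i\le 2M$, $$\frac{\rho_i^{n+1}-\rho_i^n}{\Delta t}=-\frac{F_{i+1/2}^{n+1}-F_{i-1/2}^{n+1}}{\Delta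 x},$$ where $F_{1/2}^{n+1}=F_{2M+1/2}^{n+1}=0$ and, for $1\le i\le 2M-1$, $$F_{i+1/2}^{n+1}=\rho_i^{n+1}(u_{i+1/2}^{n+1})^++\rho_{i+1}^{n+1}(u_{i+1/2}^{n+1})^-,\qquad u_{i+1/2}^{n+1}=-\frac{\xi_{i+1}^{n+1}-\xi_i^{n+1}}{\Delta x},$$ $$\xi_i^{n+1}=H'(\rho_i^{n+1})+\frac1{\Delta x}\int_{C_i}V(s)\,ds+\sum_{j=1}^{2M}\Big(\frac1{\Delta x}\int_{C_j}W(x_i-s)\,ds\Big)\frac{\rho_j^n+\rho_j^{n+1}}2\,\Delta x .$$ Its piecewise constant interpolation is $\rho_h(t,x)=\rho_i^n$ for $(t,x)\in I^n\times C_i$, $0\le n\le N$, $1\le i\le 2M$. **Weak solution.** A function $\rho\in L^\infty(Q_T)$, $\rho>0$ a.e., is a weak solution of $$\partial_t\rho=\partial_x\big[\rho\,\partial_x(H'(\rho)+V+W*\rho)\big]=\partial_{xx}\rho+\partial_x\big[\rho\,\partial_x(V+W*\rho)\big]$$ with no-flux boundary conditions and initial datum $\rho_0$ if $H'(\rho)+V+W*\rho$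 has a weak derivative $\partial_x(H'(\rho)+V+W*\rho)\in L^2(Q_T)$ and $$\int_0^T\!\!\int_\Omega\rho\,\partial_t\varphi-\rho\,\partial_x\varphi\,\partial_x\big(H'(\rho)+V+W*\rho\big)\,dx\,dt=-\int_\Omega\rho_0\,\varphi(0,\cdot)\,dx$$ for every $\varphi\in C^\infty(\overline{Q_T})$ with $\varphi(T,\cdot)=0$. **Theorem.** Set $C_V^{(2)}=\|V''\|_{L^\infty(-L,L)}+\|W''\|_{L^\infty(-2L,2L)}\|\rho_0\|_{L^1(\Omega)}$. (i) For all $M\ge1$ and $N\ge0$ the scheme has a strictly positive solution with $\sum_{i=1}^{2M}\rho_i^n\Delta x=\int_\Omega\rho_0\,dx$ for all $0\le n\le N+1$. (ii) Let $c>0$ and consider any sequence of meshes with $\Delta x=c\,\Delta t$, mesh size $h=\Delta x\to0$ and $C_V^{(2)}\Delta t<1$, together with a strictly positive solution of the scheme on each mesh. Then a subsequence of the interpolations $\rho_h$ converges strongly in $L^p(Q_T)$, for every $1\le p<\infty$, to a limit $\rho$. (iii) This limit $\rho$ is positive a.e. and is a weak solution in the above sense. -/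

import Mathlib

open MeasureTheory Set Filter Topology
open scoped ENNReal ContDiff

noncomputable section

namespace AggDiff

/-- The spatial domain `Ω = (-L, L)`. -/
def dom (L : ℝ) : Set ℝ := Ioo (-L) L

/-- The space-time cylinder `Q_T = (0, T) × (-L, L)`; points are pairs `(t, x)`. -/
def cyl (L T : ℝ) : Set (ℝ × ℝ) := Ioo 0 T ×ˢ dom L

/-- Boltzmann's entropy `H(s) = s log s - s`. -/
def boltzmann (s : ℝ) : ℝ := s * Real.log s - s

/-! ### The mesh -/

/-- Cell length `Δx = L / M` (there are `2M` cells). -/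
def stepX (L : ℝ) (M : ℕ) : ℝ := L / M

/-- Time step `Δt = T / (N + 1)`. -/
def stepT (T : ℝ) (N : ℕ) : ℝ := T / (N + 1)

/-- The cell centre `x_i = -L + Δx (i - 1/2)`, for `1 ≤ i ≤ 2M`. -/
def centre (L : ℝ) (M i : ℕ) : ℝ := -L + stepX L M * ((i : ℝ) - 1 / 2)

/-- The cell `C_i = [x_{i-1/2}, x_{i+1/2})`, for `1 ≤ i ≤ 2M`. -/
def cell (L : ℝ) (M i : ℕ) : Set ℝ :=
  Ico (-L + stepX L M * ((i : ℝ) - 1)) (-L + stepX L M * (i : ℝ))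

/-- The time interval `I^n = [t^n, t^{n+1})`, `t^n = n Δt`. -/
def timeCell (T : ℝ) (N n : ℕ) : Set ℝ :=
  Ico ((n : ℝ) * stepT T N) (((n : ℝ) + 1) * stepT T N)

/-! ### The implicit upwind finite-volume scheme

A discrete density is `r : ℕ → ℕ → ℝ`, where `r n i` stands for `ρ_i^n`. Only the values with
`0 ≤ n ≤ N + 1` and `1 ≤ i ≤ 2M` matter. -/

/-- `V_i`, the average of `V` over `C_i`. -/
def avgV (L : ℝ) (M : ℕ) (V : ℝ → ℝ) (i : ℕ) : ℝ := ⨍ s in cell L M i, V s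

/-- `W_{i-j}`, the average of `s ↦ W (x_i - s)` over `C_j`. -/
def avgW (L : ℝ) (M : ℕ) (W : ℝ → ℝ) (i j : ℕ) : ℝ :=
  ⨍ s in cell L M j, W (centre L M i - s)

/-- `(W ∗ θ)_i = ∑_j W_{i-j} θ_j Δx`. -/
def discConv (L : ℝ) (M : ℕ) (W : ℝ → ℝ) (θ : ℕ → ℝ) (i : ℕ) : ℝ :=
  ∑ j ∈ Finset.Icc 1 (2 * M), avgW L M W i j * θ j * stepX L M

/-- The entropy variable `ξ_i^{n+1} = H'(ρ_i^{n+1}) + V_i + (W ∗ ρ^{**})_i`, with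
`ρ^{**} = (ρ^n + ρ^{n+1}) / 2`. -/
def entropyVar (L : ℝ) (M : ℕ) (H V W : ℝ → ℝ) (r : ℕ → ℕ → ℝ) (n i : ℕ) : ℝ :=
  deriv H (r (n + 1) i) + avgV L M V i
    + discConv L M W (fun j => (r n j + r (n + 1) j) / 2) i

/-- The velocity `u_{i+1/2}^{n+1} = -(ξ_{i+1}^{n+1} - ξ_i^{n+1}) / Δx`. -/
def velocity (L : ℝ) (M : ℕ) (H V W : ℝ → ℝ) (r : ℕ → ℕ → ℝ) (n i : ℕ) : ℝ :=
  -((entropyVar L M H V W r n (i + 1) - entropyVar L M H V W r n i) / stepX L M)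

/-- The upwind flux `F_{i+1/2}^{n+1}`, `0 ≤ i ≤ 2M`; it vanishes at the two boundary interfaces
`i = 0` and `i = 2M`. -/
def flux (L : ℝ) (M : ℕ) (H V W : ℝ → ℝ) (r : ℕ → ℕ → ℝ) (n i : ℕ) : ℝ :=
  if 1 ≤ i ∧ i < 2 * M then
    r (n + 1) i * max (velocity L M H V W r n i) 0
      + r (n + 1) (i + 1) * min (velocity L M H V W r n i) 0
  else 0

/-- `r` solves the scheme on the mesh given by `M` and `N`, with initial datum `ρ₀`. -/
structure IsSchemeSol (L T : ℝ) (M N : ℕ) (H V W ρ₀ : ℝ → ℝ) (r : ℕ → ℕ → ℝ) : Prop where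
  init : ∀ i ∈ Finset.Icc 1 (2 * M), r 0 i = ⨍ x in cell L M i, ρ₀ x
  step : ∀ n ≤ N, ∀ i ∈ Finset.Icc 1 (2 * M),
    (r (n + 1) i - r n i) / stepT T N =
      -((flux L M H V W r n i - flux L M H V W r n (i - 1)) / stepX L M)

/-- All the values `ρ_i^n`, `0 ≤ n ≤ N + 1`, `1 ≤ i ≤ 2M`, are strictly positive. -/
def IsPositive (M N : ℕ) (r : ℕ → ℕ → ℝ) : Prop :=
  ∀ n ≤ N + 1, ∀ i ∈ Finset.Icc 1 (2 * M), 0 < r n i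

/-- The piecewise constant interpolation: `ρ_h = ρ_i^n` on `I^n × C_i`, for `0 ≤ n ≤ N` and
`1 ≤ i ≤ 2M`. -/
def interp (L T : ℝ) (M N : ℕ) (r : ℕ → ℕ → ℝ) (z : ℝ × ℝ) : ℝ :=
  ∑ n ∈ Finset.range (N + 1), ∑ i ∈ Finset.Icc 1 (2 * M),
    (timeCell T N n ×ˢ cell L M i).indicator (fun _ => r n i) z

/-- `C_V^{(2)} = ‖V''‖_{L^∞(-L,L)} + ‖W''‖_{L^∞(-2L,2L)} ‖ρ₀‖_{L^1(-L,L)}`. -/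
def constV2 (L : ℝ) (V W ρ₀ : ℝ → ℝ) : ℝ :=
  (eLpNorm (iteratedDeriv 2 V) ∞ (volume.restrict (dom L))).toReal
    + (eLpNorm (iteratedDeriv 2 W) ∞ (volume.restrict (dom (2 * L)))).toReal
      * (eLpNorm ρ₀ 1 (volume.restrict (dom L))).toReal

/-! ### Weak solutions -/

/-- Partial derivative in time, `∂f/∂t`. -/
def partialT (f : ℝ × ℝ → ℝ) (z : ℝ × ℝ) : ℝ := deriv (fun s => f (s, z.2)) z.1

/-- Partial derivative in space, `∂f/∂x`. -/
def partialX (f : ℝ × ℝ → ℝ) (z : ℝ × ℝ) : ℝ := deriv (fun y => f (z.1, y)) z.2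

/-- `g` is the weak derivative of `f` with respect to `x` in the open set `U` of space-time. -/
structure IsWeakPartialX (U : Set (ℝ × ℝ)) (f g : ℝ × ℝ → ℝ) : Prop where
  left_int : LocallyIntegrableOn f U
  right_int : LocallyIntegrableOn g U
  eq : ∀ ψ : ℝ × ℝ → ℝ, ContDiff ℝ ∞ ψ → HasCompactSupport ψ → tsupport ψ ⊆ U →
    ∫ z in U, f z * partialX ψ z = -∫ z in U, g z * ψ z

/-- The convolution `(W ∗ ρ)(t, x) = ∫_Ω W(x - y) ρ(t, y) dy`. -/
def conv (L : ℝ) (W : ℝ → ℝ) (ρ : ℝ × ℝ → ℝ) (z : ℝ × ℝ) : ℝ :=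
  ∫ y in dom L, W (z.2 - y) * ρ (z.1, y)

/-- Weak solutions on `Q_T` of `∂ₜρ = ∂ₓ(ρ ∂ₓ(H'(ρ) + V + W ∗ ρ))` with no-flux boundary
conditions and initial datum `ρ₀`: `ρ ∈ L^∞(Q_T)`, the quantity `H'(ρ) + V + W ∗ ρ` has a weak
spatial derivative `g ∈ L²(Q_T)`, and the weak formulation holds for all `φ ∈ C^∞` on the closed
cylinder with `φ(T) = 0`. -/
def IsWeakSol (L T : ℝ) (H V W ρ₀ : ℝ → ℝ) (ρ : ℝ × ℝ → ℝ) : Prop :=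
  MemLp ρ ∞ (volume.restrict (cyl L T)) ∧
  ∃ g : ℝ × ℝ → ℝ, MemLp g 2 (volume.restrict (cyl L T)) ∧
    IsWeakPartialX (cyl L T) (fun z => deriv H (ρ z) + V z.2 + conv L W ρ z) g ∧
    ∀ φ : ℝ × ℝ → ℝ, ContDiffOn ℝ ∞ φ (Icc 0 T ×ˢ Icc (-L) L) →
      (∀ x ∈ Icc (-L) L, φ (T, x) = 0) →
      ∫ z in cyl L T, (ρ z * partialT φ z - ρ z * partialX φ z * g z)
        = -∫ x in dom L, ρ₀ x * φ (0, x)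

end AggDiff

end

noncomputable section

namespace AggDiff

/-! ### Brouwer's fixed point theorem -/

section Brouwer

variable {E : Type*} [NormedAddCommGroup E] [InnerProductSpace ℝ E]

/-- Zero extension of a map that vanishes on a sphere keeps the Lipschitz constant. -/
lemma lipschitzWith_indicator_closedBall {v : E → E} {R : ℝ} {K : NNReal}
    (hv : LipschitzOnWith K v (Metric.closedBall 0 R)) (h0 : ∀ x, ‖x‖ = R → v x = 0) :
    LipschitzWith K ((Metric.closedBall (0 : E) R).indicator v) := by
  have key : ∀ x y : E, ‖x‖ ≤ R → R < ‖y‖ → ‖v x‖ ≤ K * ‖x - y‖ := by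
    intro x y hx hy
    have hc : ContinuousOn (fun s : ℝ => ‖x + s • (y - x)‖) (Icc 0 1) := by fun_prop
    have hmem : R ∈ Icc ((fun s : ℝ => ‖x + s • (y - x)‖) 0)
        ((fun s : ℝ => ‖x + s • (y - x)‖) 1) := by
      simp only [zero_smul, add_zero, one_smul, add_sub_cancel]
      exact ⟨hx, hy.le⟩
    obtain ⟨s, ⟨hs0, hs1⟩, hs⟩ := intermediate_value_Icc zero_le_one hc hmem
    simp only at hs
    have h1 := hv.norm_sub_le (x := x) (y := x + s • (y - x)) (by simpa using hx)
      (by simpa using hs.le)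
    rw [h0 _ hs, sub_zero] at h1
    refine h1.trans ?_
    gcongr
    rw [sub_add_cancel_left, norm_neg, norm_smul, Real.norm_of_nonneg hs0, norm_sub_rev]
    exact mul_le_of_le_one_left (norm_nonneg _) hs1
  refine LipschitzWith.of_dist_le_mul fun x y => ?_
  rw [dist_eq_norm, dist_eq_norm]
  by_cases hx : ‖x‖ ≤ R <;> by_cases hy : ‖y‖ ≤ R
  · rw [indicator_of_mem (by simpa using hx), indicator_of_mem (by simpa using hy)]
    exact hv.norm_sub_le (by simpa using hx) (by simpa using hy)
  · rw [indicator_of_mem (by simpa using hx), indicator_of_notMem (by simpa using hy), sub_zero]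
    exact key x y hx (not_le.1 hy)
  · rw [indicator_of_notMem (by simpa using hx), indicator_of_mem (by simpa using hy), zero_sub,
      norm_neg, norm_sub_rev]
    exact key y x hy (not_le.1 hx)
  · rw [indicator_of_notMem (by simpa using hx), indicator_of_notMem (by simpa using hy)]
    simp only [sub_zero, norm_zero]
    positivity

variable [FiniteDimensional ℝ E]

/-- Along the segment from the identity, a strict contraction perturbation keeps a positive
determinant. -/
lemma det_id_add_smul_pos (A : E →L[ℝ] E) {t : ℝ} (ht : 0 ≤ t) (h : t * ‖A‖ < 1) :
    0 < (ContinuousLinearMap.id ℝ E + t • A).det := by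
  have hne : ∀ s ∈ Icc 0 t, (ContinuousLinearMap.id ℝ E + s • A).det ≠ 0 := by
    intro s hs h0
    have hlt : s * ‖A‖ < 1 := (mul_le_mul_of_nonneg_right hs.2 (norm_nonneg _)).trans_lt h
    obtain ⟨x, hx, hx0⟩ := (LinearMap.bot_lt_ker_of_det_eq_zero (f := (ContinuousLinearMap.id ℝ E + s • A : E →L[ℝ] E).toLinearMap) h0
      |> fun h => (Submodule.ne_bot_iff _).1 h.ne')
    have hx' : x + s • A x = 0 := by simpa using hx
    have h2 : ‖x‖ = s * ‖A x‖ := by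
      rw [← Real.norm_of_nonneg hs.1, ← norm_smul, ← norm_neg (s • A x),
        ← eq_neg_of_add_eq_zero_left hx']
    have h3 : ‖x‖ ≤ s * ‖A‖ * ‖x‖ := by
      rw [mul_assoc]
      exact h2.le.trans (mul_le_mul_of_nonneg_left (A.le_opNorm x) hs.1)
    have h4 : 0 < ‖x‖ := norm_pos_iff.2 hx0
    nlinarith
  have hc : ContinuousOn (fun s : ℝ => (ContinuousLinearMap.id ℝ E + s • A).det) (Icc 0 t) := by
    have : Continuous fun s : ℝ => ContinuousLinearMap.id ℝ E + s • A := by fun_prop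
    exact (ContinuousLinearMap.continuous_det.comp this).continuousOn
  by_contra hcon
  push Not at hcon
  have : (0 : ℝ) ∈ Icc ((fun s : ℝ => (ContinuousLinearMap.id ℝ E + s • A).det) t)
      ((fun s : ℝ => (ContinuousLinearMap.id ℝ E + s • A).det) 0) := by
    refine ⟨hcon, ?_⟩
    simp [ContinuousLinearMap.det]
  obtain ⟨s, hs, hs0⟩ := intermediate_value_Icc' ht hc this
  exact hne s hs hs0

/-- Lagrange extrapolation of `t ↦ det (id + t A)` from nodes `v` to `t = 1`. -/
lemma det_id_add_eq_sum_lagrange (A : E →L[ℝ] E) (v : ℕ → ℝ) (hv : Function.Injective v) :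
    (ContinuousLinearMap.id ℝ E + A).det =
      ∑ j ∈ Finset.range (Module.finrank ℝ E + 1),
        (Lagrange.basis (Finset.range (Module.finrank ℝ E + 1)) v j).eval 1 *
          (ContinuousLinearMap.id ℝ E + v j • A).det := by
  classical
  let b := Module.finBasis ℝ E
  let B : Matrix (Fin (Module.finrank ℝ E)) (Fin (Module.finrank ℝ E)) ℝ :=
    LinearMap.toMatrix b b A.toLinearMap
  let P : Polynomial ℝ := ((Polynomial.X : Polynomial ℝ) • B.map Polynomial.C
    + (1 : Matrix _ _ ℝ).map Polynomial.C).det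
  have hP : ∀ t : ℝ, P.eval t = (ContinuousLinearMap.id ℝ E + t • A).det := by
    intro t
    rw [ContinuousLinearMap.det, ← LinearMap.det_toMatrix b, ← Polynomial.coe_evalRingHom,
      RingHom.map_det]
    congr 1
    have h1 : LinearMap.toMatrix b b
        (ContinuousLinearMap.id ℝ E + t • A : E →L[ℝ] E).toLinearMap = 1 + t • B := by
      rw [ContinuousLinearMap.toLinearMap_add, ContinuousLinearMap.toLinearMap_smul, map_add,
        map_smul, ContinuousLinearMap.coe_id, LinearMap.toMatrix_id]
    rw [h1]
    ext i j
    rw [add_comm (1 : Matrix _ _ ℝ)]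
    by_cases hij : i = j <;> simp [hij, mul_comm t]
  have hdeg : P.degree < (Finset.range (Module.finrank ℝ E + 1)).card := by
    rw [Finset.card_range]
    refine (Polynomial.degree_le_natDegree).trans_lt ?_
    have := Polynomial.natDegree_det_X_add_C_le B (1 : Matrix _ _ ℝ)
    rw [Fintype.card_fin] at this
    exact_mod_cast Nat.lt_succ_of_le this
  have h1 := Lagrange.eq_interpolate (s := Finset.range (Module.finrank ℝ E + 1)) hv.injOn hdeg
  have h2 := hP 1
  rw [one_smul] at h2
  rw [← h2, h1, Lagrange.interpolate_apply, Polynomial.eval_finsetSum]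
  refine Finset.sum_congr rfl fun j _ => ?_
  rw [Polynomial.eval_mul, Polynomial.eval_C, hP, mul_comm]

/-- For small `t`, the map `id + t (F - id)` of a `C¹` map fixing the sphere of radius `R`
preserves the volume of the ball. -/
lemma integral_det_perturbation [MeasurableSpace E] [BorelSpace E] {F : E → E} (hF : ContDiff ℝ 1 F) {R : ℝ}
    (hfix : ∀ x, ‖x‖ = R → F x = x) :
    ∃ δ : ℝ, 0 < δ ∧ ∀ t : ℝ, 0 ≤ t → t < δ →
      ∫ x in Metric.ball (0 : E) R,
        (ContinuousLinearMap.id ℝ E + t • (fderiv ℝ F x - ContinuousLinearMap.id ℝ E)).det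
        = (volume (Metric.ball (0 : E) R)).toReal := by
  obtain ⟨K, hK⟩ : ∃ K, LipschitzOnWith K (fun x => F x - x) (Metric.closedBall 0 R) := by
    have h1 : LocallyLipschitz fun x => F x - x := (hF.sub contDiff_id).locallyLipschitz
    exact (h1.locallyLipschitzOn (s := Metric.closedBall 0 R)).exists_lipschitzOnWith_of_compact (isCompact_closedBall 0 R)
  have hw := lipschitzWith_indicator_closedBall hK (fun x hx => by simp [hfix x hx])
  refine ⟨1 / (K + 1), by positivity, fun t ht0 htδ => ?_⟩
  have htK : t * (K + 1) < 1 := by rwa [lt_div_iff₀ (by positivity)] at htδ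
  have htK' : t * K < 1 := by nlinarith
  set w := (Metric.closedBall (0 : E) R).indicator (fun x => F x - x) with hw_def
  set g : E → E := fun x => x + t • w x with hg
  have hc : (Real.toNNReal t * K : NNReal) < 1 := by
    rw [← NNReal.coe_lt_coe]; simpa [ht0] using htK'
  have happ : ApproximatesLinearOn g ((ContinuousLinearEquiv.refl ℝ E : E ≃L[ℝ] E) : E →L[ℝ] E)
      univ (Real.toNNReal t * K) := by
    rw [ApproximatesLinearOn.approximatesLinearOn_iff_lipschitzOnWith]
    refine LipschitzOnWith.of_dist_le_mul fun x _ y _ => ?_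
    have := hw.dist_le_mul x y
    simp only [hg, Pi.sub_apply, ContinuousLinearEquiv.coe_coe, ContinuousLinearEquiv.refl_apply,
      add_sub_cancel_left, dist_smul₀, Real.norm_of_nonneg ht0, NNReal.coe_mul, Real.coe_toNNReal t ht0]
    rw [mul_assoc]
    exact mul_le_mul_of_nonneg_left this ht0
  have hcc : Subsingleton E ∨ (Real.toNNReal t * K : NNReal) <
      ‖((ContinuousLinearEquiv.refl ℝ E).symm : E →L[ℝ] E)‖₊⁻¹ := by
    rcases subsingleton_or_nontrivial E with h | h
    · exact Or.inl h
    · right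
      have : ‖((ContinuousLinearEquiv.refl ℝ E).symm : E →L[ℝ] E)‖₊ = 1 := by
        have := ContinuousLinearMap.nnnorm_id (𝕜 := ℝ) (E := E)
        exact this
      rw [this, inv_one]; exact hc
  have hinj : Function.Injective g := injOn_univ.1 (happ.injOn hcc)
  have hsurj : Function.Surjective g := happ.surjective hcc
  have hout : ∀ x, R ≤ ‖x‖ → g x = x := by
    intro x hx
    have : w x = 0 := by
      rcases hx.eq_or_lt with h | h
      · rw [hw_def, indicator_of_mem (by simp [h]), hfix x h.symm, sub_self]
      · rw [hw_def, indicator_of_notMem (by simpa using h)]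
    simp [hg, this]
  have himg : g '' Metric.ball 0 R = Metric.ball 0 R := by
    apply Subset.antisymm
    · rintro _ ⟨x, hx, rfl⟩
      by_contra hcon
      have h1 : R ≤ ‖g x‖ := by simpa using hcon
      have h2 := hinj (hout _ h1)
      rw [h2] at h1
      exact absurd hx (by simpa using h1)
    · intro y hy
      obtain ⟨x, rfl⟩ := hsurj y
      refine ⟨x, ?_, rfl⟩
      by_contra hcon
      have h1 : R ≤ ‖x‖ := by simpa using hcon
      rw [hout x h1] at hy
      exact absurd hy hcon
  have hder : ∀ x ∈ Metric.ball (0 : E) R, HasFDerivWithinAt g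
      (ContinuousLinearMap.id ℝ E + t • (fderiv ℝ F x - ContinuousLinearMap.id ℝ E))
      (Metric.ball 0 R) x := by
    intro x hx
    have hd : HasFDerivAt F (fderiv ℝ F x) x :=
      (hF.differentiable one_ne_zero x).hasFDerivAt
    have h1 : HasFDerivAt (fun x => x + t • (F x - x))
        (ContinuousLinearMap.id ℝ E + t • (fderiv ℝ F x - ContinuousLinearMap.id ℝ E)) x :=
      (hasFDerivAt_id x).add ((hd.sub (hasFDerivAt_id x)).const_smul t)
    refine h1.hasFDerivWithinAt.congr (fun y hy => ?_) ?_
    · simp only [hg, hw_def]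
      rw [indicator_of_mem (Metric.ball_subset_closedBall hy)]
    · simp only [hg, hw_def]
      rw [indicator_of_mem (Metric.ball_subset_closedBall hx)]
  have hpos : ∀ x ∈ Metric.ball (0 : E) R,
      0 < (ContinuousLinearMap.id ℝ E
        + t • (fderiv ℝ F x - ContinuousLinearMap.id ℝ E)).det := by
    intro x hx
    refine det_id_add_smul_pos _ ht0 ?_
    have hd : HasFDerivAt (fun x => F x - x) (fderiv ℝ F x - ContinuousLinearMap.id ℝ E) x :=
      (hF.differentiable one_ne_zero x).hasFDerivAt.sub (hasFDerivAt_id x)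
    have := hd.le_of_lipschitzOn (Metric.closedBall_mem_nhds_of_mem hx) hK
    exact (mul_le_mul_of_nonneg_left this ht0).trans_lt htK'
  have hmain := lintegral_abs_det_fderiv_eq_addHaar_image volume measurableSet_ball hder hinj.injOn
  rw [himg] at hmain
  have hcont : Continuous fun x => (ContinuousLinearMap.id ℝ E
      + t • (fderiv ℝ F x - ContinuousLinearMap.id ℝ E)).det := by
    have := hF.continuous_fderiv one_ne_zero
    exact ContinuousLinearMap.continuous_det.comp (by fun_prop)
  rw [integral_eq_lintegral_of_nonneg_ae, ← hmain]
  · congr 1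
    refine setLIntegral_congr_fun measurableSet_ball fun x hx => ?_
    rw [abs_of_pos (hpos x hx)]
  · filter_upwards [self_mem_ae_restrict measurableSet_ball] with x hx using (hpos x hx).le
  · exact hcont.aestronglyMeasurable

/-- There is no `C¹` map onto the sphere of radius `R` fixing it pointwise. -/
theorem no_retraction_onto_sphere {F : E → E} (hF : ContDiff ℝ 1 F) {R : ℝ} (hR : 0 < R)
    (hnorm : ∀ x, ‖F x‖ = R) (hfix : ∀ x, ‖x‖ = R → F x = x) : False := by
  borelize E
  obtain ⟨δ, hδ, hintg⟩ := integral_det_perturbation hF hfix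
  let v : ℕ → ℝ := fun j => δ / (j + 2)
  have hv : Function.Injective v := by
    intro i j hij
    simp only [v] at hij
    rw [div_eq_div_iff (by positivity) (by positivity)] at hij
    have := mul_left_cancel₀ hδ.ne' hij
    exact_mod_cast (add_right_cancel this).symm
  have hv0 : ∀ j, 0 ≤ v j ∧ v j < δ := fun j => by
    refine ⟨by positivity, ?_⟩
    simp only [v]
    rw [div_lt_iff₀ (by positivity)]
    nlinarith [(Nat.cast_nonneg j : (0:ℝ) ≤ j)]
  have hzero : ∀ x, (fderiv ℝ F x).det = 0 := by
    intro x
    by_contra hne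
    have hd : HasFDerivAt F (fderiv ℝ F x) x := (hF.differentiable one_ne_zero x).hasFDerivAt
    have h1 := hd.norm_sq
    have h2 : HasFDerivAt (fun x => ‖F x‖ ^ 2) (0 : E →L[ℝ] ℝ) x := by
      simp only [hnorm]; exact hasFDerivAt_const _ _
    have h3 := h1.unique h2
    have hs : Function.Surjective (fderiv ℝ F x) := by
      have := (LinearMap.equivOfDetNeZero (fderiv ℝ F x).toLinearMap hne).surjective
      exact this
    obtain ⟨y, hy⟩ := hs (F x)
    have h4 := congrArg (fun A : E →L[ℝ] ℝ => A y) h3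
    simp [hy, hnorm, hR.ne'] at h4
  have hcont : ∀ t : ℝ, Continuous fun x => (ContinuousLinearMap.id ℝ E
      + t • (fderiv ℝ F x - ContinuousLinearMap.id ℝ E)).det := by
    intro t
    have := hF.continuous_fderiv one_ne_zero
    exact ContinuousLinearMap.continuous_det.comp (by fun_prop)
  have hsum : ∫ x in Metric.ball (0 : E) R, (fderiv ℝ F x).det
      = (volume (Metric.ball (0 : E) R)).toReal := by
    have h1 : ∀ x, (fderiv ℝ F x).det = ∑ j ∈ Finset.range (Module.finrank ℝ E + 1),
        (Lagrange.basis (Finset.range (Module.finrank ℝ E + 1)) v j).eval 1 *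
          (ContinuousLinearMap.id ℝ E
            + v j • (fderiv ℝ F x - ContinuousLinearMap.id ℝ E)).det := by
      intro x
      rw [← det_id_add_eq_sum_lagrange _ v hv, add_sub_cancel]
    simp_rw [h1]
    rw [integral_finsetSum]
    · simp_rw [integral_const_mul]
      rw [Finset.sum_congr rfl fun j _ => by rw [hintg (v j) (hv0 j).1 (hv0 j).2],
        ← Finset.sum_mul, ← Polynomial.eval_finsetSum,
        Lagrange.sum_basis hv.injOn (by simp), Polynomial.eval_one, one_mul]
    · intro j _
      refine Integrable.const_mul ?_ _
      exact ((hcont _).continuousOn.integrableOn_compact (isCompact_closedBall 0 R)).mono_set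
        Metric.ball_subset_closedBall
  simp only [hzero, integral_zero] at hsum
  have hb : 0 < volume (Metric.ball (0 : E) R) := Metric.measure_ball_pos _ _ hR
  have hb' : volume (Metric.ball (0 : E) R) < ⊤ := measure_ball_lt_top
  exact (ENNReal.toReal_pos hb.ne' hb'.ne).ne hsum

/-- A bounded continuous self-map of a Euclidean space has a fixed point. -/
theorem exists_fixedPoint_of_bounded {f : E → E} (hf : Continuous f) {R : ℝ}
    (hR : ∀ x, ‖f x‖ ≤ R) : ∃ x, f x = x := by
  by_contra hcon
  push Not at hcon
  have hR0 : 0 ≤ R := (norm_nonneg _).trans (hR 0)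
  obtain ⟨g, hg, hfg, -⟩ := hf.exists_contDiff_approx 1
    (ε := fun x => min ‖f x - x‖ 1) (by fun_prop)
    (fun x => lt_min (norm_pos_iff.2 (sub_ne_zero.2 (hcon x))) one_pos)
  have hgx : ∀ x, x ≠ g x := by
    intro x hx
    have := (hfg x).trans_le (min_le_left _ _)
    rw [← hx, dist_eq_norm, norm_sub_rev] at this
    exact lt_irrefl _ this
  have hgR : ∀ x, ‖g x‖ < R + 1 := by
    intro x
    have h1 := (hfg x).trans_le (min_le_right _ _)
    rw [dist_eq_norm] at h1
    calc ‖g x‖ = ‖(g x - f x) + f x‖ := by simp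
      _ ≤ ‖g x - f x‖ + ‖f x‖ := norm_add_le _ _
      _ < R + 1 := by linarith [hR x]
  let s : ContDiffBump (0 : E) := ⟨R + 1, R + 2, by linarith, by linarith⟩
  let G : E → E := fun x => x - s x • g x
  have hG : ContDiff ℝ 1 G := contDiff_id.sub (s.contDiff.smul hg)
  have hG0 : ∀ x, G x ≠ 0 := by
    intro x hx
    by_cases h : ‖x‖ ≤ R + 1
    · have : s x = 1 := s.one_of_mem_closedBall (by simpa using h)
      simp only [G, this, one_smul, sub_eq_zero] at hx
      exact hgx x hx
    · have h1 : x = s x • g x := sub_eq_zero.1 hx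
      have h2 : ‖x‖ ≤ ‖g x‖ := by
        calc ‖x‖ = ‖s x • g x‖ := by rw [← h1]
          _ = s x * ‖g x‖ := by rw [norm_smul, Real.norm_of_nonneg s.nonneg]
          _ ≤ ‖g x‖ := mul_le_of_le_one_left (norm_nonneg _) s.le_one
      linarith [hgR x]
  have hGn : ∀ x, ‖G x‖ ≠ 0 := fun x => norm_ne_zero_iff.2 (hG0 x)
  refine no_retraction_onto_sphere (F := fun x => ((R + 2) / ‖G x‖) • G x) (R := R + 2)
    ?_ (by linarith) ?_ ?_
  · exact (contDiff_const.div (hG.norm ℝ hG0) hGn).smul hG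
  · intro x
    rw [norm_smul, Real.norm_of_nonneg (by positivity), div_mul_cancel₀ _ (hGn x)]
  · intro x hx
    have : s x = 0 := s.zero_of_le_dist (by simp [s, hx])
    simp only [G, this, zero_smul, sub_zero, hx]
    rw [div_self (by linarith), one_smul]

end Brouwer

/-- **Brouwer's theorem** on a box. -/
theorem exists_fixedPoint_Icc {ι : Type*} [Fintype ι] {a b : ι → ℝ} (hab : a ≤ b)
    {f : (ι → ℝ) → ι → ℝ} (hf : ContinuousOn f (Icc a b)) (hmaps : MapsTo f (Icc a b) (Icc a b)) :
    ∃ x ∈ Icc a b, f x = x := by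
  let cl : (ι → ℝ) → ι → ℝ := fun x => a ⊔ (b ⊓ x)
  have hcl : Continuous cl := continuous_pi fun i =>
    continuous_const.max (continuous_const.min (continuous_apply i))
  have hmem : ∀ x, cl x ∈ Icc a b := fun x => ⟨le_sup_left, sup_le hab inf_le_left⟩
  have hfc : Continuous fun x => f (cl x) :=
    hf.comp_continuous hcl hmem
  let e := EuclideanSpace.equiv ι ℝ
  obtain ⟨R, hR⟩ := (isCompact_Icc (a := a) (b := b)).image e.symm.continuous |>.isBounded.exists_norm_le
  obtain ⟨x, hx⟩ := exists_fixedPoint_of_bounded (E := EuclideanSpace ℝ ι)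
    (f := fun x => e.symm (f (cl (e x)))) (e.symm.continuous.comp (hfc.comp e.continuous))
    (R := R) (fun x => hR _ ⟨_, hmaps (hmem _), rfl⟩)
  have h1 : f (cl (e x)) = e x := by
    have := congrArg e hx
    simpa using this
  have h2 : e x ∈ Icc a b := by rw [← h1]; exact hmaps (hmem _)
  have h3 : cl (e x) = e x := by
    simp only [cl]
    rw [inf_eq_right.2 h2.2, sup_eq_right.2 h2.1]
  exact ⟨e x, h2, by rw [h3] at h1; exact h1⟩

/-! ### Finite sums over the cells -/

lemma sum_Icc_one_eq_sum_range {A : Type*} [AddCommMonoid A] (f : ℕ → A) (m : ℕ) :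
    ∑ i ∈ Finset.Icc 1 m, f i = ∑ i ∈ Finset.range m, f (i + 1) := by
  induction m with
  | zero => simp
  | succ m ih => rw [Finset.sum_Icc_succ_top (by omega), ih, Finset.sum_range_succ]

/-- Summation by parts against a discrete divergence with vanishing boundary fluxes. -/
lemma sum_mul_div_eq_neg_sum_flux (m : ℕ) (F g : ℕ → ℝ) (h0 : F 0 = 0) (hm : F m = 0) :
    ∑ i ∈ Finset.Icc 1 m, g i * (F i - F (i - 1)) =
      -∑ i ∈ Finset.Icc 1 m, F i * (g (i + 1) - g i) := by
  have key : ∀ k, ∑ i ∈ Finset.Icc 1 k, g i * (F i - F (i - 1)) =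
      -∑ i ∈ Finset.Icc 1 k, F i * (g (i + 1) - g i) + F k * g (k + 1) - F 0 * g 1 := by
    intro k
    induction k with
    | zero => simp
    | succ k ih =>
      rw [Finset.sum_Icc_succ_top (by omega), Finset.sum_Icc_succ_top (by omega), ih]
      simp only [Nat.add_sub_cancel]
      ring
  rw [key, h0, hm]
  ring

lemma sum_div_eq_zero (m : ℕ) (F : ℕ → ℝ) (h0 : F 0 = 0) (hm : F m = 0) :
    ∑ i ∈ Finset.Icc 1 m, (F i - F (i - 1)) = 0 := by
  have := sum_mul_div_eq_neg_sum_flux m F (fun _ => 1) h0 hm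
  simpa using this

/-! ### Solvability of one implicit step -/

/-- Extension by `1` of a family indexed by the cells `1, …, m`. -/
def extendOne (m : ℕ) (x : Finset.Icc 1 m → ℝ) (i : ℕ) : ℝ :=
  if h : i ∈ Finset.Icc 1 m then x ⟨i, h⟩ else 1

lemma extendOne_of_mem {m : ℕ} (x : Finset.Icc 1 m → ℝ) {i : ℕ} (h : i ∈ Finset.Icc 1 m) :
    extendOne m x i = x ⟨i, h⟩ := dif_pos h

lemma continuous_extendOne (m i : ℕ) : Continuous fun x => extendOne m x i := by
  by_cases h : i ∈ Finset.Icc 1 m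
  · simp only [extendOne, h, dite_true]
    exact continuous_apply _
  · simp only [extendOne, h, dite_false]
    exact continuous_const

lemma exists_small_log_bound (c C β B : ℝ) (hβ : 0 < β) (hB : 0 < B) :
    ∃ δ : ℝ, 0 < δ ∧ δ ≤ B ∧ δ * (1 + c * (C + |Real.log δ|)) ≤ β := by
  have hc : Continuous fun δ : ℝ => δ * (1 + c * C) + c * |δ * Real.log δ| :=
    (continuous_id.mul continuous_const).add (continuous_const.mul Real.continuous_mul_log.abs)
  have h1 : Tendsto (fun δ : ℝ => δ * (1 + c * C) + c * |δ * Real.log δ|) (𝓝[>] 0)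
      (𝓝 (0 * (1 + c * C) + c * |0 * Real.log 0|)) :=
    tendsto_nhdsWithin_of_tendsto_nhds (hc.tendsto 0)
  simp only [zero_mul, abs_zero, mul_zero, add_zero] at h1
  have h2 := (h1.eventually (gt_mem_nhds hβ)).and
    ((Ioo_mem_nhdsGT hB : Ioo 0 B ∈ 𝓝[>] (0:ℝ)))
  obtain ⟨δ, hδ, hδ0, hδB⟩ := h2.exists
  refine ⟨δ, hδ0, hδB.le, ?_⟩
  rw [abs_mul, abs_of_pos hδ0] at hδ
  nlinarith

/-- Upwind flux with velocities `u`, vanishing at the boundary interfaces `0` and `m`. -/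
def upwind (m : ℕ) (u a : ℕ → ℝ) (i : ℕ) : ℝ :=
  if 1 ≤ i ∧ i < m then a i * max (u i) 0 + a (i + 1) * min (u i) 0 else 0

lemma upwind_zero (m : ℕ) (u a : ℕ → ℝ) : upwind m u a 0 = 0 := by simp [upwind]

lemma upwind_last (m : ℕ) (u a : ℕ → ℝ) : upwind m u a m = 0 := by simp [upwind]

/-- One step of the implicit upwind scheme is solvable with strictly positive values. The potential
`P` is an arbitrary continuous function of the unknown. -/
theorem exists_upwind_step (m : ℕ) {lam h : ℝ} (hlam : 0 < lam) (hh : 0 < h) (b : ℕ → ℝ)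
    (hb : ∀ i ∈ Finset.Icc 1 m, 0 < b i) (P : (ℕ → ℝ) → ℕ → ℝ)
    (hP : ∀ i, Continuous fun x : Finset.Icc 1 m → ℝ => P (extendOne m x) i) :
    ∃ a : ℕ → ℝ, (∀ i ∈ Finset.Icc 1 m, 0 < a i) ∧
      ∀ i ∈ Finset.Icc 1 m, a i - b i = -(lam *
        (upwind m (fun i => -((Real.log (a (i + 1)) + P a (i + 1)
            - (Real.log (a i) + P a i)) / h)) a i
          - upwind m (fun i => -((Real.log (a (i + 1)) + P a (i + 1)
            - (Real.log (a i) + P a i)) / h)) a (i - 1))) := by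
  classical
  rcases Nat.eq_zero_or_pos m with rfl | hm
  · exact ⟨fun _ => 1, by simp, by simp⟩
  have hne : (Finset.Icc 1 m).Nonempty := ⟨1, by simp; omega⟩
  obtain ⟨i₀, hi₀, hmin⟩ := Finset.exists_min_image (Finset.Icc 1 m) b hne
  set B : ℝ := ∑ i ∈ Finset.Icc 1 m, b i + 1 with hBdef
  have hS0 : 0 ≤ ∑ i ∈ Finset.Icc 1 m, b i := Finset.sum_nonneg fun i hi => (hb i hi).le
  have hB : 0 < B := by positivity
  -- a bound for the potential on the box
  obtain ⟨C, hC⟩ : ∃ C, ∀ i ∈ Finset.range (m + 2), ∀ x ∈ Icc (0 : Finset.Icc 1 m → ℝ) (fun _ => B),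
      |P (extendOne m x) i| ≤ C := by
    have h1 : ∀ i, ∃ C, ∀ x ∈ Icc (0 : Finset.Icc 1 m → ℝ) (fun _ => B),
        |P (extendOne m x) i| ≤ C := fun i => by
      obtain ⟨C, hC⟩ := (isCompact_Icc (a := (0 : Finset.Icc 1 m → ℝ)) (b := fun _ => B)).exists_bound_of_continuousOn
        (hP i).continuousOn
      exact ⟨C, hC⟩
    choose C hC using h1
    refine ⟨∑ i ∈ Finset.range (m + 2), |C i|, fun i hi x hx => ?_⟩
    exact (hC i x hx).trans ((le_abs_self _).trans
      (Finset.single_le_sum (f := fun i => |C i|) (fun _ _ => abs_nonneg _) hi))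
  obtain ⟨δ, hδ0, hδB, hδ⟩ := exists_small_log_bound (4 * lam / h) (C + |Real.log B|) (b i₀) B
    (hb i₀ hi₀) hB
  let a' : (Finset.Icc 1 m → ℝ) → ℕ → ℝ := extendOne m
  let u : (Finset.Icc 1 m → ℝ) → ℕ → ℝ := fun x i =>
    -((Real.log (a' x (i + 1)) + P (a' x) (i + 1) - (Real.log (a' x i) + P (a' x) i)) / h)
  let p : (Finset.Icc 1 m → ℝ) → ℕ → ℝ := fun x i => if 1 ≤ i ∧ i < m then max (u x i) 0 else 0
  let q : (Finset.Icc 1 m → ℝ) → ℕ → ℝ := fun x i => if 1 ≤ i ∧ i < m then -min (u x i) 0 else 0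
  have hp0 : ∀ x i, 0 ≤ p x i := fun x i => by simp only [p]; split_ifs <;> simp
  have hq0 : ∀ x i, 0 ≤ q x i := fun x i => by simp only [q]; split_ifs <;> simp
  have hF : ∀ x i, upwind m (u x) (a' x) i = a' x i * p x i - a' x (i + 1) * q x i := by
    intro x i
    simp only [upwind, p, q]
    split_ifs <;> ring
  let val : (Finset.Icc 1 m → ℝ) → Finset.Icc 1 m → ℝ := fun x i =>
    (b i + lam * (a' x (i + 1) * q x i) + lam * (a' x (i - 1) * p x (i - 1)))
      / (1 + lam * p x i + lam * q x (i - 1))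
  let box : Set (Finset.Icc 1 m → ℝ) := Icc (fun _ => δ) (fun _ => B)
  have hpos : ∀ x ∈ box, ∀ i, 0 < a' x i := by
    intro x hx i
    simp only [a', extendOne]
    split_ifs with h
    · exact hδ0.trans_le (hx.1 _)
    · exact one_pos
  have hden : ∀ x i j, 0 < 1 + lam * p x i + lam * q x j := fun x i j => by
    have := hp0 x i; have := hq0 x j; positivity
  have hucont : ∀ i, ContinuousOn (fun x => u x i) box := by
    intro i
    have hl : ∀ j, ContinuousOn (fun x => Real.log (a' x j)) box := fun j =>
      ContinuousOn.log (continuous_extendOne m j).continuousOn fun x hx => (hpos x hx j).ne'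
    exact ((((hl _).add (hP _).continuousOn).sub ((hl _).add (hP _).continuousOn)).div_const h).neg
  have hpcont : ∀ i, ContinuousOn (fun x => p x i) box := fun i => by
    simp only [p]
    split_ifs
    · exact (hucont i).sup continuousOn_const
    · exact continuousOn_const
  have hqcont : ∀ i, ContinuousOn (fun x => q x i) box := fun i => by
    simp only [q]
    split_ifs
    · exact ((hucont i).inf continuousOn_const).neg
    · exact continuousOn_const
  have hvcont : ContinuousOn (fun x => fun i => min (val x i) B) box := by
    refine continuousOn_pi.2 fun i => ContinuousOn.inf ?_ continuousOn_const
    have ha : ∀ j, ContinuousOn (fun x => a' x j) box := fun j =>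
      (continuous_extendOne m j).continuousOn
    refine ContinuousOn.div ?_ ?_ fun x _ => (hden x _ _).ne'
    · exact (continuousOn_const.add (continuousOn_const.mul ((ha _).mul (hqcont _)))).add
        (continuousOn_const.mul ((ha _).mul (hpcont _)))
    · exact (continuousOn_const.add (continuousOn_const.mul (hpcont _))).add
        (continuousOn_const.mul (hqcont _))
  -- velocities are bounded on the box
  have hubd : ∀ x ∈ box, ∀ i, 1 ≤ i → i < m →
      |u x i| ≤ 2 * (C + |Real.log B| + |Real.log δ|) / h := by
    intro x hx i h1 h2
    have hx0 : x ∈ Icc (0 : Finset.Icc 1 m → ℝ) (fun _ => B) :=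
      ⟨fun i => (hδ0.le).trans (hx.1 i), hx.2⟩
    have hlog : ∀ j ∈ Finset.Icc 1 m, |Real.log (a' x j)| ≤ |Real.log B| + |Real.log δ| := by
      intro j hj
      have e : a' x j = x ⟨j, hj⟩ := extendOne_of_mem x hj
      rw [e]
      have l1 := Real.log_le_log hδ0 (hx.1 ⟨j, hj⟩)
      have l2 := Real.log_le_log (hδ0.trans_le (hx.1 ⟨j, hj⟩)) (hx.2 ⟨j, hj⟩)
      rw [abs_le]
      constructor
      · linarith [neg_abs_le (Real.log δ), abs_nonneg (Real.log B)]
      · linarith [le_abs_self (Real.log B), abs_nonneg (Real.log δ)]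
    simp only [u]
    rw [abs_neg, abs_div, abs_of_pos hh]
    gcongr
    have e1 := hlog i (by simp; omega)
    have e2 := hlog (i + 1) (by simp; omega)
    have e3 := hC i (by simp; omega) x hx0
    have e4 := hC (i + 1) (by simp; omega) x hx0
    rw [abs_le] at e1 e2 e3 e4 ⊢
    constructor <;> simp only [a'] at * <;> linarith [e1.1, e1.2, e2.1, e2.2, e3.1, e3.2, e4.1, e4.2]
  have hU0 : 0 ≤ 2 * (C + |Real.log B| + |Real.log δ|) / h := by
    have hx0 : (fun _ => 0 : Finset.Icc 1 m → ℝ) ∈ Icc (0 : Finset.Icc 1 m → ℝ) (fun _ => B) :=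
      ⟨le_rfl, fun _ => hB.le⟩
    have := (abs_nonneg _).trans (hC 0 (by simp) _ hx0)
    positivity
  have hmaps : MapsTo (fun x => fun i => min (val x i) B) box box := by
    intro x hx
    refine ⟨fun i => le_min ?_ hδB, fun i => min_le_right _ _⟩
    simp only [val]
    rw [le_div_iff₀ (hden x _ _)]
    have hpU : ∀ i, p x i ≤ 2 * (C + |Real.log B| + |Real.log δ|) / h := by
      intro i
      simp only [p]
      split_ifs with hi
      · exact max_le ((le_abs_self _).trans (hubd x hx i hi.1 hi.2)) hU0
      · exact hU0
    have hqU : ∀ i, q x i ≤ 2 * (C + |Real.log B| + |Real.log δ|) / h := by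
      intro i
      simp only [q]
      split_ifs with hi
      · rw [neg_le]
        exact le_min (by linarith [neg_abs_le (u x i), hubd x hx i hi.1 hi.2]) (by linarith)
      · exact hU0
    have e1 : 0 ≤ lam * (a' x (i + 1) * q x i) :=
      mul_nonneg hlam.le (mul_nonneg (hpos x hx _).le (hq0 _ _))
    have e2 : 0 ≤ lam * (a' x (i - 1) * p x (i - 1)) :=
      mul_nonneg hlam.le (mul_nonneg (hpos x hx _).le (hp0 _ _))
    have e3 : δ * (1 + lam * p x i + lam * q x (i - 1)) ≤
        δ * (1 + 4 * lam / h * (C + |Real.log B| + |Real.log δ|)) := by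
      refine mul_le_mul_of_nonneg_left ?_ hδ0.le
      have f1 := mul_le_mul_of_nonneg_left (hpU i) hlam.le
      have f2 := mul_le_mul_of_nonneg_left (hqU (i - 1)) hlam.le
      have : 4 * lam / h * (C + |Real.log B| + |Real.log δ|)
        = lam * (2 * (C + |Real.log B| + |Real.log δ|) / h)
          + lam * (2 * (C + |Real.log B| + |Real.log δ|) / h) := by ring
      linarith
    have e4 := hmin i i.2
    linarith
  obtain ⟨x, hx, hfix⟩ := exists_fixedPoint_Icc (fun _ => hδB) hvcont hmaps
  have hxa : ∀ i (hi : i ∈ Finset.Icc 1 m), a' x i = x ⟨i, hi⟩ := fun i hi => extendOne_of_mem x hi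
  have hle : ∀ i ∈ Finset.Icc 1 m,
      a' x i - b i + lam * (upwind m (u x) (a' x) i - upwind m (u x) (a' x) (i - 1)) ≤ 0 := by
    intro i hi
    have e1 : a' x i ≤ val x ⟨i, hi⟩ := by
      rw [hxa i hi, ← congrFun hfix ⟨i, hi⟩]
      exact min_le_left _ _
    simp only [val] at e1
    rw [le_div_iff₀ (hden x _ _)] at e1
    have hi1 : i - 1 + 1 = i := Nat.sub_add_cancel (Finset.mem_Icc.1 hi).1
    rw [hF, hF, hi1]
    linarith
  have hsum : ∑ i ∈ Finset.Icc 1 m, a' x i ≤ ∑ i ∈ Finset.Icc 1 m, b i := by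
    have h1 := Finset.sum_nonpos hle
    rw [Finset.sum_add_distrib, Finset.sum_sub_distrib, ← Finset.mul_sum,
      sum_div_eq_zero m _ (upwind_zero _ _ _) (upwind_last _ _ _)] at h1
    linarith
  refine ⟨a' x, fun i _ => hpos x hx i, fun i hi => ?_⟩
  have hlt : a' x i < B := by
    have := Finset.single_le_sum (f := a' x) (fun j _ => (hpos x hx j).le) hi
    linarith
  have e1 : a' x i = val x ⟨i, hi⟩ := by
    have e := congrFun hfix ⟨i, hi⟩
    rw [← hxa i hi] at e
    rcases min_choice (val x ⟨i, hi⟩) B with h | h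
    · rw [h] at e; exact e.symm
    · rw [h] at e; exact absurd e hlt.ne'
  simp only [val] at e1
  rw [eq_div_iff (hden x _ _).ne'] at e1
  have hi1 : i - 1 + 1 = i := Nat.sub_add_cancel (Finset.mem_Icc.1 hi).1
  change a' x i - b i = -(lam * (upwind m (u x) (a' x) i - upwind m (u x) (a' x) (i - 1)))
  rw [hF, hF, hi1]
  linarith

/-! ### The mesh and cell averages -/

lemma deriv_boltzmann {s : ℝ} (hs : 0 < s) : deriv boltzmann s = Real.log s := by
  have h : HasDerivAt boltzmann (Real.log s + 1 - 1) s :=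
    (Real.hasDerivAt_mul_log hs.ne').sub (hasDerivAt_id s)
  rw [h.deriv, add_sub_cancel_right]

lemma stepX_pos {L : ℝ} (hL : 0 < L) {M : ℕ} (hM : 1 ≤ M) : 0 < stepX L M :=
  div_pos hL (by exact_mod_cast hM)

lemma stepT_pos {T : ℝ} (hT : 0 < T) (N : ℕ) : 0 < stepT T N :=
  div_pos hT (by positivity)

lemma stepX_mul {L : ℝ} {M : ℕ} (hM : 1 ≤ M) : stepX L M * ((2 * M : ℕ) : ℝ) = 2 * L := by
  have : (M : ℝ) ≠ 0 := by exact_mod_cast (by omega : M ≠ 0)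
  rw [stepX]
  push_cast
  field_simp

lemma stepT_mul (T : ℝ) (N : ℕ) : ((N : ℝ) + 1) * stepT T N = T := by
  have : (N : ℝ) + 1 ≠ 0 := by positivity
  rw [stepT]
  field_simp

lemma measurableSet_cell (L : ℝ) (M i : ℕ) : MeasurableSet (cell L M i) := measurableSet_Ico

lemma cell_subset {L : ℝ} (hL : 0 < L) {M : ℕ} (hM : 1 ≤ M) {i : ℕ}
    (hi : i ∈ Finset.Icc 1 (2 * M)) : cell L M i ⊆ Ico (-L) L := by
  have hX := stepX_pos hL hM
  obtain ⟨h1, h2⟩ := Finset.mem_Icc.1 hi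
  have h1' : (1 : ℝ) ≤ i := by exact_mod_cast h1
  have h2' : (i : ℝ) ≤ ((2 * M : ℕ) : ℝ) := by exact_mod_cast h2
  have h3 := stepX_mul (L := L) hM
  apply Ico_subset_Ico
  · nlinarith
  · nlinarith

lemma ae_restrict_cell {L : ℝ} (hL : 0 < L) {M : ℕ} (hM : 1 ≤ M) {i : ℕ}
    (hi : i ∈ Finset.Icc 1 (2 * M)) {p : ℝ → Prop}
    (h : ∀ᵐ x ∂(volume.restrict (dom L)), p x) : ∀ᵐ x ∂(volume.restrict (cell L M i)), p x := by
  rw [dom, Measure.restrict_congr_set Ioo_ae_eq_Ico] at h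
  exact ae_mono (Measure.restrict_mono (cell_subset hL hM hi) le_rfl) h

lemma integrableOn_cell {L : ℝ} (hL : 0 < L) {M : ℕ} (hM : 1 ≤ M) {i : ℕ}
    (hi : i ∈ Finset.Icc 1 (2 * M)) {f : ℝ → ℝ} (h : IntegrableOn f (dom L)) :
    IntegrableOn f (cell L M i) := by
  have : IntegrableOn f (Ico (-L) L) := h.congr_set_ae Ioo_ae_eq_Ico.symm
  exact this.mono_set (cell_subset hL hM hi)

lemma volume_real_cell {L : ℝ} (hL : 0 < L) {M : ℕ} (hM : 1 ≤ M) (i : ℕ) :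
    volume.real (cell L M i) = stepX L M := by
  have := stepX_pos hL hM
  rw [cell, Real.volume_real_Ico_of_le (by nlinarith)]
  ring

lemma average_cell {L : ℝ} (hL : 0 < L) {M : ℕ} (hM : 1 ≤ M) (i : ℕ) (f : ℝ → ℝ) :
    stepX L M * ⨍ x in cell L M i, f x = ∫ x in cell L M i, f x := by
  rw [setAverage_eq, volume_real_cell hL hM, smul_eq_mul, mul_inv_cancel_left₀]
  exact (stepX_pos hL hM).ne'

lemma average_cell_mem {L : ℝ} (hL : 0 < L) {M : ℕ} (hM : 1 ≤ M) {i : ℕ}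
    {f : ℝ → ℝ} (hf : IntegrableOn f (cell L M i)) {a b : ℝ}
    (h : ∀ᵐ x ∂(volume.restrict (cell L M i)), f x ∈ Icc a b) :
    (⨍ x in cell L M i, f x) ∈ Icc a b := by
  have hv := volume_real_cell hL hM i
  have hX := stepX_pos hL hM
  refine (convex_Icc a b).set_average_mem isClosed_Icc ?_ ?_ h hf
  · intro h0
    rw [Measure.real, h0] at hv
    simp at hv
    linarith
  · exact measure_Ico_lt_top.ne

/-- Sum of a function over all cells is its integral over the domain. -/
lemma sum_integral_cell {L : ℝ} (hL : 0 < L) {M : ℕ} (hM : 1 ≤ M) {f : ℝ → ℝ}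
    (hf : IntegrableOn f (dom L)) :
    ∑ i ∈ Finset.Icc 1 (2 * M), ∫ x in cell L M i, f x = ∫ x in dom L, f x := by
  have hX := stepX_pos hL hM
  have hcell : ∀ k : ℕ, cell L M (k + 1) =
      Ico (-L + stepX L M * (k : ℝ)) (-L + stepX L M * ((k + 1 : ℕ) : ℝ)) := by
    intro k; rw [cell]; push_cast; simp
  have e : ∀ k : ℕ, ∫ x in cell L M (k + 1), f x =
      ∫ x in (-L + stepX L M * (k : ℝ))..(-L + stepX L M * ((k + 1 : ℕ) : ℝ)), f x := by
    intro k
    rw [hcell, intervalIntegral.integral_of_le (by push_cast; nlinarith), integral_Ico_eq_integral_Ioc]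
  rw [sum_Icc_one_eq_sum_range, Finset.sum_congr rfl fun k _ => e k,
    intervalIntegral.sum_integral_adjacent_intervals
      (a := fun k : ℕ => -L + stepX L M * (k : ℝ)) (n := 2 * M)]
  · simp only [Nat.cast_zero, mul_zero, add_zero]
    rw [stepX_mul hM, intervalIntegral.integral_of_le (by linarith), dom,
      integral_Ioc_eq_integral_Ioo]
    congr 2; ring_nf
  · intro k hk
    rw [intervalIntegrable_iff_integrableOn_Ico_of_le (by push_cast; nlinarith), ← hcell]
    exact integrableOn_cell hL hM (by simp; omega) hf

lemma integrableOn_dom_of_memLp_top {L : ℝ} {f : ℝ → ℝ}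
    (hf : MemLp f ∞ (volume.restrict (dom L))) : IntegrableOn f (dom L) := by
  have : IsFiniteMeasure (volume.restrict (dom L)) :=
    ⟨by rw [Measure.restrict_apply_univ]; exact measure_Ioo_lt_top⟩
  exact hf.integrable (by simp)

/-! ### The scheme -/

lemma flux_eq_upwind (L : ℝ) (M : ℕ) (H V W : ℝ → ℝ) (r : ℕ → ℕ → ℝ) (n i : ℕ) :
    flux L M H V W r n i = upwind (2 * M) (velocity L M H V W r n) (r (n + 1)) i := rfl

lemma flux_zero (L : ℝ) (M : ℕ) (H V W : ℝ → ℝ) (r : ℕ → ℕ → ℝ) (n : ℕ) :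
    flux L M H V W r n 0 = 0 := upwind_zero _ _ _

lemma flux_last (L : ℝ) (M : ℕ) (H V W : ℝ → ℝ) (r : ℕ → ℕ → ℝ) (n : ℕ) :
    flux L M H V W r n (2 * M) = 0 := upwind_last _ _ _

/-- The discrete potential `V_i + (W ∗ θ)_i`, where `θ` is the mean of two consecutive densities. -/
def discPot (L : ℝ) (M : ℕ) (V W : ℝ → ℝ) (r : ℕ → ℕ → ℝ) (n i : ℕ) : ℝ :=
  avgV L M V i + discConv L M W (fun j => (r n j + r (n + 1) j) / 2) i

lemma entropyVar_eq {L : ℝ} {M : ℕ} {V W : ℝ → ℝ} {r : ℕ → ℕ → ℝ} {n i : ℕ}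
    (h : 0 < r (n + 1) i) : entropyVar L M boltzmann V W r n i =
      Real.log (r (n + 1) i) + discPot L M V W r n i := by
  rw [entropyVar, deriv_boltzmann h, discPot, add_assoc]

lemma IsSchemeSol.increment {L T : ℝ} (hT : 0 < T) {M N : ℕ} {H V W ρ₀ : ℝ → ℝ} {r : ℕ → ℕ → ℝ}
    (h : IsSchemeSol L T M N H V W ρ₀ r) {n : ℕ} (hn : n ≤ N) {i : ℕ}
    (hi : i ∈ Finset.Icc 1 (2 * M)) :
    r (n + 1) i - r n i = -(stepT T N / stepX L M *
      (flux L M H V W r n i - flux L M H V W r n (i - 1))) := by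
  have h1 := h.step n hn i hi
  have hτ := (stepT_pos hT N).ne'
  rw [div_eq_iff hτ] at h1
  rw [h1]
  ring

lemma IsSchemeSol.sum_eq {L T : ℝ} (hT : 0 < T) {M N : ℕ} {H V W ρ₀ : ℝ → ℝ} {r : ℕ → ℕ → ℝ}
    (h : IsSchemeSol L T M N H V W ρ₀ r) {n : ℕ} (hn : n ≤ N + 1) :
    ∑ i ∈ Finset.Icc 1 (2 * M), r n i = ∑ i ∈ Finset.Icc 1 (2 * M), r 0 i := by
  induction n with
  | zero => rfl
  | succ n ih =>
    rw [← ih (by omega), ← sub_eq_zero, ← Finset.sum_sub_distrib,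
      Finset.sum_congr rfl fun i hi => h.increment hT (by omega : n ≤ N) hi,
      Finset.sum_neg_distrib, ← Finset.mul_sum,
      sum_div_eq_zero _ _ (flux_zero _ _ _ _ _ _ _) (flux_last _ _ _ _ _ _ _)]
    simp

/-- Conservation of mass. -/
lemma IsSchemeSol.mass_eq {L T : ℝ} (hL : 0 < L) (hT : 0 < T) {M N : ℕ} (hM : 1 ≤ M)
    {H V W ρ₀ : ℝ → ℝ} {r : ℕ → ℕ → ℝ} (hρ₀ : IntegrableOn ρ₀ (dom L))
    (h : IsSchemeSol L T M N H V W ρ₀ r) {n : ℕ} (hn : n ≤ N + 1) :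
    ∑ i ∈ Finset.Icc 1 (2 * M), r n i * stepX L M = ∫ x in dom L, ρ₀ x := by
  rw [← Finset.sum_mul, h.sum_eq hT hn, Finset.sum_mul, ← sum_integral_cell hL hM hρ₀]
  refine Finset.sum_congr rfl fun i hi => ?_
  rw [h.init i hi, mul_comm, average_cell hL hM]

/-- One implicit step of the scheme has a strictly positive solution. -/
lemma exists_scheme_step {L T : ℝ} (hL : 0 < L) (hT : 0 < T) (V W : ℝ → ℝ) {M : ℕ} (N : ℕ)
    (hM : 1 ≤ M) (b : ℕ → ℝ) (hb : ∀ i ∈ Finset.Icc 1 (2 * M), 0 < b i) :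
    ∃ a : ℕ → ℝ, (∀ i ∈ Finset.Icc 1 (2 * M), 0 < a i) ∧
      ∀ i ∈ Finset.Icc 1 (2 * M), (a i - b i) / stepT T N =
        -((flux L M boltzmann V W (fun k => if k = 0 then b else a) 0 i
          - flux L M boltzmann V W (fun k => if k = 0 then b else a) 0 (i - 1)) / stepX L M) := by
  have hX := stepX_pos hL hM
  have hτ := stepT_pos hT N
  obtain ⟨a, ha, hstep⟩ := exists_upwind_step (2 * M) (div_pos hτ hX) hX b hb
    (fun a i => avgV L M V i + discConv L M W (fun j => (b j + a j) / 2) i) (by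
      intro i
      refine continuous_const.add (continuous_finsetSum _ fun j _ => ?_)
      have := continuous_extendOne (2 * M) j
      fun_prop)
  refine ⟨a, ha, fun i hi => ?_⟩
  have hflux : ∀ j, flux L M boltzmann V W (fun k => if k = 0 then b else a) 0 j =
      upwind (2 * M) (fun i => -((Real.log (a (i + 1))
        + (avgV L M V (i + 1) + discConv L M W (fun j => (b j + a j) / 2) (i + 1))
        - (Real.log (a i) + (avgV L M V i + discConv L M W (fun j => (b j + a j) / 2) i)))
          / stepX L M)) a j := by
    intro j
    rw [flux_eq_upwind]
    by_cases hj : 1 ≤ j ∧ j < 2 * M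
    · have h1 : velocity L M boltzmann V W (fun k => if k = 0 then b else a) 0 j =
        -((Real.log (a (j + 1))
        + (avgV L M V (j + 1) + discConv L M W (fun j => (b j + a j) / 2) (j + 1))
        - (Real.log (a j) + (avgV L M V j + discConv L M W (fun j => (b j + a j) / 2) j)))
          / stepX L M) := by
        rw [velocity, entropyVar_eq, entropyVar_eq]
        · simp [discPot]
        · simpa using ha j (by simp; omega)
        · simpa using ha (j + 1) (by simp; omega)
      rw [upwind, upwind, if_pos hj, if_pos hj, h1]
      rfl
    · rw [upwind, upwind, if_neg hj, if_neg hj]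
  rw [hflux, hflux, hstep i hi]
  field_simp

/-- Existence of a strictly positive, mass-preserving solution of the scheme. -/
theorem exists_isSchemeSol {L T : ℝ} (hL : 0 < L) (hT : 0 < T) (V W : ℝ → ℝ) {ρ₀ : ℝ → ℝ}
    (hρ₀ : MemLp ρ₀ ∞ (volume.restrict (dom L)))
    (hpos : ∃ ε : ℝ, 0 < ε ∧ ∀ᵐ x ∂(volume.restrict (dom L)), ε ≤ ρ₀ x) (M N : ℕ) (hM : 1 ≤ M) :
    ∃ r : ℕ → ℕ → ℝ, IsSchemeSol L T M N boltzmann V W ρ₀ r ∧ IsPositive M N r ∧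
      ∀ n ≤ N + 1, ∑ i ∈ Finset.Icc 1 (2 * M), r n i * stepX L M = ∫ x in dom L, ρ₀ x := by
  obtain ⟨ε, hε, hle⟩ := hpos
  have hintg := integrableOn_dom_of_memLp_top hρ₀
  have h0 : ∀ i ∈ Finset.Icc 1 (2 * M), 0 < ⨍ x in cell L M i, ρ₀ x := by
    intro i hi
    have h1 := ae_restrict_cell hL hM hi hle
    have h2 := average_cell hL hM i ρ₀
    have h3 : ∫ x in cell L M i, ε ≤ ∫ x in cell L M i, ρ₀ x :=
      integral_mono_ae (integrableOn_const measure_Ico_lt_top.ne) (integrableOn_cell hL hM hi hintg) h1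
    rw [setIntegral_const, volume_real_cell hL hM, smul_eq_mul, ← h2] at h3
    exact hε.trans_le (le_of_mul_le_mul_left h3 (stepX_pos hL hM))
  choose! S hS using fun b hb => exists_scheme_step hL hT V W N hM b hb
  let r : ℕ → ℕ → ℝ := fun n => Nat.rec (fun i => ⨍ x in cell L M i, ρ₀ x) (fun _ b => S b) n
  have hr : ∀ n, ∀ i ∈ Finset.Icc 1 (2 * M), 0 < r n i := by
    intro n
    induction n with
    | zero => exact h0
    | succ n ih => exact (hS (r n) ih).1
  have hsol : IsSchemeSol L T M N boltzmann V W ρ₀ r :=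
    ⟨fun i _ => rfl, fun n _ i hi => (hS (r n) (hr n)).2 i hi⟩
  exact ⟨r, hsol, fun n _ => hr n, fun n hn => hsol.mass_eq hL hT hM hintg hn⟩

/-! ### Differences of the discrete potential -/

/-- Bounds for a `C²` function on a compact interval, its first and its second differences. -/
lemma exists_difference_bounds {f : ℝ → ℝ} {a b : ℝ} (hab : a < b)
    (hf : ContDiffOn ℝ 2 f (Icc a b)) : ∃ K : ℝ, 0 ≤ K ∧ (∀ x ∈ Icc a b, |f x| ≤ K) ∧
      (∀ x ∈ Icc a b, ∀ y ∈ Icc a b, |f x - f y| ≤ K * |x - y|) ∧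
      ∀ x h, 0 ≤ h → x - h ∈ Icc a b → x + h ∈ Icc a b →
        |f (x + h) - 2 * f x + f (x - h)| ≤ K * h ^ 2 := by
  have hu : UniqueDiffOn ℝ (Icc a b) := uniqueDiffOn_Icc hab
  obtain ⟨K₀, hK₀⟩ := (isCompact_Icc (a := a) (b := b)).exists_bound_of_continuousOn hf.continuousOn
  obtain ⟨K₁, hK₁⟩ := LocallyLipschitzOn.exists_lipschitzOnWith_of_compact
    (isCompact_Icc (a := a) (b := b))
    (ContDiffOn.locallyLipschitzOn (convex_Icc a b) (hf.of_le (by norm_num)))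
  obtain ⟨K₂, hK₂⟩ := LocallyLipschitzOn.exists_lipschitzOnWith_of_compact
    (isCompact_Icc (a := a) (b := b))
    (ContDiffOn.locallyLipschitzOn (convex_Icc a b)
      (hf.derivWithin hu (m := 1) (by norm_num)))
  have hK₀' : 0 ≤ |K₀| := abs_nonneg _
  refine ⟨|K₀| + K₁ + K₂, by positivity, fun x hx => ?_, fun x hx y hy => ?_,
    fun x h hh h1 h2 => ?_⟩
  · have := (hK₀ x hx).trans (le_abs_self K₀)
    rw [Real.norm_eq_abs] at this
    linarith [K₁.2, K₂.2, K₁.coe_nonneg, K₂.coe_nonneg]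
  · have := hK₁.dist_le_mul x hx y hy
    rw [Real.dist_eq, Real.dist_eq] at this
    refine this.trans (mul_le_mul_of_nonneg_right ?_ (abs_nonneg _))
    linarith [K₂.coe_nonneg]
  · have hd : ∀ y ∈ Icc (x - h) x, HasDerivWithinAt (fun y => f (y + h) - f y)
        (derivWithin f (Icc a b) (y + h) - derivWithin f (Icc a b) y) (Icc (x - h) x) y := by
      intro y hy
      have hy1 : y ∈ Icc a b := ⟨h1.1.trans hy.1, by linarith [hy.2, h2.2]⟩
      have hy2 : y + h ∈ Icc a b := ⟨by linarith [h1.1, hy.1], by linarith [hy.2, h2.2]⟩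
      have d1 := (hf.differentiableOn (by norm_num) y hy1).hasDerivWithinAt
      have d2 := (hf.differentiableOn (by norm_num) _ hy2).hasDerivWithinAt
      have e1 : HasDerivWithinAt f (derivWithin f (Icc a b) y) (Icc (x - h) x) y :=
        d1.mono (Icc_subset_Icc h1.1 (by linarith [h2.2]))
      have e2 : HasDerivWithinAt (fun y => f (y + h)) (derivWithin f (Icc a b) (y + h) * 1)
          (Icc (x - h) x) y := by
        refine HasDerivWithinAt.comp y d2 ((hasDerivWithinAt_id y _).add_const h) ?_
        intro z hz
        exact ⟨by linarith [h1.1, hz.1], by linarith [hz.2, h2.2]⟩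
      rw [mul_one] at e2
      exact e2.sub e1
    have hb : ∀ y ∈ Icc (x - h) x,
        ‖derivWithin f (Icc a b) (y + h) - derivWithin f (Icc a b) y‖ ≤ K₂ * h := by
      intro y hy
      have hy1 : y ∈ Icc a b := ⟨h1.1.trans hy.1, by linarith [hy.2, h2.2]⟩
      have hy2 : y + h ∈ Icc a b := ⟨by linarith [h1.1, hy.1], by linarith [hy.2, h2.2]⟩
      have := hK₂.dist_le_mul (y + h) hy2 y hy1
      rwa [Real.dist_eq, Real.dist_eq, add_sub_cancel_left, abs_of_nonneg hh] at this
    have := (convex_Icc (x - h) x).norm_image_sub_le_of_norm_hasDerivWithin_le hd hb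
      (left_mem_Icc.2 (by linarith)) (right_mem_Icc.2 (by linarith))
    simp only [sub_add_cancel, sub_sub_cancel, Real.norm_eq_abs, abs_of_nonneg hh] at this
    have e : f (x + h) - 2 * f x + f (x - h) = f (x + h) - f x - (f x - f (x - h)) := by ring
    rw [e]
    refine this.trans ?_
    have : 0 ≤ (|K₀| + K₁) * h ^ 2 := by positivity
    nlinarith

lemma abs_average_cell_le {L : ℝ} (hL : 0 < L) {M : ℕ} (hM : 1 ≤ M) {i : ℕ} {f : ℝ → ℝ} {C : ℝ}
    (h : ∀ x ∈ cell L M i, |f x| ≤ C) : |⨍ x in cell L M i, f x| ≤ C := by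
  have hX := stepX_pos hL hM
  have h1 := norm_setIntegral_le_of_norm_le_const (μ := volume) (s := cell L M i)
    measure_Ico_lt_top (f := f) (C := C) h
  rw [volume_real_cell hL hM, ← average_cell hL hM, norm_mul, Real.norm_of_nonneg hX.le,
    mul_comm C] at h1
  exact le_of_mul_le_mul_left h1 hX

lemma average_cell_sub {L : ℝ} (M : ℕ) {i : ℕ} {f g : ℝ → ℝ}
    (hf : IntegrableOn f (cell L M i)) (hg : IntegrableOn g (cell L M i)) :
    (⨍ x in cell L M i, f x) - (⨍ x in cell L M i, g x) = ⨍ x in cell L M i, (f x - g x) := by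
  rw [setAverage_eq, setAverage_eq, setAverage_eq, integral_sub hf hg, smul_sub]

lemma average_cell_secondDiff {L : ℝ} (M : ℕ) {i : ℕ} {f g k : ℝ → ℝ}
    (hf : IntegrableOn f (cell L M i)) (hg : IntegrableOn g (cell L M i))
    (hk : IntegrableOn k (cell L M i)) :
    (⨍ x in cell L M i, f x) - 2 * (⨍ x in cell L M i, g x) + (⨍ x in cell L M i, k x)
      = ⨍ x in cell L M i, (f x - 2 * g x + k x) := by
  rw [setAverage_eq, setAverage_eq, setAverage_eq, setAverage_eq,
    integral_add (f := fun x => f x - 2 * g x) (hf.sub (hg.const_mul 2)) hk, integral_sub hf (hg.const_mul 2), integral_const_mul]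
  simp only [smul_eq_mul]
  ring

lemma integral_cell_succ (L : ℝ) (M i : ℕ) (f : ℝ → ℝ) :
    ∫ x in cell L M (i + 1), f x = ∫ x in cell L M i, f (x + stepX L M) := by
  have h := (measurePreserving_add_right (volume : Measure ℝ) (stepX L M)).setIntegral_preimage_emb
    (measurableEmbedding_addRight _) f (cell L M (i + 1))
  rw [← h]
  congr 2
  rw [cell, cell, preimage_add_const_Ico]
  congr 1 <;> push_cast <;> ring

lemma average_cell_succ {L : ℝ} (hL : 0 < L) {M : ℕ} (hM : 1 ≤ M) (i : ℕ) (f : ℝ → ℝ) :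
    (⨍ x in cell L M (i + 1), f x) = ⨍ x in cell L M i, f (x + stepX L M) := by
  rw [setAverage_eq, setAverage_eq, integral_cell_succ, volume_real_cell hL hM,
    volume_real_cell hL hM]

lemma centre_succ (L : ℝ) (M i : ℕ) : centre L M (i + 1) = centre L M i + stepX L M := by
  rw [centre, centre]; push_cast; ring

lemma centre_mem_cell {L : ℝ} (hL : 0 < L) {M : ℕ} (hM : 1 ≤ M) (i : ℕ) :
    centre L M i ∈ cell L M i := by
  have := stepX_pos hL hM
  constructor <;> simp only [centre] <;> nlinarith

lemma centre_sub_mem {L : ℝ} (hL : 0 < L) {M : ℕ} (hM : 1 ≤ M) {i j : ℕ}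
    (hi : i ∈ Finset.Icc 1 (2 * M)) (hj : j ∈ Finset.Icc 1 (2 * M)) {s : ℝ} (hs : s ∈ cell L M j) :
    centre L M i - s ∈ Icc (-(2 * L)) (2 * L) := by
  have h1 := cell_subset hL hM hi (centre_mem_cell hL hM i)
  have h2 := cell_subset hL hM hj hs
  constructor <;> linarith [h1.1, h1.2, h2.1, h2.2]

lemma integrableOn_cell_of_continuousOn {L : ℝ} {M j : ℕ} {f : ℝ → ℝ} {a b : ℝ}
    (hf : ContinuousOn f (Icc a b)) {c e : ℝ}
    (h : ∀ s ∈ cell L M j, c + e * s ∈ Icc a b) :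
    IntegrableOn (fun s => f (c + e * s)) (cell L M j) := by
  obtain ⟨C, hC⟩ := (isCompact_Icc (a := a) (b := b)).exists_bound_of_continuousOn hf
  have hm : AEStronglyMeasurable (fun s => f (c + e * s)) (volume.restrict (cell L M j)) := by
    refine ContinuousOn.aestronglyMeasurable ?_ (measurableSet_cell L M j)
    exact hf.comp (by fun_prop) h
  refine Integrable.mono' (g := fun _ => C) (integrableOn_const measure_Ico_lt_top.ne) hm ?_
  filter_upwards [self_mem_ae_restrict (measurableSet_cell L M j)] with s hs using hC _ (h s hs)

/-- First and second differences of the discrete potential are controlled by the mass. -/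
lemma exists_discPot_bounds {L : ℝ} (hL : 0 < L) {V W : ℝ → ℝ}
    (hV : ContDiffOn ℝ 2 V (Icc (-L) L)) (hW : ContDiffOn ℝ 2 W (Icc (-(2 * L)) (2 * L))) (m : ℝ) :
    ∃ K : ℝ, 0 ≤ K ∧ ∀ (M : ℕ) (r : ℕ → ℕ → ℝ) (n : ℕ), 1 ≤ M →
      (∀ j ∈ Finset.Icc 1 (2 * M), 0 < r n j) → (∀ j ∈ Finset.Icc 1 (2 * M), 0 < r (n + 1) j) →
      ∑ j ∈ Finset.Icc 1 (2 * M), r n j * stepX L M = m →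
      ∑ j ∈ Finset.Icc 1 (2 * M), r (n + 1) j * stepX L M = m →
      (∀ i, 1 ≤ i → i < 2 * M →
        |discPot L M V W r n (i + 1) - discPot L M V W r n i| ≤ K * stepX L M) ∧
      ∀ i, 1 ≤ i → i + 1 < 2 * M → |discPot L M V W r n (i + 2) - 2 * discPot L M V W r n (i + 1)
        + discPot L M V W r n i| ≤ K * stepX L M ^ 2 := by
  obtain ⟨K₁, hK₁, -, hV1, hV2⟩ := exists_difference_bounds (by linarith : -L < L) hV
  obtain ⟨K₂, hK₂, -, hW1, hW2⟩ := exists_difference_bounds (by linarith : -(2 * L) < 2 * L) hW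
  refine ⟨K₁ + K₂ * |m|, by positivity, fun M r n hM hr hr' hm hm' => ?_⟩
  have hX := stepX_pos hL hM
  have hVint : ∀ i ∈ Finset.Icc 1 (2 * M), IntegrableOn V (cell L M i) := fun i hi => by
    have := integrableOn_cell_of_continuousOn (L := L) (M := M) (j := i) hV.continuousOn
      (c := 0) (e := 1) (fun s hs => by
        rw [zero_add, one_mul]; exact Ico_subset_Icc_self (cell_subset hL hM hi hs))
    simpa using this
  have hshift : ∀ i, ∀ s ∈ cell L M i, s + stepX L M ∈ cell L M (i + 1) := by
    intro i s hs
    rw [cell] at hs ⊢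
    push_cast
    constructor <;> nlinarith [hs.1, hs.2]
  have hVint' : ∀ i c, i ∈ Finset.Icc 1 (2 * M) →
      (∀ s ∈ cell L M i, s + c ∈ Icc (-L) L) → IntegrableOn (fun s => V (s + c)) (cell L M i) :=
    fun i c hi hc => by
    have := integrableOn_cell_of_continuousOn (L := L) (M := M) (j := i) hV.continuousOn
      (c := c) (e := 1) (fun s hs => by
        rw [one_mul, add_comm]; exact hc s hs)
    simpa [add_comm] using this
  have hWint : ∀ i ∈ Finset.Icc 1 (2 * M), ∀ j ∈ Finset.Icc 1 (2 * M),
      IntegrableOn (fun s => W (centre L M i - s)) (cell L M j) := fun i hi j hj => by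
    have := integrableOn_cell_of_continuousOn (L := L) (M := M) (j := j) hW.continuousOn
      (c := centre L M i) (e := -1) (fun s hs => by
        have := centre_sub_mem hL hM hi hj hs
        rwa [neg_one_mul, ← sub_eq_add_neg])
    simpa [sub_eq_add_neg] using this
  set θ : ℕ → ℝ := fun j => (r n j + r (n + 1) j) / 2 with hθ
  have hθ0 : ∀ j ∈ Finset.Icc 1 (2 * M), 0 ≤ θ j * stepX L M := fun j hj => by
    have := hr j hj; have := hr' j hj; positivity
  have hθs : ∑ j ∈ Finset.Icc 1 (2 * M), θ j * stepX L M = m := by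
    have : ∀ j, θ j * stepX L M = (r n j * stepX L M + r (n + 1) j * stepX L M) / 2 := fun j => by
      simp only [hθ]; ring
    simp_rw [this]
    rw [← Finset.sum_div, Finset.sum_add_distrib, hm, hm']
    ring
  have hsum : ∀ (g : ℕ → ℝ) (C : ℝ), 0 ≤ C → (∀ j ∈ Finset.Icc 1 (2 * M), |g j| ≤ C) →
      |∑ j ∈ Finset.Icc 1 (2 * M), g j * θ j * stepX L M| ≤ C * |m| := by
    intro g C hC hg
    refine (Finset.abs_sum_le_sum_abs _ _).trans ?_
    calc ∑ j ∈ Finset.Icc 1 (2 * M), |g j * θ j * stepX L M|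
        ≤ ∑ j ∈ Finset.Icc 1 (2 * M), C * (θ j * stepX L M) := by
          refine Finset.sum_le_sum fun j hj => ?_
          rw [mul_assoc, abs_mul, abs_of_nonneg (hθ0 j hj)]
          exact mul_le_mul_of_nonneg_right (hg j hj) (hθ0 j hj)
      _ = C * m := by rw [← Finset.mul_sum, hθs]
      _ ≤ C * |m| := mul_le_mul_of_nonneg_left (le_abs_self m) hC
  constructor
  · intro i h1 h2
    have hi : i ∈ Finset.Icc 1 (2 * M) := by simp; omega
    have hi' : i + 1 ∈ Finset.Icc 1 (2 * M) := by simp; omega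
    have eV : |avgV L M V (i + 1) - avgV L M V i| ≤ K₁ * stepX L M := by
      rw [avgV, avgV, average_cell_succ hL hM, average_cell_sub]
      · refine abs_average_cell_le hL hM fun s hs => ?_
        have := hV1 (s + stepX L M) (Ico_subset_Icc_self (cell_subset hL hM hi' (hshift i s hs)))
          s (Ico_subset_Icc_self (cell_subset hL hM hi hs))
        rwa [add_sub_cancel_left, abs_of_pos hX] at this
      · exact hVint' i _ hi fun s hs =>
          Ico_subset_Icc_self (cell_subset hL hM hi' (hshift i s hs))
      · exact hVint i hi
    have eW : |∑ j ∈ Finset.Icc 1 (2 * M), (avgW L M W (i + 1) j - avgW L M W i j) * θ j * stepX L M|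
        ≤ K₂ * stepX L M * |m| := by
      refine hsum _ _ (by positivity) fun j hj => ?_
      rw [avgW, avgW, average_cell_sub _ (hWint _ hi' j hj) (hWint _ hi j hj)]
      refine abs_average_cell_le hL hM fun s hs => ?_
      have := hW1 _ (centre_sub_mem hL hM hi' hj hs) _ (centre_sub_mem hL hM hi hj hs)
      rw [centre_succ] at this ⊢
      rwa [show centre L M i + stepX L M - s - (centre L M i - s) = stepX L M by ring,
        abs_of_pos hX] at this
    have e : discPot L M V W r n (i + 1) - discPot L M V W r n i =
        (avgV L M V (i + 1) - avgV L M V i) +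
        ∑ j ∈ Finset.Icc 1 (2 * M), (avgW L M W (i + 1) j - avgW L M W i j) * θ j * stepX L M := by
      simp only [discPot, discConv, sub_mul, Finset.sum_sub_distrib]
      ring
    rw [e]
    refine (abs_add_le _ _).trans ?_
    linarith
  · intro i h1 h2
    have hi : i ∈ Finset.Icc 1 (2 * M) := by simp; omega
    have hi' : i + 1 ∈ Finset.Icc 1 (2 * M) := by simp; omega
    have hi'' : i + 2 ∈ Finset.Icc 1 (2 * M) := by simp; omega
    have m1 : ∀ s ∈ cell L M i, s ∈ Icc (-L) L := fun s hs =>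
      Ico_subset_Icc_self (cell_subset hL hM hi hs)
    have m2 : ∀ s ∈ cell L M i, s + stepX L M ∈ Icc (-L) L := fun s hs =>
      Ico_subset_Icc_self (cell_subset hL hM hi' (hshift i s hs))
    have m3 : ∀ s ∈ cell L M i, s + stepX L M + stepX L M ∈ Icc (-L) L := fun s hs =>
      Ico_subset_Icc_self (cell_subset hL hM hi'' (hshift (i + 1) _ (hshift i s hs)))
    have eV : |avgV L M V (i + 2) - 2 * avgV L M V (i + 1) + avgV L M V i|
        ≤ K₁ * stepX L M ^ 2 := by
      have i3 : IntegrableOn (fun s => V (s + stepX L M + stepX L M)) (cell L M i) := by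
        simp only [add_assoc]
        exact hVint' i _ hi fun s hs => by rw [← add_assoc]; exact m3 s hs
      rw [avgV, avgV, avgV, average_cell_succ hL hM (i + 1), average_cell_succ hL hM i,
        average_cell_succ hL hM i,
        average_cell_secondDiff _ i3 (hVint' i _ hi m2) (hVint i hi)]
      refine abs_average_cell_le hL hM fun s hs => ?_
      have := hV2 (s + stepX L M) (stepX L M) hX.le (by simpa using m1 s hs) (m3 s hs)
      rwa [add_sub_cancel_right] at this
    have eW : |∑ j ∈ Finset.Icc 1 (2 * M), (avgW L M W (i + 2) j - 2 * avgW L M W (i + 1) j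
        + avgW L M W i j) * θ j * stepX L M| ≤ K₂ * stepX L M ^ 2 * |m| := by
      refine hsum _ _ (by positivity) fun j hj => ?_
      rw [avgW, avgW, avgW, average_cell_secondDiff _ (hWint _ hi'' j hj) (hWint _ hi' j hj)
        (hWint _ hi j hj)]
      refine abs_average_cell_le hL hM fun s hs => ?_
      have c1 := centre_sub_mem hL hM hi'' hj hs
      have c0 := centre_sub_mem hL hM hi hj hs
      rw [centre_succ, centre_succ] at c1
      have := hW2 (centre L M i + stepX L M - s) (stepX L M) hX.le
        (by convert c0 using 1; ring) (by convert c1 using 1; ring)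
      rw [centre_succ, centre_succ]
      rwa [show centre L M i + stepX L M - s + stepX L M
        = centre L M i + stepX L M + stepX L M - s by ring,
        show centre L M i + stepX L M - s - stepX L M = centre L M i - s by ring] at this
    have e : discPot L M V W r n (i + 2) - 2 * discPot L M V W r n (i + 1)
        + discPot L M V W r n i =
        (avgV L M V (i + 2) - 2 * avgV L M V (i + 1) + avgV L M V i) +
        ∑ j ∈ Finset.Icc 1 (2 * M), (avgW L M W (i + 2) j - 2 * avgW L M W (i + 1) j
        + avgW L M W i j) * θ j * stepX L M := by
      simp only [discPot, discConv, sub_mul, add_mul, Finset.sum_sub_distrib,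
        Finset.sum_add_distrib, mul_assoc, ← Finset.mul_sum]
      ring
    rw [e]
    refine (abs_add_le _ _).trans ?_
    linarith

/-! ### Uniform upper and lower bounds -/

/-- Upwind flux across one interface, with densities `a` and `b` on its two sides and potential
increment `p`. -/
def faceFlux (h p a b : ℝ) : ℝ :=
  a * max (-((Real.log b - Real.log a + p) / h)) 0 + b * min (-((Real.log b - Real.log a + p) / h)) 0

lemma faceFlux_mono_left {h p a a' b : ℝ} (hh : 0 < h) (ha : 0 < a) (hb : 0 < b) (haa : a ≤ a') :
    faceFlux h p a b ≤ faceFlux h p a' b := by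
  have hl := Real.log_le_log ha haa
  have hu : -((Real.log b - Real.log a + p) / h) ≤ -((Real.log b - Real.log a' + p) / h) := by
    gcongr
  unfold faceFlux
  have := ha.trans_le haa
  gcongr

lemma faceFlux_anti_right {h p a b b' : ℝ} (hh : 0 < h) (ha : 0 < a) (hb : 0 < b) (hbb : b ≤ b') :
    faceFlux h p a b' ≤ faceFlux h p a b := by
  have hl := Real.log_le_log hb hbb
  have hu : -((Real.log b' - Real.log a + p) / h) ≤ -((Real.log b - Real.log a + p) / h) := by
    gcongr
  unfold faceFlux
  refine add_le_add (by gcongr) ?_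
  calc b' * min (-((Real.log b' - Real.log a + p) / h)) 0
      ≤ b * min (-((Real.log b' - Real.log a + p) / h)) 0 :=
        mul_le_mul_of_nonpos_right hbb (min_le_right _ _)
    _ ≤ _ := by gcongr

lemma faceFlux_exp_right {h p a s : ℝ} (ha : 0 < a) :
    faceFlux h p a (a * Real.exp s) =
      a * (max (-((s + p) / h)) 0 + Real.exp s * min (-((s + p) / h)) 0) := by
  rw [faceFlux, Real.log_mul ha.ne' (Real.exp_pos s).ne', Real.log_exp, add_sub_cancel_left]
  ring

lemma faceFlux_exp_left {h p a s : ℝ} (ha : 0 < a) :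
    faceFlux h p (a * Real.exp s) a =
      a * (Real.exp s * max (-((-s + p) / h)) 0 + min (-((-s + p) / h)) 0) := by
  rw [faceFlux, Real.log_mul ha.ne' (Real.exp_pos s).ne', Real.log_exp, sub_add_cancel_left]
  ring

/-- The fluxes into and out of a cell induced by a smooth barrier nearly balance. -/
lemma abs_barrier_flux_sub_le {h A K a sr sl pr pl : ℝ} (hh : 0 < h) (hA : 0 ≤ A)
    (hAh : A * h ≤ 1) (ha : 0 < a) (hsr : |sr| ≤ A * h) (hsl : |sl| ≤ A * h)
    (hpr : |pr| ≤ K * h) (hpl : |pl| ≤ K * h) (hs : |sr + sl| ≤ A * h ^ 2)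
    (hp : |pr - pl| ≤ K * h ^ 2) :
    |faceFlux h pr a (a * Real.exp sr) - faceFlux h pl (a * Real.exp sl) a|
      ≤ (A + K + 4 * A * (A + K)) * h * a := by
  rw [faceFlux_exp_right ha, faceFlux_exp_left ha]
  set D := -((sr + pr) / h) with hD
  set E := -((-sl + pl) / h) with hE
  have hexp : ∀ s, |s| ≤ A * h → |Real.exp s - 1| ≤ 2 * (A * h) := fun s hs =>
    (Real.abs_exp_sub_one_le (hs.trans hAh)).trans (by linarith)
  have hDb : |D| ≤ A + K := by
    rw [hD, abs_neg, abs_div, abs_of_pos hh, div_le_iff₀ hh]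
    refine (abs_add_le _ _).trans ?_
    linarith
  have hEb : |E| ≤ A + K := by
    rw [hE, abs_neg, abs_div, abs_of_pos hh, div_le_iff₀ hh]
    refine (abs_add_le _ _).trans ?_
    rw [abs_neg]
    linarith
  have hDE : |D - E| ≤ (A + K) * h := by
    have : D - E = -((sr + sl) + (pr - pl)) / h := by rw [hD, hE]; field_simp; ring
    rw [this, abs_div, abs_neg, abs_of_pos hh, div_le_iff₀ hh]
    refine (abs_add_le _ _).trans ?_
    nlinarith
  have hminD : |min D 0| ≤ A + K := by
    refine le_trans ?_ hDb
    rcases le_total D 0 with h0 | h0 <;> simp [h0]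
  have hmaxE : |max E 0| ≤ A + K := by
    refine le_trans ?_ hEb
    rcases le_total E 0 with h0 | h0 <;> simp [h0]
  have e1 : max D 0 + Real.exp sr * min D 0 = D + (Real.exp sr - 1) * min D 0 := by
    rcases le_total D 0 with h0 | h0 <;> simp [h0]
    ring
  have e2 : Real.exp sl * max E 0 + min E 0 = E + (Real.exp sl - 1) * max E 0 := by
    rcases le_total E 0 with h0 | h0 <;> simp [h0]
    ring
  rw [e1, e2, ← mul_sub, abs_mul, abs_of_pos ha, mul_comm]
  refine mul_le_mul_of_nonneg_right ?_ ha.le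
  have f1 : |(Real.exp sr - 1) * min D 0| ≤ 2 * (A * h) * (A + K) := by
    rw [abs_mul]
    exact mul_le_mul (hexp _ hsr) hminD (abs_nonneg _) (by positivity)
  have f2 : |(Real.exp sl - 1) * max E 0| ≤ 2 * (A * h) * (A + K) := by
    rw [abs_mul]
    exact mul_le_mul (hexp _ hsl) hmaxE (abs_nonneg _) (by positivity)
  have e3 : D + (Real.exp sr - 1) * min D 0 - (E + (Real.exp sl - 1) * max E 0) =
    (D - E) + ((Real.exp sr - 1) * min D 0 - (Real.exp sl - 1) * max E 0) := by ring
  rw [e3]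
  refine (abs_add_le _ _).trans ?_
  have := abs_sub ((Real.exp sr - 1) * min D 0) ((Real.exp sl - 1) * max E 0)
  nlinarith

/-- Barrier-weighted maximum principle for one implicit step. -/
lemma exists_argmax_increment_le {m : ℕ} (hm : 2 ≤ m) {h τ A K : ℝ} (hh : 0 < h) (hτ : 0 < τ)
    (hA : 0 ≤ A) (hK : 0 ≤ K) (hAh : A * h ≤ 1) {a b P φ F : ℕ → ℝ}
    (ha : ∀ i ∈ Finset.Icc 1 m, 0 < a i)
    (hF : ∀ i, 1 ≤ i → i < m → F i = faceFlux h (P (i + 1) - P i) (a i) (a (i + 1)))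
    (hF0 : F 0 = 0) (hFm : F m = 0)
    (hstep : ∀ i ∈ Finset.Icc 1 m, a i - b i = -(τ / h * (F i - F (i - 1))))
    (hP1 : ∀ i, 1 ≤ i → i < m → |P (i + 1) - P i| ≤ K * h)
    (hP2 : ∀ i, 1 ≤ i → i + 1 < m → |P (i + 2) - 2 * P (i + 1) + P i| ≤ K * h ^ 2)
    (hφ1 : ∀ i, 1 ≤ i → i < m → |φ (i + 1) - φ i| ≤ A * h)
    (hφ2 : ∀ i, 1 ≤ i → i + 1 < m → |φ (i + 2) - 2 * φ (i + 1) + φ i| ≤ A * h ^ 2)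
    (hl : P 2 - P 1 ≤ φ 2 - φ 1) (hr : φ m - φ (m - 1) ≤ P m - P (m - 1)) :
    ∃ i ∈ Finset.Icc 1 m, (∀ j ∈ Finset.Icc 1 m, a j * Real.exp (φ j) ≤ a i * Real.exp (φ i)) ∧
      a i - b i ≤ (A + K + 4 * A * (A + K)) * τ * a i := by
  obtain ⟨i, hi, hmax⟩ := Finset.exists_max_image (Finset.Icc 1 m)
    (fun j => a j * Real.exp (φ j)) ⟨1, by simp; omega⟩
  refine ⟨i, hi, hmax, ?_⟩
  have hai := ha i hi
  obtain ⟨hi1, hi2⟩ := Finset.mem_Icc.1 hi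
  have hnb : ∀ j ∈ Finset.Icc 1 m, a j ≤ a i * Real.exp (φ i - φ j) := by
    intro j hj
    have := hmax j hj
    rw [Real.exp_sub, mul_div_assoc', le_div_iff₀ (Real.exp_pos _)]
    exact this
  have hC : 0 ≤ (A + K + 4 * A * (A + K)) * τ * a i := by positivity
  rw [hstep i hi]
  rcases eq_or_lt_of_le hi1 with h1 | h1
  · subst h1
    have hF1 : 0 ≤ F 1 := by
      rw [hF 1 le_rfl (by omega)]
      refine le_trans ?_ (faceFlux_anti_right hh hai (ha 2 (by simp; omega)) (hnb 2 (by simp; omega)))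
      rw [faceFlux_exp_right hai]
      have : 0 ≤ -((φ 1 - φ 2 + (P (1 + 1) - P 1)) / h) := by
        rw [neg_nonneg]
        exact div_nonpos_of_nonpos_of_nonneg (by norm_num; linarith) hh.le
      rw [min_eq_right this, max_eq_left this]
      positivity
    simp only [Nat.sub_self, hF0, sub_zero]
    have : 0 ≤ τ / h * F 1 := by positivity
    linarith
  rcases eq_or_lt_of_le hi2 with h2 | h2
  · subst h2
    have hF1 : F (i - 1) ≤ 0 := by
      rw [hF (i - 1) (by omega) (by omega), Nat.sub_add_cancel hi1]
      refine (faceFlux_mono_left hh (ha (i - 1) (by simp; omega)) hai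
        (hnb (i - 1) (by simp; omega))).trans ?_
      rw [faceFlux_exp_left hai]
      have : -((-(φ i - φ (i - 1)) + (P i - P (i - 1))) / h) ≤ 0 := by
        rw [neg_nonpos]
        exact div_nonneg (by linarith) hh.le
      rw [max_eq_right this, min_eq_left this]
      have := mul_nonneg hai.le (neg_nonneg.2 this)
      simp only [mul_zero, zero_add]
      linarith
    rw [hFm, zero_sub]
    have : 0 ≤ τ / h * (-F (i - 1)) := by
      have : 0 ≤ -F (i - 1) := by linarith
      positivity
    linarith
  · obtain ⟨k, rfl⟩ : ∃ k, i = k + 1 := ⟨i - 1, by omega⟩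
    simp only [Nat.add_sub_cancel] at *
    have b1 := faceFlux_anti_right (p := P (k + 2) - P (k + 1)) hh hai (ha (k + 2) (by simp; omega))
      (hnb (k + 2) (by simp; omega))
    have b2 := faceFlux_mono_left (p := P (k + 1) - P k) hh (ha k (by simp; omega)) hai
      (hnb k (by simp; omega))
    have b3 := abs_barrier_flux_sub_le (a := a (k + 1)) (sr := φ (k + 1) - φ (k + 2))
      (sl := φ (k + 1) - φ k) (pr := P (k + 2) - P (k + 1)) (pl := P (k + 1) - P k)
      hh hA hAh hai (by rw [abs_sub_comm]; exact hφ1 (k + 1) (by omega) (by omega))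
      (hφ1 k (by omega) (by omega)) (hP1 (k + 1) (by omega) (by omega))
      (hP1 k (by omega) (by omega))
      (by
        have := hφ2 k (by omega) (by omega)
        rw [← abs_neg] at this
        convert this using 2; ring)
      (by
        have := hP2 k (by omega) (by omega)
        convert this using 2; ring)
    rw [hF (k + 1) (by omega) h2, hF k (by omega) (by omega)]
    have b4 := (abs_le.1 b3).1
    have b5 : -((A + K + 4 * A * (A + K)) * h * a (k + 1)) ≤
        faceFlux h (P (k + 1 + 1) - P (k + 1)) (a (k + 1)) (a (k + 1 + 1))
          - faceFlux h (P (k + 1) - P k) (a k) (a (k + 1)) := by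
      linarith
    have b6 := mul_le_mul_of_nonneg_left b5 (div_pos hτ hh).le
    have b7 : τ / h * -((A + K + 4 * A * (A + K)) * h * a (k + 1)) =
      -((A + K + 4 * A * (A + K)) * τ * a (k + 1)) := by field_simp
    linarith

/-- Barrier-weighted minimum principle for one implicit step. -/
lemma exists_argmin_le_increment {m : ℕ} (hm : 2 ≤ m) {h τ A K : ℝ} (hh : 0 < h) (hτ : 0 < τ)
    (hA : 0 ≤ A) (hK : 0 ≤ K) (hAh : A * h ≤ 1) {a b P φ F : ℕ → ℝ}
    (ha : ∀ i ∈ Finset.Icc 1 m, 0 < a i)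
    (hF : ∀ i, 1 ≤ i → i < m → F i = faceFlux h (P (i + 1) - P i) (a i) (a (i + 1)))
    (hF0 : F 0 = 0) (hFm : F m = 0)
    (hstep : ∀ i ∈ Finset.Icc 1 m, a i - b i = -(τ / h * (F i - F (i - 1))))
    (hP1 : ∀ i, 1 ≤ i → i < m → |P (i + 1) - P i| ≤ K * h)
    (hP2 : ∀ i, 1 ≤ i → i + 1 < m → |P (i + 2) - 2 * P (i + 1) + P i| ≤ K * h ^ 2)
    (hφ1 : ∀ i, 1 ≤ i → i < m → |φ (i + 1) - φ i| ≤ A * h)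
    (hφ2 : ∀ i, 1 ≤ i → i + 1 < m → |φ (i + 2) - 2 * φ (i + 1) + φ i| ≤ A * h ^ 2)
    (hl : φ 2 - φ 1 ≤ P 2 - P 1) (hr : P m - P (m - 1) ≤ φ m - φ (m - 1)) :
    ∃ i ∈ Finset.Icc 1 m, (∀ j ∈ Finset.Icc 1 m, a i * Real.exp (φ i) ≤ a j * Real.exp (φ j)) ∧
      -((A + K + 4 * A * (A + K)) * τ * a i) ≤ a i - b i := by
  obtain ⟨i, hi, hmin⟩ := Finset.exists_min_image (Finset.Icc 1 m)
    (fun j => a j * Real.exp (φ j)) ⟨1, by simp; omega⟩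
  refine ⟨i, hi, hmin, ?_⟩
  have hai := ha i hi
  obtain ⟨hi1, hi2⟩ := Finset.mem_Icc.1 hi
  have hnb : ∀ j ∈ Finset.Icc 1 m, a i * Real.exp (φ i - φ j) ≤ a j := by
    intro j hj
    have := hmin j hj
    rw [Real.exp_sub, mul_div_assoc', div_le_iff₀ (Real.exp_pos _)]
    exact this
  have hpe : ∀ s, 0 < a i * Real.exp s := fun s => mul_pos hai (Real.exp_pos s)
  have hC : 0 ≤ (A + K + 4 * A * (A + K)) * τ * a i := by positivity
  rw [hstep i hi]
  rcases eq_or_lt_of_le hi1 with h1 | h1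
  · subst h1
    have hF1 : F 1 ≤ 0 := by
      rw [hF 1 le_rfl (by omega)]
      refine (faceFlux_anti_right hh hai (hpe _) (hnb 2 (by simp; omega))).trans ?_
      rw [faceFlux_exp_right hai]
      have : -((φ 1 - φ 2 + (P (1 + 1) - P 1)) / h) ≤ 0 := by
        rw [neg_nonpos]
        exact div_nonneg (by norm_num; linarith) hh.le
      rw [max_eq_right this, min_eq_left this, zero_add]
      exact mul_nonpos_of_nonneg_of_nonpos hai.le
        (mul_nonpos_of_nonneg_of_nonpos (Real.exp_pos _).le this)
    simp only [Nat.sub_self, hF0, sub_zero]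
    have : 0 ≤ τ / h * (-F 1) := by
      have : 0 ≤ -F 1 := by linarith
      positivity
    linarith
  rcases eq_or_lt_of_le hi2 with h2 | h2
  · subst h2
    have hF1 : 0 ≤ F (i - 1) := by
      rw [hF (i - 1) (by omega) (by omega), Nat.sub_add_cancel hi1]
      refine le_trans ?_ (faceFlux_mono_left hh (hpe _) hai (hnb (i - 1) (by simp; omega)))
      rw [faceFlux_exp_left hai]
      have : 0 ≤ -((-(φ i - φ (i - 1)) + (P i - P (i - 1))) / h) := by
        rw [neg_nonneg]
        exact div_nonpos_of_nonpos_of_nonneg (by linarith) hh.le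
      rw [max_eq_left this, min_eq_right this]
      positivity
    rw [hFm, zero_sub]
    have : 0 ≤ τ / h * F (i - 1) := by positivity
    linarith
  · obtain ⟨k, rfl⟩ : ∃ k, i = k + 1 := ⟨i - 1, by omega⟩
    simp only [Nat.add_sub_cancel] at *
    have b1 := faceFlux_anti_right (p := P (k + 2) - P (k + 1)) hh hai (hpe _)
      (hnb (k + 2) (by simp; omega))
    have b2 := faceFlux_mono_left (p := P (k + 1) - P k) hh (hpe _) hai
      (hnb k (by simp; omega))
    have b3 := abs_barrier_flux_sub_le (a := a (k + 1)) (sr := φ (k + 1) - φ (k + 2))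
      (sl := φ (k + 1) - φ k) (pr := P (k + 2) - P (k + 1)) (pl := P (k + 1) - P k)
      hh hA hAh hai (by rw [abs_sub_comm]; exact hφ1 (k + 1) (by omega) (by omega))
      (hφ1 k (by omega) (by omega)) (hP1 (k + 1) (by omega) (by omega))
      (hP1 k (by omega) (by omega))
      (by
        have := hφ2 k (by omega) (by omega)
        rw [← abs_neg] at this
        convert this using 2; ring)
      (by
        have := hP2 k (by omega) (by omega)
        convert this using 2; ring)
    rw [hF (k + 1) (by omega) h2, hF k (by omega) (by omega)]
    have b4 := (abs_le.1 b3).2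
    have b5 : faceFlux h (P (k + 1 + 1) - P (k + 1)) (a (k + 1)) (a (k + 1 + 1))
          - faceFlux h (P (k + 1) - P k) (a k) (a (k + 1)) ≤
        (A + K + 4 * A * (A + K)) * h * a (k + 1) := by
      linarith
    have b6 := mul_le_mul_of_nonneg_left b5 (div_pos hτ hh).le
    have b7 : τ / h * ((A + K + 4 * A * (A + K)) * h * a (k + 1)) =
      (A + K + 4 * A * (A + K)) * τ * a (k + 1) := by field_simp
    linarith

lemma flux_eq_faceFlux {L : ℝ} {M : ℕ} {V W : ℝ → ℝ} {r : ℕ → ℕ → ℝ} {n : ℕ}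
    (hr : ∀ i ∈ Finset.Icc 1 (2 * M), 0 < r (n + 1) i) {i : ℕ} (h1 : 1 ≤ i) (h2 : i < 2 * M) :
    flux L M boltzmann V W r n i = faceFlux (stepX L M)
      (discPot L M V W r n (i + 1) - discPot L M V W r n i) (r (n + 1) i) (r (n + 1) (i + 1)) := by
  have hv : velocity L M boltzmann V W r n i = -((Real.log (r (n + 1) (i + 1))
      - Real.log (r (n + 1) i) + (discPot L M V W r n (i + 1) - discPot L M V W r n i))
        / stepX L M) := by
    rw [velocity, entropyVar_eq (hr i (by simp; omega)), entropyVar_eq (hr (i + 1) (by simp; omega))]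
    congr 2; ring
  rw [flux, if_pos ⟨h1, h2⟩, hv, faceFlux]

lemma initial_bounds {L : ℝ} (hL : 0 < L) {M : ℕ} (hM : 1 ≤ M) {ρ₀ : ℝ → ℝ}
    (hρ₀ : MemLp ρ₀ ∞ (volume.restrict (dom L))) {ε : ℝ}
    (hle : ∀ᵐ x ∂(volume.restrict (dom L)), ε ≤ ρ₀ x) {i : ℕ} (hi : i ∈ Finset.Icc 1 (2 * M)) :
    (⨍ x in cell L M i, ρ₀ x) ∈ Icc ε (eLpNorm ρ₀ ∞ (volume.restrict (dom L))).toReal := by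
  refine average_cell_mem hL hM (integrableOn_cell hL hM hi (integrableOn_dom_of_memLp_top hρ₀)) ?_
  refine ae_restrict_cell hL hM hi ?_
  have h2 : ∀ᵐ x ∂(volume.restrict (dom L)),
      ‖ρ₀ x‖ₑ ≤ eLpNorm ρ₀ ∞ (volume.restrict (dom L)) := by
    rw [eLpNorm_exponent_top]
    exact ae_le_eLpNormEssSup
  filter_upwards [hle, h2] with x h3 h4
  refine ⟨h3, (le_abs_self _).trans ?_⟩
  have := ENNReal.toReal_mono hρ₀.eLpNorm_ne_top h4
  simpa using this

lemma centre_sq_le {L : ℝ} (hL : 0 < L) {M : ℕ} (hM : 1 ≤ M) {i : ℕ}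
    (hi : i ∈ Finset.Icc 1 (2 * M)) : centre L M i ^ 2 ≤ L ^ 2 := by
  have := cell_subset hL hM hi (centre_mem_cell hL hM i)
  exact sq_le_sq' this.1 this.2.le

lemma sq_barrier_bounds {L : ℝ} (hL : 0 < L) {M : ℕ} (hM : 2 ≤ M) {q : ℝ} (hq : 0 ≤ q) :
    (∀ i, 1 ≤ i → i < 2 * M → |q * centre L M (i + 1) ^ 2 - q * centre L M i ^ 2|
      ≤ (2 * q * L + 2 * q) * stepX L M) ∧
    (∀ i, |q * centre L M (i + 2) ^ 2 - 2 * (q * centre L M (i + 1) ^ 2)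
      + q * centre L M i ^ 2| ≤ (2 * q * L + 2 * q) * stepX L M ^ 2) ∧
    q * centre L M 2 ^ 2 - q * centre L M 1 ^ 2 ≤ -(q * L * stepX L M) ∧
    q * L * stepX L M ≤ q * centre L M (2 * M) ^ 2 - q * centre L M (2 * M - 1) ^ 2 := by
  have hX := stepX_pos hL (by omega : 1 ≤ M)
  have hXM := stepX_mul (L := L) (M := M) (by omega)
  have hX2 : stepX L M ≤ L / 2 := by
    rw [stepX]
    exact div_le_div_of_nonneg_left hL.le two_pos (by exact_mod_cast hM)
  have e : ∀ i, q * centre L M (i + 1) ^ 2 - q * centre L M i ^ 2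
      = 2 * q * (-L + stepX L M * i) * stepX L M := by
    intro i; rw [centre, centre]; push_cast; ring
  refine ⟨fun i h1 h2 => ?_, fun i => ?_, ?_, ?_⟩
  · rw [e, abs_mul, abs_of_pos hX]
    refine mul_le_mul_of_nonneg_right ?_ hX.le
    rw [abs_mul, abs_of_nonneg (by positivity : 0 ≤ 2 * q)]
    have h3 : (i : ℝ) ≤ ((2 * M : ℕ) : ℝ) := by exact_mod_cast h2.le
    have h4 : |-L + stepX L M * i| ≤ L := by
      rw [abs_le]
      constructor
      · nlinarith [(Nat.cast_nonneg i : (0:ℝ) ≤ i)]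
      · nlinarith
    nlinarith
  · have : q * centre L M (i + 2) ^ 2 - 2 * (q * centre L M (i + 1) ^ 2)
      + q * centre L M i ^ 2 = 2 * q * stepX L M ^ 2 := by
      rw [centre, centre, centre]; push_cast; ring
    rw [this, abs_of_nonneg (by positivity)]
    have : 0 ≤ 2 * q * L * stepX L M ^ 2 := by positivity
    linarith
  · have := e 1
    norm_num at this
    rw [this]
    nlinarith [mul_nonneg hq hX.le]
  · have := e (2 * M - 1)
    rw [Nat.sub_add_cancel (by omega)] at this
    rw [this, Nat.cast_sub (by omega), mul_sub, hXM]
    push_cast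
    nlinarith [mul_nonneg hq hX.le]

set_option maxHeartbeats 1000000 in
/-- On sufficiently fine meshes, strictly positive solutions of the scheme stay between two
positive constants that do not depend on the mesh. -/
theorem exists_uniform_bounds {L T : ℝ} (hL : 0 < L) (hT : 0 < T) {V W : ℝ → ℝ}
    (hV : ContDiffOn ℝ 2 V (Icc (-L) L)) (hW : ContDiffOn ℝ 2 W (Icc (-(2 * L)) (2 * L)))
    {ρ₀ : ℝ → ℝ} (hρ₀ : MemLp ρ₀ ∞ (volume.restrict (dom L)))
    (hpos : ∃ ε : ℝ, 0 < ε ∧ ∀ᵐ x ∂(volume.restrict (dom L)), ε ≤ ρ₀ x) :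
    ∃ lo hi δ K : ℝ, 0 < lo ∧ 0 < hi ∧ 0 < δ ∧ 0 ≤ K ∧ ∀ (M N : ℕ) (r : ℕ → ℕ → ℝ), 1 ≤ M →
      stepX L M ≤ δ → stepT T N ≤ δ → IsSchemeSol L T M N boltzmann V W ρ₀ r → IsPositive M N r →
      (∀ n ≤ N + 1, ∀ i ∈ Finset.Icc 1 (2 * M), lo ≤ r n i ∧ r n i ≤ hi) ∧
      ∀ n ≤ N, ∀ i, 1 ≤ i → i < 2 * M →
        |discPot L M V W r n (i + 1) - discPot L M V W r n i| ≤ K * stepX L M := by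
  obtain ⟨ε, hε, hle⟩ := hpos
  have hintg := integrableOn_dom_of_memLp_top hρ₀
  obtain ⟨K, hK, hpot⟩ := exists_discPot_bounds hL hV hW (∫ x in dom L, ρ₀ x)
  set B := (eLpNorm ρ₀ ∞ (volume.restrict (dom L))).toReal with hB
  set q := K / L with hqdef
  have hq : 0 ≤ q := by positivity
  have hqL : q * L = K := by rw [hqdef]; field_simp
  set A := 2 * q * L + 2 * q with hAdef
  have hA : 0 ≤ A := by positivity
  set C := A + K + 4 * A * (A + K) with hC
  have hC0 : 0 ≤ C := by positivity
  refine ⟨ε * Real.exp (-(C * T)) * Real.exp (-(q * L ^ 2)),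
    (B + 1) * Real.exp (2 * C * T) * Real.exp (q * L ^ 2),
    min (L / 2) (min (1 / (A + 1)) (1 / (2 * (C + 1)))), K, by positivity, by positivity,
    by positivity, hK, fun M N r hM hX hτ hsol hr => ?_⟩
  have hXpos := stepX_pos hL hM
  have hτpos := stepT_pos hT N
  have hM2 : 2 ≤ M := by
    by_contra hcon
    obtain rfl : M = 1 := by omega
    have := hX.trans (min_le_left _ _)
    simp [stepX] at this
    linarith
  have hAh : A * stepX L M ≤ 1 := by
    have := hX.trans ((min_le_right _ _).trans (min_le_left _ _))
    rw [le_div_iff₀ (by positivity)] at this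
    nlinarith
  have hCτ : C * stepT T N ≤ 1 / 2 := by
    have := hτ.trans ((min_le_right _ _).trans (min_le_right _ _))
    rw [le_div_iff₀ (by positivity)] at this
    nlinarith
  have hpot' : ∀ n ≤ N, _ := fun n hn => hpot M r n hM (hr n (by omega)) (hr (n + 1) (by omega))
    (hsol.mass_eq hL hT hM hintg (by omega)) (hsol.mass_eq hL hT hM hintg (by omega))
  obtain ⟨hb1, hb2, hb3, hb4⟩ := sq_barrier_bounds hL hM2 hq
  rw [hqL] at hb3 hb4
  have hnT : ∀ n ≤ N + 1, (n : ℝ) * stepT T N ≤ T := by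
    intro n hn
    have h1 := stepT_mul T N
    have h2 : (n : ℝ) ≤ (N : ℝ) + 1 := by exact_mod_cast hn
    nlinarith
  have hup : ∀ n ≤ N + 1, ∀ i ∈ Finset.Icc 1 (2 * M),
      r n i * Real.exp (-(q * centre L M i ^ 2))
        ≤ B * Real.exp (2 * C * (n * stepT T N)) := by
    intro n
    induction n with
    | zero =>
      intro _ i hi
      have h1 := initial_bounds hL hM hρ₀ hle hi
      rw [← hsol.init i hi] at h1
      simp only [Nat.cast_zero, zero_mul, mul_zero, Real.exp_zero, mul_one]
      refine le_trans ?_ h1.2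
      refine mul_le_of_le_one_right (hr 0 (by omega) i hi).le ?_
      rw [Real.exp_le_one_iff]
      have : 0 ≤ q * centre L M i ^ 2 := by positivity
      linarith
    | succ n ih =>
      intro hn j hj
      obtain ⟨hp1, hp2⟩ := hpot' n (by omega)
      obtain ⟨i, hi, hmax, hinc⟩ := exists_argmax_increment_le (m := 2 * M) (by omega) hXpos hτpos
        hA hK hAh (a := r (n + 1)) (b := r n) (P := discPot L M V W r n)
        (φ := fun i => -(q * centre L M i ^ 2)) (F := flux L M boltzmann V W r n)
        (hr (n + 1) hn) (fun i h1 h2 => flux_eq_faceFlux (hr (n + 1) hn) h1 h2)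
        (flux_zero _ _ _ _ _ _ _) (flux_last _ _ _ _ _ _ _)
        (fun i hi => hsol.increment hT (by omega) hi) hp1 hp2
        (fun i h1 h2 => by
          have := hb1 i h1 h2
          rw [← abs_neg] at this
          convert this using 2; ring)
        (fun i h1 h2 => by
          have := hb2 i
          rw [← abs_neg] at this
          convert this using 2; ring)
        (by
          have := (abs_le.1 (hp1 1 le_rfl (by omega))).2
          norm_num at this
          linarith)
        (by
          have := (abs_le.1 (hp1 (2 * M - 1) (by omega) (by omega))).1
          rw [Nat.sub_add_cancel (by omega)] at this
          linarith)
      rw [← hC] at hinc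
      refine (hmax j hj).trans ?_
      have h1 := ih (by omega) i hi
      set y := C * stepT T N with hy
      have hy0 : 0 ≤ y := by positivity
      have h2 : r (n + 1) i * (1 - y) ≤ r n i := by nlinarith
      have h3 : 1 ≤ Real.exp (2 * y) * (1 - y) := by
        have := Real.add_one_le_exp (2 * y)
        nlinarith
      have h4 : 0 < r (n + 1) i := hr (n + 1) hn i hi
      have h5 : Real.exp (2 * C * (((n + 1 : ℕ) : ℝ) * stepT T N)) =
          Real.exp (2 * C * ((n : ℝ) * stepT T N)) * Real.exp (2 * y) := by
        rw [← Real.exp_add, hy]; congr 1; push_cast; ring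
      rw [h5]
      set e := Real.exp (-(q * centre L M i ^ 2)) with he
      have he0 : 0 < e := Real.exp_pos _
      calc r (n + 1) i * e ≤ r (n + 1) i * e * (Real.exp (2 * y) * (1 - y)) :=
            le_mul_of_one_le_right (by positivity) h3
        _ = (r (n + 1) i * (1 - y)) * e * Real.exp (2 * y) := by ring
        _ ≤ r n i * e * Real.exp (2 * y) := by gcongr
        _ ≤ B * Real.exp (2 * C * ((n : ℝ) * stepT T N)) * Real.exp (2 * y) := by gcongr
        _ = _ := by ring
  have hdown : ∀ n ≤ N + 1, ∀ i ∈ Finset.Icc 1 (2 * M),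
      ε * Real.exp (-(C * (n * stepT T N))) ≤ r n i * Real.exp (q * centre L M i ^ 2) := by
    intro n
    induction n with
    | zero =>
      intro _ i hi
      have h1 := initial_bounds hL hM hρ₀ hle hi
      rw [← hsol.init i hi] at h1
      simp only [Nat.cast_zero, zero_mul, mul_zero, neg_zero, Real.exp_zero, mul_one]
      refine h1.1.trans (le_mul_of_one_le_right (hr 0 (by omega) i hi).le ?_)
      rw [Real.one_le_exp_iff]
      positivity
    | succ n ih =>
      intro hn j hj
      obtain ⟨hp1, hp2⟩ := hpot' n (by omega)
      obtain ⟨i, hi, hmin, hinc⟩ := exists_argmin_le_increment (m := 2 * M) (by omega) hXpos hτpos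
        hA hK hAh (a := r (n + 1)) (b := r n) (P := discPot L M V W r n)
        (φ := fun i => q * centre L M i ^ 2) (F := flux L M boltzmann V W r n)
        (hr (n + 1) hn) (fun i h1 h2 => flux_eq_faceFlux (hr (n + 1) hn) h1 h2)
        (flux_zero _ _ _ _ _ _ _) (flux_last _ _ _ _ _ _ _)
        (fun i hi => hsol.increment hT (by omega) hi) hp1 hp2
        hb1 (fun i _ _ => hb2 i)
        (by
          have := (abs_le.1 (hp1 1 le_rfl (by omega))).1
          norm_num at this
          linarith)
        (by
          have := (abs_le.1 (hp1 (2 * M - 1) (by omega) (by omega))).2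
          rw [Nat.sub_add_cancel (by omega)] at this
          linarith)
      rw [← hC] at hinc
      refine le_trans ?_ (hmin j hj)
      have h1 := ih (by omega) i hi
      set y := C * stepT T N with hy
      have hy0 : 0 ≤ y := by positivity
      have h4 : 0 < r (n + 1) i := hr (n + 1) hn i hi
      have h2 : r n i ≤ r (n + 1) i * Real.exp y := by
        have := Real.add_one_le_exp y
        nlinarith
      have h5 : Real.exp (-(C * (((n + 1 : ℕ) : ℝ) * stepT T N))) =
          Real.exp (-(C * ((n : ℝ) * stepT T N))) * Real.exp (-y) := by
        rw [← Real.exp_add, hy]; congr 1; push_cast; ring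
      rw [h5]
      set e := Real.exp (q * centre L M i ^ 2) with he
      have he0 : 0 < e := Real.exp_pos _
      calc ε * (Real.exp (-(C * ((n : ℝ) * stepT T N))) * Real.exp (-y))
          = ε * Real.exp (-(C * ((n : ℝ) * stepT T N))) * Real.exp (-y) := by ring
        _ ≤ r n i * e * Real.exp (-y) := by gcongr
        _ ≤ (r (n + 1) i * Real.exp y) * e * Real.exp (-y) := by gcongr
        _ = r (n + 1) i * e * (Real.exp y * Real.exp (-y)) := by ring
        _ = r (n + 1) i * e := by rw [← Real.exp_add]; simp
  refine ⟨fun n hn i hi => ?_, fun n hn i h1 h2 => (hpot' n hn).1 i h1 h2⟩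
  have hc := centre_sq_le hL hM hi
  have hri := hr n hn i hi
  have hB0 : 0 ≤ B := ENNReal.toReal_nonneg
  constructor
  · have h1 := hdown n hn i hi
    have h2 : r n i = r n i * Real.exp (q * centre L M i ^ 2) * Real.exp (-(q * centre L M i ^ 2)) := by
      rw [mul_assoc, ← Real.exp_add]; simp
    rw [h2]
    have h3 : Real.exp (-(C * T)) ≤ Real.exp (-(C * (n * stepT T N))) := by
      rw [Real.exp_le_exp]
      have := mul_le_mul_of_nonneg_left (hnT n hn) hC0
      linarith
    have h4 : Real.exp (-(q * L ^ 2)) ≤ Real.exp (-(q * centre L M i ^ 2)) := by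
      rw [Real.exp_le_exp]
      have := mul_le_mul_of_nonneg_left hc hq
      linarith
    refine mul_le_mul ?_ h4 (Real.exp_pos _).le (by positivity)
    exact (mul_le_mul_of_nonneg_left h3 hε.le).trans h1
  · have h1 := hup n hn i hi
    have h2 : r n i = r n i * Real.exp (-(q * centre L M i ^ 2)) * Real.exp (q * centre L M i ^ 2) := by
      rw [mul_assoc, ← Real.exp_add]; simp
    rw [h2]
    have h3 : Real.exp (2 * C * (n * stepT T N)) ≤ Real.exp (2 * C * T) := by
      rw [Real.exp_le_exp]
      exact mul_le_mul_of_nonneg_left (hnT n hn) (by positivity)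
    have h4 : Real.exp (q * centre L M i ^ 2) ≤ Real.exp (q * L ^ 2) := by
      rw [Real.exp_le_exp]
      exact mul_le_mul_of_nonneg_left hc hq
    refine mul_le_mul ?_ h4 (Real.exp_pos _).le (by positivity)
    refine h1.trans (mul_le_mul (by linarith) h3 (Real.exp_pos _).le (by linarith))

/-! ### Energy estimate -/

/-- A solution of the scheme with values in `[lo, hi]` whose discrete potential has slopes bounded
by `K`. -/
structure GoodSol (L T : ℝ) (V W ρ₀ : ℝ → ℝ) (lo hi K : ℝ) (M N : ℕ) (r : ℕ → ℕ → ℝ) : Prop where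
  one_le : 1 ≤ M
  sol : IsSchemeSol L T M N boltzmann V W ρ₀ r
  mem : ∀ n ≤ N + 1, ∀ i ∈ Finset.Icc 1 (2 * M), lo ≤ r n i ∧ r n i ≤ hi
  pot : ∀ n ≤ N, ∀ i, 1 ≤ i → i < 2 * M →
    |discPot L M V W r n (i + 1) - discPot L M V W r n i| ≤ K * stepX L M

lemma log_sub_mul_sub_ge {a b hi : ℝ} (ha : 0 < a) (hb : 0 < b) (hahi : a ≤ hi) (hbhi : b ≤ hi) :
    (b - a) ^ 2 / hi ≤ (Real.log b - Real.log a) * (b - a) := by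
  have key : ∀ a b : ℝ, 0 < a → a ≤ b → b ≤ hi → (b - a) / hi ≤ Real.log b - Real.log a := by
    intro a b ha hab hbhi
    have hb : 0 < b := ha.trans_le hab
    have h1 : Real.log (a / b) ≤ a / b - 1 := Real.log_le_sub_one_of_pos (by positivity)
    rw [Real.log_div ha.ne' hb.ne'] at h1
    have h2 : (b - a) / hi ≤ (b - a) / b :=
      div_le_div_of_nonneg_left (by linarith) hb hbhi
    have h3 : (b - a) / b = 1 - a / b := by field_simp
    linarith
  rcases le_total a b with h | h
  · have := mul_le_mul_of_nonneg_right (key a b ha h hbhi) (sub_nonneg.2 h)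
    refine le_of_eq_of_le ?_ this
    ring
  · have := mul_le_mul_of_nonneg_right (key b a hb h hahi) (sub_nonneg.2 h)
    refine le_of_eq_of_le ?_ (this.trans_eq ?_) <;> ring

lemma abs_log_sub_le {a b lo : ℝ} (hlo : 0 < lo) (ha : lo ≤ a) (hb : lo ≤ b) :
    |Real.log b - Real.log a| ≤ |b - a| / lo := by
  have key : ∀ a b : ℝ, lo ≤ a → a ≤ b → Real.log b - Real.log a ≤ (b - a) / lo := by
    intro a b ha hab
    have ha0 : 0 < a := hlo.trans_le ha
    have hb : 0 < b := ha0.trans_le hab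
    have h1 : Real.log (b / a) ≤ b / a - 1 := Real.log_le_sub_one_of_pos (by positivity)
    rw [Real.log_div hb.ne' ha0.ne'] at h1
    have h2 : (b - a) / a ≤ (b - a) / lo :=
      div_le_div_of_nonneg_left (by linarith) hlo ha
    have h3 : (b - a) / a = b / a - 1 := by field_simp
    linarith
  rcases le_total a b with h | h
  · rw [abs_of_nonneg (sub_nonneg.2 (Real.log_le_log (hlo.trans_le ha) h)),
      abs_of_nonneg (sub_nonneg.2 h)]
    exact key a b ha h
  · rw [abs_sub_comm, abs_sub_comm b a,
      abs_of_nonneg (sub_nonneg.2 (Real.log_le_log (hlo.trans_le hb) h)),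
      abs_of_nonneg (sub_nonneg.2 h)]
    exact key b a hb h

/-- The upwind value `ρ^{up}` at an interface, for the velocity `u`. -/
def upwindValue (u a b : ℝ) : ℝ := if 0 ≤ u then a else b

lemma upwindValue_mul (u a b : ℝ) : a * max u 0 + b * min u 0 = upwindValue u a b * u := by
  unfold upwindValue
  split_ifs with h
  · rw [max_eq_left h, min_eq_right h]; ring
  · rw [max_eq_right (not_le.1 h).le, min_eq_left (not_le.1 h).le]; ring

lemma upwindValue_mem {u a b lo hi : ℝ} (ha : lo ≤ a ∧ a ≤ hi) (hb : lo ≤ b ∧ b ≤ hi) :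
    lo ≤ upwindValue u a b ∧ upwindValue u a b ≤ hi := by
  unfold upwindValue; split_ifs <;> assumption

lemma abs_upwindValue_sub_le (u a b : ℝ) : |upwindValue u a b - a| ≤ |b - a| := by
  unfold upwindValue; split_ifs <;> simp

lemma upwind_dissipation {a b u p h lo hi K : ℝ} (hh : 0 < h) (hlo : 0 < lo)
    (ha : lo ≤ a ∧ a ≤ hi) (hb : lo ≤ b ∧ b ≤ hi) (hp : |p| ≤ K * h)
    (hu : u = -((Real.log b - Real.log a + p) / h)) :
    (a * max u 0 + b * min u 0) * (b - a)
      ≤ -(lo / (2 * hi) * ((b - a) ^ 2 / h)) + hi ^ 3 * K ^ 2 / (2 * lo) * h := by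
  have hhi : 0 < hi := hlo.trans_le (ha.1.trans ha.2)
  rw [upwindValue_mul]
  obtain ⟨hv1, hv2⟩ := upwindValue_mem (u := u) ha hb
  set v := upwindValue u a b
  have h1 := log_sub_mul_sub_ge (hlo.trans_le ha.1) (hlo.trans_le hb.1) ha.2 hb.2
  set ℓ := Real.log b - Real.log a
  set d := b - a
  have hv0 : 0 < v := hlo.trans_le hv1
  have e : v * u * d = -(v * (ℓ * d) / h) - v * (p * d) / h := by rw [hu]; field_simp; ring
  rw [e]
  have h2 : lo * (d ^ 2 / hi) / h ≤ v * (ℓ * d) / h := by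
    gcongr
  have h3 : -(v * (p * d) / h) ≤ hi * K * |d| := by
    rw [← neg_div, div_le_iff₀ hh]
    have : -(p * d) ≤ K * h * |d| := by
      refine (neg_le_abs _).trans ?_
      rw [abs_mul]
      exact mul_le_mul_of_nonneg_right hp (abs_nonneg _)
    have h0 : 0 ≤ K * h * |d| := mul_nonneg ((abs_nonneg _).trans hp) (abs_nonneg _)
    calc -(v * (p * d)) = v * -(p * d) := by ring
      _ ≤ v * (K * h * |d|) := mul_le_mul_of_nonneg_left this hv0.le
      _ ≤ hi * (K * h * |d|) := mul_le_mul_of_nonneg_right hv2 h0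
      _ = _ := by ring
  have h4 : hi * K * |d| ≤ lo / (2 * hi) * (d ^ 2 / h) + hi ^ 3 * K ^ 2 / (2 * lo) * h := by
    have : 0 ≤ (lo * |d| - hi ^ 2 * K * h) ^ 2 / (2 * hi * lo * h) := by positivity
    have e2 : (lo * |d| - hi ^ 2 * K * h) ^ 2 / (2 * hi * lo * h) =
        lo / (2 * hi) * (|d| ^ 2 / h) + hi ^ 3 * K ^ 2 / (2 * lo) * h - hi * K * |d| := by
      field_simp; ring
    rw [e2, sq_abs] at this
    linarith
  have h5 : lo * (d ^ 2 / hi) / h = 2 * (lo / (2 * hi) * (d ^ 2 / h)) := by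
    field_simp
  linarith

lemma GoodSol.velocity_eq {L T : ℝ} {V W ρ₀ : ℝ → ℝ} {lo hi K : ℝ} {M N : ℕ} {r : ℕ → ℕ → ℝ}
    (hlo : 0 < lo) (h : GoodSol L T V W ρ₀ lo hi K M N r) {n : ℕ} (hn : n ≤ N) {i : ℕ}
    (h1 : 1 ≤ i) (h2 : i < 2 * M) :
    velocity L M boltzmann V W r n i = -((Real.log (r (n + 1) (i + 1)) - Real.log (r (n + 1) i)
      + (discPot L M V W r n (i + 1) - discPot L M V W r n i)) / stepX L M) := by
  have hm : ∀ i ∈ Finset.Icc 1 (2 * M), 0 < r (n + 1) i := fun i hi =>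
    hlo.trans_le (h.mem (n + 1) (by omega) i hi).1
  rw [velocity, entropyVar_eq (hm i (by simp; omega)), entropyVar_eq (hm (i + 1) (by simp; omega))]
  congr 2; ring

lemma GoodSol.abs_velocity_le {L T : ℝ} (hL : 0 < L) {V W ρ₀ : ℝ → ℝ} {lo hi K : ℝ} {M N : ℕ}
    {r : ℕ → ℕ → ℝ} (hlo : 0 < lo) (h : GoodSol L T V W ρ₀ lo hi K M N r) {n : ℕ} (hn : n ≤ N)
    {i : ℕ} (h1 : 1 ≤ i) (h2 : i < 2 * M) :
    |velocity L M boltzmann V W r n i| ≤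
      |r (n + 1) (i + 1) - r (n + 1) i| / (lo * stepX L M) + K := by
  have hX := stepX_pos hL h.one_le
  rw [h.velocity_eq hlo hn h1 h2, abs_neg, abs_div, abs_of_pos hX, div_le_iff₀ hX]
  refine (abs_add_le _ _).trans ?_
  have e1 := abs_log_sub_le hlo (h.mem (n + 1) (by omega) i (by simp; omega)).1
    (h.mem (n + 1) (by omega) (i + 1) (by simp; omega)).1
  have e2 := h.pot n hn i h1 h2
  have e3 : (|r (n + 1) (i + 1) - r (n + 1) i| / (lo * stepX L M) + K) * stepX L M =
    |r (n + 1) (i + 1) - r (n + 1) i| / lo + K * stepX L M := by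
    field_simp
  rw [e3]
  exact add_le_add e1 e2

/-- Uniform bounds for the discrete dissipation, the time increments and the velocities. -/
theorem exists_energy_bound {L T : ℝ} (hL : 0 < L) (hT : 0 < T) (V W ρ₀ : ℝ → ℝ) {lo hi K : ℝ}
    (hlo : 0 < lo) (hhi : 0 < hi) :
    ∃ E : ℝ, 0 ≤ E ∧ ∀ (M N : ℕ) (r : ℕ → ℕ → ℝ), GoodSol L T V W ρ₀ lo hi K M N r →
      ∑ n ∈ Finset.range (N + 1), ∑ i ∈ Finset.Icc 1 (2 * M),
        (r (n + 1) i - r n i) ^ 2 * stepX L M ≤ E ∧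
      ∑ n ∈ Finset.range (N + 1), ∑ i ∈ Finset.Ico 1 (2 * M),
        (r (n + 1) (i + 1) - r (n + 1) i) ^ 2 / stepX L M * stepT T N ≤ E ∧
      ∑ n ∈ Finset.range (N + 1), ∑ i ∈ Finset.Ico 1 (2 * M),
        velocity L M boltzmann V W r n i ^ 2 * stepX L M * stepT T N ≤ E := by
  set C := hi ^ 3 * K ^ 2 / (2 * lo) with hC
  set κ := lo / (2 * hi) with hκ
  have hκ0 : 0 < κ := by positivity
  have hC0 : 0 ≤ C := by positivity
  set E₀ := 2 * L * hi ^ 2 + 4 * L * C * T with hE₀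
  set E₁ := E₀ / (2 * κ) with hE₁
  set E₂ := 2 * (E₁ / lo ^ 2) + 2 * K ^ 2 * (2 * L * T) with hE₂
  have hE₀0 : 0 ≤ E₀ := by positivity
  have hE₁0 : 0 ≤ E₁ := by positivity
  have hE₂0 : 0 ≤ E₂ := by positivity
  refine ⟨E₀ + E₁ + E₂, by positivity, fun M N r h => ?_⟩
  have hM := h.one_le
  have hX := stepX_pos hL hM
  have hτ := stepT_pos hT N
  have hXM := stepX_mul (L := L) hM
  have hτN := stepT_mul T N
  set m := 2 * M with hm
  set x := stepX L M with hx
  set τ := stepT T N with hτdef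
  have hm1 : 1 ≤ m := by omega
  have hsplit : ∀ f : ℕ → ℝ, ∑ i ∈ Finset.Icc 1 m, f i = ∑ i ∈ Finset.Ico 1 m, f i + f m := by
    intro f
    rw [← Finset.sum_Ico_succ_top (by omega)]
    rfl
  have hcardm : ∀ c : ℝ, ∑ _i ∈ Finset.Ico 1 m, c * x = c * (2 * L - x) := by
    intro c
    rw [Finset.sum_const, Nat.card_Ico, nsmul_eq_mul, Nat.cast_sub hm1, Nat.cast_one]
    linear_combination c * hXM
  -- one time step
  have hstep : ∀ n ≤ N, ∑ i ∈ Finset.Icc 1 m, (r (n + 1) i - r n i) ^ 2 * x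
      + 2 * κ * ∑ i ∈ Finset.Ico 1 m, (r (n + 1) (i + 1) - r (n + 1) i) ^ 2 / x * τ
      ≤ ∑ i ∈ Finset.Icc 1 m, r n i ^ 2 * x - ∑ i ∈ Finset.Icc 1 m, r (n + 1) i ^ 2 * x
        + 4 * L * C * τ := by
    intro n hn
    set F := flux L M boltzmann V W r n with hF
    have e1 : ∑ i ∈ Finset.Icc 1 m, r (n + 1) i * (r (n + 1) i - r n i) * x
        = τ * ∑ i ∈ Finset.Ico 1 m, F i * (r (n + 1) (i + 1) - r (n + 1) i) := by
      have e2 : ∀ i ∈ Finset.Icc 1 m, r (n + 1) i * (r (n + 1) i - r n i) * x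
          = -τ * (r (n + 1) i * (F i - F (i - 1))) := by
        intro i hi
        rw [h.sol.increment hT hn hi, ← hτdef, ← hx, ← hF]
        field_simp
      rw [Finset.sum_congr rfl e2, ← Finset.mul_sum,
        sum_mul_div_eq_neg_sum_flux m F (r (n + 1)) (flux_zero _ _ _ _ _ _ _)
          (flux_last _ _ _ _ _ _ _), hsplit]
      have : F m = 0 := flux_last _ _ _ _ _ _ _
      rw [this]
      ring
    have e3 : ∑ i ∈ Finset.Ico 1 m, F i * (r (n + 1) (i + 1) - r (n + 1) i) ≤
        ∑ i ∈ Finset.Ico 1 m, (-(κ * ((r (n + 1) (i + 1) - r (n + 1) i) ^ 2 / x)) + C * x) := by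
      refine Finset.sum_le_sum fun i hi => ?_
      obtain ⟨h1, h2⟩ := Finset.mem_Ico.1 hi
      rw [hF, flux, if_pos ⟨h1, h2⟩]
      exact upwind_dissipation hX hlo (h.mem (n + 1) (by omega) i (by simp; omega))
        (h.mem (n + 1) (by omega) (i + 1) (by simp; omega)) (h.pot n hn i h1 h2)
        (h.velocity_eq hlo hn h1 h2)
    rw [Finset.sum_add_distrib, hcardm, Finset.sum_neg_distrib, ← Finset.mul_sum] at e3
    have e4 : ∑ i ∈ Finset.Icc 1 m, r (n + 1) i * (r (n + 1) i - r n i) * x =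
        (∑ i ∈ Finset.Icc 1 m, r (n + 1) i ^ 2 * x - ∑ i ∈ Finset.Icc 1 m, r n i ^ 2 * x
          + ∑ i ∈ Finset.Icc 1 m, (r (n + 1) i - r n i) ^ 2 * x) / 2 := by
      rw [← Finset.sum_sub_distrib, ← Finset.sum_add_distrib, Finset.sum_div]
      refine Finset.sum_congr rfl fun i _ => ?_
      ring
    rw [e4] at e1
    have e5 := mul_le_mul_of_nonneg_left e3 hτ.le
    rw [← e1] at e5
    rw [← Finset.sum_mul (f := fun i => (r (n + 1) (i + 1) - r (n + 1) i) ^ 2 / x)]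
    have e6 : 0 ≤ τ * (C * x) := by positivity
    nlinarith
  have hsum := Finset.sum_le_sum (s := Finset.range (N + 1))
    fun n hn => hstep n (by simpa [Nat.lt_succ_iff] using hn)
  rw [Finset.sum_add_distrib, Finset.sum_add_distrib, ← Finset.mul_sum,
    Finset.sum_range_sub' (fun n => ∑ i ∈ Finset.Icc 1 m, r n i ^ 2 * x), Finset.sum_const,
    Finset.card_range, nsmul_eq_mul] at hsum
  have hinit : ∑ i ∈ Finset.Icc 1 m, r 0 i ^ 2 * x ≤ 2 * L * hi ^ 2 := by
    calc ∑ i ∈ Finset.Icc 1 m, r 0 i ^ 2 * x ≤ ∑ i ∈ Finset.Icc 1 m, hi ^ 2 * x := by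
          refine Finset.sum_le_sum fun i hi => ?_
          have := h.mem 0 (by omega) i hi
          have h0 := hlo.trans_le this.1
          have h1 := this.2
          gcongr
      _ = 2 * L * hi ^ 2 := by
          rw [Finset.sum_const, Nat.card_Icc, nsmul_eq_mul, Nat.add_sub_cancel]
          linear_combination hi ^ 2 * hXM
  have hfin : 0 ≤ ∑ i ∈ Finset.Icc 1 m, r (N + 1) i ^ 2 * x :=
    Finset.sum_nonneg fun i _ => by positivity
  have hlast : ((N + 1 : ℕ) : ℝ) * (4 * L * C * τ) = 4 * L * C * T := by
    push_cast
    linear_combination 4 * L * C * hτN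
  rw [hlast] at hsum
  have hA0 : 0 ≤ ∑ n ∈ Finset.range (N + 1), ∑ i ∈ Finset.Icc 1 m,
      (r (n + 1) i - r n i) ^ 2 * x :=
    Finset.sum_nonneg fun n _ => Finset.sum_nonneg fun i _ => by positivity
  have hB0 : 0 ≤ ∑ n ∈ Finset.range (N + 1), ∑ i ∈ Finset.Ico 1 m,
      (r (n + 1) (i + 1) - r (n + 1) i) ^ 2 / x * τ :=
    Finset.sum_nonneg fun n _ => Finset.sum_nonneg fun i _ => by positivity
  have hA : ∑ n ∈ Finset.range (N + 1), ∑ i ∈ Finset.Icc 1 m,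
      (r (n + 1) i - r n i) ^ 2 * x ≤ E₀ := by
    have := mul_nonneg (mul_nonneg two_pos.le hκ0.le) hB0
    linarith
  have hB : ∑ n ∈ Finset.range (N + 1), ∑ i ∈ Finset.Ico 1 m,
      (r (n + 1) (i + 1) - r (n + 1) i) ^ 2 / x * τ ≤ E₁ := by
    rw [hE₁, le_div_iff₀ (by positivity)]
    linarith
  have hV : ∑ n ∈ Finset.range (N + 1), ∑ i ∈ Finset.Ico 1 m,
      velocity L M boltzmann V W r n i ^ 2 * x * τ ≤ E₂ := by
    have e1 : ∀ n ∈ Finset.range (N + 1), ∀ i ∈ Finset.Ico 1 m,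
        velocity L M boltzmann V W r n i ^ 2 * x * τ ≤
          2 / lo ^ 2 * ((r (n + 1) (i + 1) - r (n + 1) i) ^ 2 / x * τ) + 2 * K ^ 2 * τ * x := by
      intro n hn i hi
      obtain ⟨h1, h2⟩ := Finset.mem_Ico.1 hi
      have e2 := h.abs_velocity_le hL hlo (n := n) (by simpa [Nat.lt_succ_iff] using hn) h1 h2
      have e3 : velocity L M boltzmann V W r n i ^ 2 ≤
          2 * (|r (n + 1) (i + 1) - r (n + 1) i| / (lo * x)) ^ 2 + 2 * K ^ 2 := by
        rw [← sq_abs]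
        calc _ ≤ (|r (n + 1) (i + 1) - r (n + 1) i| / (lo * x) + K) ^ 2 := by gcongr
          _ ≤ _ := by nlinarith [sq_nonneg (|r (n + 1) (i + 1) - r (n + 1) i| / (lo * x) - K)]
      have e4 := mul_le_mul_of_nonneg_right e3 (mul_pos hX hτ).le
      rw [div_pow, sq_abs] at e4
      calc _ = velocity L M boltzmann V W r n i ^ 2 * (x * τ) := by ring
        _ ≤ _ := e4
        _ = _ := by field_simp
    calc _ ≤ ∑ n ∈ Finset.range (N + 1), ∑ i ∈ Finset.Ico 1 m,
          (2 / lo ^ 2 * ((r (n + 1) (i + 1) - r (n + 1) i) ^ 2 / x * τ) + 2 * K ^ 2 * τ * x) :=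
          Finset.sum_le_sum fun n hn => Finset.sum_le_sum (e1 n hn)
      _ = 2 / lo ^ 2 * (∑ n ∈ Finset.range (N + 1), ∑ i ∈ Finset.Ico 1 m,
          (r (n + 1) (i + 1) - r (n + 1) i) ^ 2 / x * τ)
          + ((N + 1 : ℕ) : ℝ) * (2 * K ^ 2 * τ * (2 * L - x)) := by
          simp_rw [Finset.sum_add_distrib, hcardm, ← Finset.mul_sum]
          rw [Finset.sum_const, Finset.card_range, nsmul_eq_mul]
          ring
      _ ≤ 2 / lo ^ 2 * E₁ + 2 * K ^ 2 * (2 * L * T) := by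
          have f1 : ((N + 1 : ℕ) : ℝ) * (2 * K ^ 2 * τ * (2 * L - x)) =
              2 * K ^ 2 * (2 * L - x) * T := by
            push_cast
            linear_combination 2 * K ^ 2 * (2 * L - x) * hτN
          rw [f1]
          refine add_le_add (by gcongr) ?_
          have : 0 ≤ 2 * K ^ 2 * x * T := by positivity
          linarith
      _ = E₂ := by rw [hE₂]; ring
  exact ⟨by linarith, by linarith, by linarith⟩

/-! ### Piecewise constant interpolations -/

/-- The half-open space-time cylinder, the disjoint union of the mesh cells. -/
def halfCyl (L T : ℝ) : Set (ℝ × ℝ) := Ico 0 T ×ˢ Ico (-L) L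

lemma measurableSet_halfCyl (L T : ℝ) : MeasurableSet (halfCyl L T) :=
  measurableSet_Ico.prod measurableSet_Ico

lemma restrict_cyl (L T : ℝ) :
    (volume : Measure (ℝ × ℝ)).restrict (cyl L T) = volume.restrict (halfCyl L T) := by
  refine Measure.restrict_congr_set ?_
  rw [cyl, halfCyl, dom, Measure.volume_eq_prod]
  exact Measure.set_prod_ae_eq Ioo_ae_eq_Ico Ioo_ae_eq_Ico

lemma cyl_subset_halfCyl (L T : ℝ) : cyl L T ⊆ halfCyl L T :=
  prod_mono Ioo_subset_Ico_self Ioo_subset_Ico_self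

lemma volume_halfCyl_lt_top (L T : ℝ) : volume (halfCyl L T) < ⊤ := by
  rw [halfCyl, Measure.volume_eq_prod, Measure.prod_prod]
  exact ENNReal.mul_lt_top measure_Ico_lt_top measure_Ico_lt_top

instance isFiniteMeasure_restrict_halfCyl (L T : ℝ) :
    IsFiniteMeasure ((volume : Measure (ℝ × ℝ)).restrict (halfCyl L T)) :=
  ⟨by rw [Measure.restrict_apply_univ]; exact volume_halfCyl_lt_top L T⟩

lemma measurableSet_timeCell (T : ℝ) (N n : ℕ) : MeasurableSet (timeCell T N n) := measurableSet_Ico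

lemma timeCell_unique {T : ℝ} (hT : 0 < T) {N n n' : ℕ} {t : ℝ} (h : t ∈ timeCell T N n)
    (h' : t ∈ timeCell T N n') : n = n' := by
  have hτ := stepT_pos hT N
  have key : ∀ {a b : ℕ}, t ∈ timeCell T N a → t ∈ timeCell T N b → a ≤ b := by
    intro a b ha hb
    have : (a : ℝ) < (b : ℝ) + 1 := lt_of_mul_lt_mul_right (ha.1.trans_lt hb.2) hτ.le
    have : a < b + 1 := by exact_mod_cast this
    omega
  exact le_antisymm (key h h') (key h' h)

lemma cell_unique {L : ℝ} (hL : 0 < L) {M : ℕ} (hM : 1 ≤ M) {i i' : ℕ} {x : ℝ}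
    (h : x ∈ cell L M i) (h' : x ∈ cell L M i') : i = i' := by
  have hX := stepX_pos hL hM
  have key : ∀ {a b : ℕ}, x ∈ cell L M a → x ∈ cell L M b → a ≤ b := by
    intro a b ha hb
    have h1 : stepX L M * ((a : ℝ) - 1) < stepX L M * b := by linarith [ha.1, hb.2]
    have : (a : ℝ) - 1 < b := lt_of_mul_lt_mul_left h1 hX.le
    have : a < b + 1 := by exact_mod_cast (by linarith : (a : ℝ) < b + 1)
    omega
  exact le_antisymm (key h h') (key h' h)

lemma exists_mem_timeCell {T : ℝ} (hT : 0 < T) (N : ℕ) {t : ℝ} (ht : t ∈ Ico 0 T) :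
    ∃ n ≤ N, t ∈ timeCell T N n := by
  have hτ := stepT_pos hT N
  refine ⟨⌊t / stepT T N⌋₊, ?_, ?_, ?_⟩
  · have h1 := Nat.floor_le (div_nonneg ht.1 hτ.le)
    rw [le_div_iff₀ hτ] at h1
    have h2 := (h1.trans_lt ht.2).trans_eq (stepT_mul T N).symm
    have h3 := lt_of_mul_lt_mul_right h2 hτ.le
    have : ⌊t / stepT T N⌋₊ < N + 1 := by exact_mod_cast h3
    omega
  · have h1 := Nat.floor_le (div_nonneg ht.1 hτ.le)
    rwa [le_div_iff₀ hτ] at h1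
  · have h1 := Nat.lt_floor_add_one (t / stepT T N)
    rwa [div_lt_iff₀ hτ] at h1

lemma exists_mem_cell {L : ℝ} (hL : 0 < L) {M : ℕ} (hM : 1 ≤ M) {x : ℝ} (hx : x ∈ Ico (-L) L) :
    ∃ i ∈ Finset.Icc 1 (2 * M), x ∈ cell L M i := by
  have hX := stepX_pos hL hM
  have h0 : 0 ≤ (x + L) / stepX L M := div_nonneg (by linarith [hx.1]) hX.le
  have h1 := Nat.floor_le h0
  rw [le_div_iff₀ hX] at h1
  have h2 := Nat.lt_floor_add_one ((x + L) / stepX L M)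
  rw [div_lt_iff₀ hX] at h2
  refine ⟨⌊(x + L) / stepX L M⌋₊ + 1, ?_, ?_, ?_⟩
  · have h3 : (⌊(x + L) / stepX L M⌋₊ : ℝ) * stepX L M < ((2 * M : ℕ) : ℝ) * stepX L M := by
      rw [mul_comm ((2 * M : ℕ) : ℝ), stepX_mul hM]
      linarith [hx.2]
    have h4 := lt_of_mul_lt_mul_right h3 hX.le
    have h5 : ⌊(x + L) / stepX L M⌋₊ < 2 * M := by exact_mod_cast h4
    simp; omega
  · push_cast
    linarith
  · push_cast
    linarith

lemma timeCell_subset {T : ℝ} (hT : 0 < T) {N n : ℕ} (hn : n ≤ N) :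
    timeCell T N n ⊆ Ico 0 T := by
  have hτ := stepT_pos hT N
  have h1 := stepT_mul T N
  have h2 : (n : ℝ) ≤ N := by exact_mod_cast hn
  apply Ico_subset_Ico
  · positivity
  · nlinarith

lemma interp_of_mem {L T : ℝ} (hL : 0 < L) (hT : 0 < T) {M N : ℕ} (hM : 1 ≤ M) {n i : ℕ}
    (hn : n ≤ N) (hi : i ∈ Finset.Icc 1 (2 * M)) {z : ℝ × ℝ}
    (hz : z ∈ timeCell T N n ×ˢ cell L M i) (a : ℕ → ℕ → ℝ) : interp L T M N a z = a n i := by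
  rw [interp, Finset.sum_eq_single n, Finset.sum_eq_single i, indicator_of_mem hz]
  · intro j _ hj
    refine indicator_of_notMem (fun h => hj ?_) _
    exact cell_unique hL hM h.2 hz.2
  · exact fun h => absurd hi h
  · intro k _ hk
    refine Finset.sum_eq_zero fun j _ => indicator_of_notMem (fun h => hk ?_) _
    exact timeCell_unique hT h.1 hz.1
  · intro h
    exact absurd (Finset.mem_range.2 (by omega)) h

lemma interp_of_notMem {L T : ℝ} (hL : 0 < L) (hT : 0 < T) {M N : ℕ} (hM : 1 ≤ M) {z : ℝ × ℝ}
    (hz : z ∉ halfCyl L T) (a : ℕ → ℕ → ℝ) : interp L T M N a z = 0 := by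
  refine Finset.sum_eq_zero fun n hn => Finset.sum_eq_zero fun i hi => ?_
  refine indicator_of_notMem (fun h => hz ?_) _
  exact ⟨timeCell_subset hT (by simpa [Nat.lt_succ_iff] using hn) h.1, cell_subset hL hM hi h.2⟩

lemma exists_index {L T : ℝ} (hL : 0 < L) (hT : 0 < T) {M : ℕ} (N : ℕ) (hM : 1 ≤ M) {z : ℝ × ℝ}
    (hz : z ∈ halfCyl L T) : ∃ n i, n ≤ N ∧ i ∈ Finset.Icc 1 (2 * M) ∧ z.1 ∈ timeCell T N n ∧
      z.2 ∈ cell L M i ∧ ∀ a, interp L T M N a z = a n i := by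
  obtain ⟨n, hn, h1⟩ := exists_mem_timeCell hT N hz.1
  obtain ⟨i, hi, h2⟩ := exists_mem_cell hL hM hz.2
  exact ⟨n, i, hn, hi, h1, h2, interp_of_mem hL hT hM hn hi ⟨h1, h2⟩⟩

lemma measurable_interp (L T : ℝ) (M N : ℕ) (a : ℕ → ℕ → ℝ) : Measurable (interp L T M N a) := by
  refine Finset.measurable_sum _ fun n _ => Finset.measurable_sum _ fun i _ => ?_
  exact measurable_const.indicator ((measurableSet_timeCell T N n).prod (measurableSet_cell L M i))

lemma volume_real_timeCell {T : ℝ} (hT : 0 < T) (N n : ℕ) :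
    volume.real (timeCell T N n) = stepT T N := by
  have := stepT_pos hT N
  rw [timeCell, Real.volume_real_Ico_of_le (by nlinarith)]
  ring

lemma volume_real_timeCell_prod_cell {L T : ℝ} (hL : 0 < L) (hT : 0 < T) {M : ℕ} (N : ℕ)
    (hM : 1 ≤ M) (n i : ℕ) :
    (volume : Measure (ℝ × ℝ)).real (timeCell T N n ×ˢ cell L M i) = stepT T N * stepX L M := by
  rw [Measure.volume_eq_prod, measureReal_prod_prod, volume_real_timeCell hT, volume_real_cell hL hM]

lemma integral_interp_mul {L T : ℝ} (hL : 0 < L) (hT : 0 < T) {M N : ℕ} (hM : 1 ≤ M)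
    (a : ℕ → ℕ → ℝ) {g : ℝ × ℝ → ℝ} (hg : IntegrableOn g (halfCyl L T)) :
    ∫ z in halfCyl L T, interp L T M N a z * g z =
      ∑ n ∈ Finset.range (N + 1), ∑ i ∈ Finset.Icc 1 (2 * M),
        a n i * ∫ z in timeCell T N n ×ˢ cell L M i, g z := by
  have hms : ∀ n i, MeasurableSet (timeCell T N n ×ˢ cell L M i) := fun n i =>
    (measurableSet_timeCell T N n).prod (measurableSet_cell L M i)
  have e : ∀ z, interp L T M N a z * g z = ∑ n ∈ Finset.range (N + 1),
      ∑ i ∈ Finset.Icc 1 (2 * M),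
        (timeCell T N n ×ˢ cell L M i).indicator (fun z => a n i * g z) z := by
    intro z
    rw [interp, Finset.sum_mul]
    refine Finset.sum_congr rfl fun n _ => ?_
    rw [Finset.sum_mul]
    refine Finset.sum_congr rfl fun i _ => ?_
    by_cases hz : z ∈ timeCell T N n ×ˢ cell L M i
    · rw [indicator_of_mem hz, indicator_of_mem hz]
    · rw [indicator_of_notMem hz, indicator_of_notMem hz, zero_mul]
  have hI : ∀ n i, Integrable ((timeCell T N n ×ˢ cell L M i).indicator (fun z => a n i * g z))
      (volume.restrict (halfCyl L T)) := fun n i =>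
    (Integrable.const_mul hg (a n i)).indicator (hms n i)
  simp_rw [e]
  rw [integral_finsetSum _ fun n _ => integrable_finsetSum _ fun i _ => hI n i]
  refine Finset.sum_congr rfl fun n hn => ?_
  rw [integral_finsetSum _ fun i _ => hI n i]
  refine Finset.sum_congr rfl fun i hi => ?_
  rw [integral_indicator (hms n i), Measure.restrict_restrict (hms n i),
    inter_eq_self_of_subset_left (t := halfCyl L T) (prod_mono
      (timeCell_subset hT (by simpa [Nat.lt_succ_iff] using hn)) (cell_subset hL hM hi)),
    integral_const_mul]

lemma integral_interp {L T : ℝ} (hL : 0 < L) (hT : 0 < T) {M N : ℕ} (hM : 1 ≤ M)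
    (a : ℕ → ℕ → ℝ) :
    ∫ z in halfCyl L T, interp L T M N a z =
      ∑ n ∈ Finset.range (N + 1), ∑ i ∈ Finset.Icc 1 (2 * M),
        a n i * (stepT T N * stepX L M) := by
  have := integral_interp_mul (N := N) hL hT hM a (g := fun _ => 1)
    (integrableOn_const (volume_halfCyl_lt_top L T).ne)
  simp only [mul_one, setIntegral_const, smul_eq_mul, volume_real_timeCell_prod_cell hL hT N hM]
    at this
  exact this

lemma abs_interp_le {L T : ℝ} (hL : 0 < L) (hT : 0 < T) {M N : ℕ} (hM : 1 ≤ M)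
    {a : ℕ → ℕ → ℝ} {C : ℝ} (hC : 0 ≤ C)
    (h : ∀ n ≤ N, ∀ i ∈ Finset.Icc 1 (2 * M), |a n i| ≤ C) (z : ℝ × ℝ) :
    |interp L T M N a z| ≤ C := by
  by_cases hz : z ∈ halfCyl L T
  · obtain ⟨n, i, hn, hi, -, -, e⟩ := exists_index hL hT N hM hz
    rw [e]; exact h n hn i hi
  · rw [interp_of_notMem hL hT hM hz]; simpa using hC

/-! ### Functions of one variable that are constant on the cells -/

/-- The function equal to `b i` on the `i`-th cell and to `0` outside the domain. -/
def cellFn (L : ℝ) (M : ℕ) (b : ℕ → ℝ) (x : ℝ) : ℝ :=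
  ∑ i ∈ Finset.Icc 1 (2 * M), (cell L M i).indicator (fun _ => b i) x

lemma measurable_cellFn (L : ℝ) (M : ℕ) (b : ℕ → ℝ) : Measurable (cellFn L M b) :=
  Finset.measurable_sum _ fun i _ => measurable_const.indicator (measurableSet_cell L M i)

lemma cellFn_of_mem {L : ℝ} (hL : 0 < L) {M : ℕ} (hM : 1 ≤ M) {i : ℕ}
    (hi : i ∈ Finset.Icc 1 (2 * M)) {x : ℝ} (hx : x ∈ cell L M i) (b : ℕ → ℝ) :
    cellFn L M b x = b i := by
  rw [cellFn, Finset.sum_eq_single i, indicator_of_mem hx]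
  · intro j _ hj
    exact indicator_of_notMem (fun h => hj (cell_unique hL hM h hx)) _
  · exact fun h => absurd hi h

lemma cellFn_of_notMem {L : ℝ} (hL : 0 < L) {M : ℕ} (hM : 1 ≤ M) {x : ℝ} (hx : x ∉ Ico (-L) L)
    (b : ℕ → ℝ) : cellFn L M b x = 0 :=
  Finset.sum_eq_zero fun _ hi => indicator_of_notMem (fun h => hx (cell_subset hL hM hi h)) _

lemma interp_eq_cellFn {L T : ℝ} (hL : 0 < L) (hT : 0 < T) {M N : ℕ} (hM : 1 ≤ M) {n : ℕ}
    (hn : n ≤ N) {t : ℝ} (ht : t ∈ timeCell T N n) (a : ℕ → ℕ → ℝ) (x : ℝ) :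
    interp L T M N a (t, x) = cellFn L M (a n) x := by
  by_cases hx : x ∈ Ico (-L) L
  · obtain ⟨i, hi, h⟩ := exists_mem_cell hL hM hx
    rw [cellFn_of_mem hL hM hi h, interp_of_mem hL hT hM hn hi ⟨ht, h⟩]
  · rw [cellFn_of_notMem hL hM hx, interp_of_notMem hL hT hM fun h => hx h.2]

lemma abs_cellFn_le {L : ℝ} (hL : 0 < L) {M : ℕ} (hM : 1 ≤ M) {b : ℕ → ℝ} {C : ℝ} (hC : 0 ≤ C)
    (h : ∀ i ∈ Finset.Icc 1 (2 * M), |b i| ≤ C) (x : ℝ) : |cellFn L M b x| ≤ C := by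
  by_cases hx : x ∈ Ico (-L) L
  · obtain ⟨i, hi, h'⟩ := exists_mem_cell hL hM hx
    rw [cellFn_of_mem hL hM hi h']; exact h i hi
  · rw [cellFn_of_notMem hL hM hx]; simpa using hC

lemma integral_cellFn_mul {L : ℝ} {M : ℕ} (b : ℕ → ℝ) {g : ℝ → ℝ}
    (hg : ∀ i ∈ Finset.Icc 1 (2 * M), IntegrableOn g (cell L M i)) :
    ∫ x, cellFn L M b x * g x = ∑ i ∈ Finset.Icc 1 (2 * M), b i * ∫ x in cell L M i, g x := by
  have e : ∀ x, cellFn L M b x * g x =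
      ∑ i ∈ Finset.Icc 1 (2 * M), (cell L M i).indicator (fun x => b i * g x) x := by
    intro x
    rw [cellFn, Finset.sum_mul]
    refine Finset.sum_congr rfl fun i _ => ?_
    by_cases hx : x ∈ cell L M i
    · rw [indicator_of_mem hx, indicator_of_mem hx]
    · rw [indicator_of_notMem hx, indicator_of_notMem hx, zero_mul]
  simp_rw [e]
  rw [integral_finsetSum]
  · refine Finset.sum_congr rfl fun i _ => ?_
    rw [integral_indicator (measurableSet_cell L M i), integral_const_mul]
  · intro i hi
    exact (integrable_indicator_iff (measurableSet_cell L M i)).2 ((hg i hi).const_mul _)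

/-- Total variation on the line of the function `cellFn L M b`. -/
def cellVariation (M : ℕ) (b : ℕ → ℝ) : ℝ :=
  ∑ i ∈ Finset.Ico 1 (2 * M), |b (i + 1) - b i| + |b 1| + |b (2 * M)|

lemma lintegral_translate_step (p s : ℝ) :
    ∫⁻ x, ‖(Ici p).indicator (fun _ => (1 : ℝ)) (x + s) - (Ici p).indicator (fun _ => (1 : ℝ)) x‖ₑ
      ≤ ENNReal.ofReal |s| := by
  have e : ∀ x, ‖(Ici p).indicator (fun _ => (1 : ℝ)) (x + s)
      - (Ici p).indicator (fun _ => (1 : ℝ)) x‖ₑ ≤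
      (Ico (min p (p - s)) (max p (p - s))).indicator (fun _ => (1 : ℝ≥0∞)) x := by
    intro x
    by_cases h1 : p ≤ x + s <;> by_cases h2 : p ≤ x
    · simp [indicator, h1, h2]
    · have : x ∈ Ico (min p (p - s)) (max p (p - s)) :=
        ⟨(min_le_right _ _).trans (by linarith), (not_le.1 h2).trans_le (le_max_left _ _)⟩
      simp [indicator, h1, h2, this]
    · have : x ∈ Ico (min p (p - s)) (max p (p - s)) :=
        ⟨(min_le_left _ _).trans h2, lt_of_lt_of_le (by linarith) (le_max_right _ _)⟩
      simp [indicator, h1, h2, this]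
    · simp [indicator, h1, h2]
  refine (lintegral_mono e).trans ?_
  rw [lintegral_indicator measurableSet_Ico, setLIntegral_const, one_mul, Real.volume_Ico,
    max_sub_min_eq_abs]
  simp

lemma cellFn_eq_sum_steps {L : ℝ} (hL : 0 < L) {M : ℕ} (hM : 1 ≤ M) (b : ℕ → ℝ) (x : ℝ) :
    cellFn L M b x =
      ∑ i ∈ Finset.Ico 1 (2 * M), (b (i + 1) - b i) *
        (Ici (-L + stepX L M * (i : ℝ))).indicator (fun _ => (1 : ℝ)) x
      + b 1 * (Ici (-L)).indicator (fun _ => (1 : ℝ)) x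
      - b (2 * M) * (Ici L).indicator (fun _ => (1 : ℝ)) x := by
  have hX := stepX_pos hL hM
  set S : ℕ → ℝ := fun i => (Ici (-L + stepX L M * (i : ℝ))).indicator (fun _ => (1 : ℝ)) x with hS
  have e1 : ∀ i, (cell L M (i + 1)).indicator (fun _ => b (i + 1)) x
      = b (i + 1) * (S i - S (i + 1)) := by
    intro i
    simp only [hS, cell, indicator, mem_Ico, mem_Ici]
    push_cast
    rw [add_sub_cancel_right]
    by_cases h1 : -L + stepX L M * (i : ℝ) ≤ x <;>
      by_cases h2 : -L + stepX L M * ((i : ℝ) + 1) ≤ x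
    · simp only [h1, h2, not_lt.2 h2, and_false, if_true, if_false]
      ring
    · simp [h1, h2, not_le.1 h2]
    · exfalso; nlinarith
    · simp [h1, h2]
  have key : ∀ m, ∑ i ∈ Finset.range (m + 1), b (i + 1) * (S i - S (i + 1)) =
      ∑ i ∈ Finset.Ico 1 (m + 1), (b (i + 1) - b i) * S i + b 1 * S 0 - b (m + 1) * S (m + 1) := by
    intro m
    induction m with
    | zero => simp; ring
    | succ m ih =>
      rw [Finset.sum_range_succ, ih, Finset.sum_Ico_succ_top (by omega : 1 ≤ m + 1)]
      ring
  obtain ⟨m, hm⟩ : ∃ m, 2 * M = m + 1 := ⟨2 * M - 1, by omega⟩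
  have hlast : S (2 * M) = (Ici L).indicator (fun _ => (1 : ℝ)) x := by
    simp only [hS]
    rw [stepX_mul hM]
    congr 2; ring
  have hfirst : S 0 = (Ici (-L)).indicator (fun _ => (1 : ℝ)) x := by simp [hS]
  rw [cellFn, sum_Icc_one_eq_sum_range, Finset.sum_congr rfl fun i _ => e1 i, ← hlast, ← hfirst, hm,
    key]

/-- Translating `cellFn L M b` by `s` changes it in `L¹` by at most `|s|` times its variation. -/
lemma lintegral_translate_cellFn {L : ℝ} (hL : 0 < L) {M : ℕ} (hM : 1 ≤ M) (b : ℕ → ℝ) (s : ℝ) :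
    ∫⁻ x, ‖cellFn L M b (x + s) - cellFn L M b x‖ₑ ≤ ENNReal.ofReal (|s| * cellVariation M b) := by
  set D : ℝ → ℝ → ℝ := fun p x => (Ici p).indicator (fun _ => (1 : ℝ)) (x + s)
    - (Ici p).indicator (fun _ => (1 : ℝ)) x with hD
  have hDm : ∀ p, Measurable (D p) := fun p =>
    ((measurable_const.indicator measurableSet_Ici).comp (measurable_add_const s)).sub
      (measurable_const.indicator measurableSet_Ici)
  have e : ∀ x, cellFn L M b (x + s) - cellFn L M b x =
      ∑ i ∈ Finset.Ico 1 (2 * M), (b (i + 1) - b i) * D (-L + stepX L M * (i : ℝ)) x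
      + b 1 * D (-L) x - b (2 * M) * D L x := by
    intro x
    rw [cellFn_eq_sum_steps hL hM, cellFn_eq_sum_steps hL hM]
    simp only [hD, mul_sub, Finset.sum_sub_distrib]
    ring
  have hle : ∀ x, ‖cellFn L M b (x + s) - cellFn L M b x‖ₑ ≤
      ∑ i ∈ Finset.Ico 1 (2 * M), ‖b (i + 1) - b i‖ₑ * ‖D (-L + stepX L M * (i : ℝ)) x‖ₑ
      + ‖b 1‖ₑ * ‖D (-L) x‖ₑ + ‖b (2 * M)‖ₑ * ‖D L x‖ₑ := by
    intro x
    rw [e]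
    refine (enorm_sub_le).trans (add_le_add ((enorm_add_le _ _).trans (add_le_add ?_ ?_)) ?_)
    · refine (enorm_sum_le _ _).trans (Finset.sum_le_sum fun i _ => ?_)
      rw [enorm_mul]
    · rw [enorm_mul]
    · rw [enorm_mul]
  refine (lintegral_mono hle).trans ?_
  have hm : ∀ p (c : ℝ≥0∞), Measurable fun x => c * ‖D p x‖ₑ := fun p c =>
    (hDm p).enorm.const_mul c
  have hintg : ∀ p (c : ℝ), ∫⁻ x, ‖c‖ₑ * ‖D p x‖ₑ ≤ ENNReal.ofReal (|s| * |c|) := by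
    intro p c
    rw [lintegral_const_mul _ (hDm p).enorm, mul_comm |s|, ENNReal.ofReal_mul (abs_nonneg _),
      Real.enorm_eq_ofReal_abs]
    gcongr
    exact lintegral_translate_step p s
  rw [lintegral_add_right _ (hm _ _), lintegral_add_right _ (hm _ _),
    lintegral_finsetSum _ fun i _ => hm _ _, cellVariation, mul_add, mul_add,
    ENNReal.ofReal_add (by positivity) (by positivity),
    ENNReal.ofReal_add (by positivity) (by positivity), Finset.mul_sum,
    ENNReal.ofReal_sum_of_nonneg fun i _ => by positivity]
  exact add_le_add (add_le_add (Finset.sum_le_sum fun i _ => hintg _ _) (hintg _ _)) (hintg _ _)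

/-! ### Compactness -/

/-- A pointwise bounded, asymptotically equicontinuous sequence of functions on a separable space
has a subsequence that converges everywhere. -/
lemma exists_subseq_tendsto_of_asymptotic_equicontinuity {X : Type*} [TopologicalSpace X]
    [TopologicalSpace.SeparableSpace X] (a : ℕ → X → ℝ) (B : ℝ) (hB : ∀ k x, |a k x| ≤ B)
    (heq : ∀ x, ∀ ε > 0, ∃ U ∈ 𝓝 x, ∃ K, ∀ k ≥ K, ∀ y ∈ U, |a k x - a k y| ≤ ε) :
    ∃ σ : ℕ → ℕ, StrictMono σ ∧ ∀ x, ∃ l, Tendsto (fun k => a (σ k) x) atTop (𝓝 l) := by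
  obtain ⟨s, hs, hd⟩ := TopologicalSpace.exists_countable_dense X
  have : Countable s := hs
  have hcpt : IsCompact (Set.pi univ fun _ : s => Icc (-B) B) :=
    isCompact_univ_pi fun _ => isCompact_Icc
  obtain ⟨l, -, σ, hσ, hl⟩ := hcpt.tendsto_subseq (x := fun k (y : s) => a k y)
    (fun k y _ => abs_le.1 (hB k y))
  refine ⟨σ, hσ, fun x => cauchySeq_tendsto_of_complete ?_⟩
  rw [Metric.cauchySeq_iff']
  intro ε hε
  obtain ⟨U, hU, K, hK⟩ := heq x (ε / 4) (by positivity)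
  obtain ⟨y, hys, hyU⟩ := hd.inter_nhds_nonempty hU
  have hy : CauchySeq fun k => a (σ k) y :=
    ((tendsto_pi_nhds.1 hl) ⟨y, hys⟩).cauchySeq
  obtain ⟨N, hN⟩ := Metric.cauchySeq_iff.1 hy (ε / 4) (by positivity)
  refine ⟨max N K, fun n hn => ?_⟩
  have h1 := hK (σ n) (((le_max_right _ _).trans hn).trans (hσ.id_le n)) y hyU
  have h2 := hK (σ (max N K)) ((le_max_right N K).trans (hσ.id_le _)) y hyU
  have h3 := hN n ((le_max_left _ _).trans hn) (max N K) (le_max_left _ _)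
  rw [Real.dist_eq] at h3 ⊢
  calc |a (σ n) x - a (σ (max N K)) x|
      = |(a (σ n) x - a (σ n) y) + (a (σ n) y - a (σ (max N K)) y)
        - (a (σ (max N K)) x - a (σ (max N K)) y)| := by ring_nf
    _ ≤ |a (σ n) x - a (σ n) y| + |a (σ n) y - a (σ (max N K)) y|
        + |a (σ (max N K)) x - a (σ (max N K)) y| :=
        (abs_sub _ _).trans (add_le_add_left (abs_add_le _ _) _)
    _ < ε := by linarith

/-- A smooth mollifier supported in the ball of radius `1 / (m + 1)`. -/
def mollifier (m : ℕ) : ℝ → ℝ :=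
  (⟨1 / (2 * ((m : ℝ) + 1)), 1 / ((m : ℝ) + 1), by positivity, by
    apply one_div_lt_one_div_of_lt <;> nlinarith [(Nat.cast_nonneg m : (0:ℝ) ≤ m)]⟩ :
      ContDiffBump (0 : ℝ)).normed volume

lemma mollifier_nonneg (m : ℕ) (s : ℝ) : 0 ≤ mollifier m s := ContDiffBump.nonneg_normed _ s

lemma continuous_mollifier (m : ℕ) : Continuous (mollifier m) := ContDiffBump.continuous_normed _

lemma integrable_mollifier (m : ℕ) : Integrable (mollifier m) := ContDiffBump.integrable_normed _

lemma integral_mollifier (m : ℕ) : ∫ s, mollifier m s = 1 := ContDiffBump.integral_normed _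

lemma abs_le_of_mollifier_ne_zero {m : ℕ} {s : ℝ} (h : mollifier m s ≠ 0) :
    |s| ≤ 1 / ((m : ℝ) + 1) := by
  have h1 : s ∈ Function.support (mollifier m) := h
  rw [mollifier, ContDiffBump.support_normed_eq, Metric.mem_ball, dist_zero_right] at h1
  exact h1.le

lemma exists_lipschitz_mollifier (m : ℕ) :
    ∃ K : ℝ, 0 ≤ K ∧ ∀ s s', |mollifier m s - mollifier m s'| ≤ K * |s - s'| := by
  obtain ⟨K, hK⟩ := ContDiff.lipschitzWith_of_hasCompactSupport (𝕂 := ℝ)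
    (f := mollifier m) (n := 1) (ContDiffBump.hasCompactSupport_normed _)
    (ContDiffBump.contDiff_normed _ (n := 1)) (by simp)
  exact ⟨K, K.2, fun s y => hK.dist_le_mul s y⟩

/-- Mollification in the space variable. -/
def mollifyX (m : ℕ) (f : ℝ × ℝ → ℝ) (z : ℝ × ℝ) : ℝ := ∫ y, f (z.1, y) * mollifier m (z.2 - y)

/-- Mollification of the piecewise constant function `cellFn L M b`. -/
def mollifyCell (L : ℝ) (M : ℕ) (m : ℕ) (b : ℕ → ℝ) (x : ℝ) : ℝ :=
  ∫ y, cellFn L M b y * mollifier m (x - y)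

lemma mollifyX_interp {L T : ℝ} (hL : 0 < L) (hT : 0 < T) {M N : ℕ} (hM : 1 ≤ M) (m : ℕ) {n : ℕ}
    (hn : n ≤ N) {z : ℝ × ℝ} (ht : z.1 ∈ timeCell T N n) (a : ℕ → ℕ → ℝ) :
    mollifyX m (interp L T M N a) z = mollifyCell L M m (a n) z.2 := by
  simp only [mollifyX, mollifyCell, interp_eq_cellFn hL hT hM hn ht]

lemma integrable_mollifier_sub (m : ℕ) (x : ℝ) : Integrable fun y => mollifier m (x - y) :=
  (integrable_mollifier m).comp_sub_left x

lemma exists_abs_cellFn_le {L : ℝ} (hL : 0 < L) {M : ℕ} (hM : 1 ≤ M) (b : ℕ → ℝ) :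
    ∃ C, ∀ x, ‖cellFn L M b x‖ ≤ C :=
  ⟨_, abs_cellFn_le hL hM (Finset.sum_nonneg fun i (_ : i ∈ Finset.Icc 1 (2 * M)) => abs_nonneg (b i))
    fun _ hi => Finset.single_le_sum (f := fun i => |b i|) (fun _ _ => abs_nonneg _) hi⟩

lemma integrable_cellFn_mul {L : ℝ} (hL : 0 < L) {M : ℕ} (hM : 1 ≤ M) (b : ℕ → ℝ) {g : ℝ → ℝ}
    (hg : Integrable g) : Integrable fun y => cellFn L M b y * g y := by
  obtain ⟨C, hC⟩ := exists_abs_cellFn_le hL hM b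
  exact hg.bdd_mul (c := C) (measurable_cellFn L M b).aestronglyMeasurable
    (Eventually.of_forall hC)

lemma abs_mollifyCell_le {L : ℝ} (hL : 0 < L) {M : ℕ} (hM : 1 ≤ M) (m : ℕ) {b : ℕ → ℝ} {C : ℝ}
    (hC : 0 ≤ C) (h : ∀ i ∈ Finset.Icc 1 (2 * M), |b i| ≤ C) (x : ℝ) :
    |mollifyCell L M m b x| ≤ C := by
  have h1 : ‖∫ y, cellFn L M b y * mollifier m (x - y)‖ ≤ ∫ y, C * mollifier m (x - y) := by
    refine norm_integral_le_of_norm_le ((integrable_mollifier_sub m x).const_mul C)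
      (Eventually.of_forall fun y => ?_)
    rw [norm_mul, Real.norm_of_nonneg (mollifier_nonneg m _)]
    exact mul_le_mul_of_nonneg_right (abs_cellFn_le hL hM hC h y) (mollifier_nonneg m _)
  rw [integral_const_mul, integral_sub_left_eq_self (mollifier m) volume x, integral_mollifier,
    mul_one] at h1
  exact h1

lemma lintegral_sub_mollifyCell_le {L : ℝ} (hL : 0 < L) {M : ℕ} (hM : 1 ≤ M) (m : ℕ) (b : ℕ → ℝ) :
    ∫⁻ x, ‖cellFn L M b x - mollifyCell L M m b x‖ₑ
      ≤ ENNReal.ofReal (1 / ((m : ℝ) + 1) * cellVariation M b) := by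
  set g := cellFn L M b with hg
  have hgm : Measurable g := measurable_cellFn L M b
  have hkm : Measurable (mollifier m) := (continuous_mollifier m).measurable
  have h1 : ∀ x, ‖g x - mollifyCell L M m b x‖ₑ ≤ ∫⁻ s, ‖mollifier m s‖ₑ * ‖g x - g (x - s)‖ₑ := by
    intro x
    have e1 : g x - mollifyCell L M m b x = ∫ y, mollifier m (x - y) * (g x - g y) := by
      have e2 : g x = ∫ y, mollifier m (x - y) * g x := by
        rw [integral_mul_const, integral_sub_left_eq_self (mollifier m) volume x,
          integral_mollifier, one_mul]
      simp_rw [mul_sub]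
      rw [integral_sub ((integrable_mollifier_sub m x).mul_const _)
        (by simpa [mul_comm] using integrable_cellFn_mul hL hM b (integrable_mollifier_sub m x)),
        ← e2, mollifyCell]
      simp_rw [mul_comm (mollifier m _)]
      rfl
    rw [e1]
    refine (enorm_integral_le_lintegral_enorm _).trans (le_of_eq ?_)
    rw [← lintegral_sub_left_eq_self (fun s => ‖mollifier m s‖ₑ * ‖g x - g (x - s)‖ₑ) x]
    simp_rw [enorm_mul, sub_sub_cancel]
  refine (lintegral_mono h1).trans ?_
  rw [lintegral_lintegral_swap]
  · have h2 : ∀ s, ∫⁻ x, ‖mollifier m s‖ₑ * ‖g x - g (x - s)‖ₑ ≤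
        ‖mollifier m s‖ₑ * ENNReal.ofReal (1 / ((m : ℝ) + 1) * cellVariation M b) := by
      intro s
      have hm : Measurable fun x => ‖g x - g (x - s)‖ₑ :=
        (hgm.sub (hgm.comp (measurable_sub_const s))).enorm
      rw [lintegral_const_mul _ hm]
      by_cases hs : mollifier m s = 0
      · simp [hs]
      · gcongr
        have h3 := lintegral_translate_cellFn hL hM b (-s)
        have e3 : ∀ x, ‖g x - g (x - s)‖ₑ = ‖cellFn L M b (x + -s) - cellFn L M b x‖ₑ := fun x => by
          rw [enorm_sub_rev, ← sub_eq_add_neg]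
        rw [lintegral_congr e3]
        refine h3.trans (ENNReal.ofReal_le_ofReal ?_)
        rw [abs_neg]
        refine mul_le_mul_of_nonneg_right (abs_le_of_mollifier_ne_zero hs) ?_
        unfold cellVariation
        positivity
    refine (lintegral_mono h2).trans ?_
    rw [lintegral_mul_const _ hkm.enorm]
    have h4 : ∫⁻ s, ‖mollifier m s‖ₑ = 1 := by
      rw [← ofReal_integral_norm_eq_lintegral_enorm (integrable_mollifier m)]
      simp_rw [Real.norm_of_nonneg (mollifier_nonneg m _), integral_mollifier, ENNReal.ofReal_one]
    rw [h4, one_mul]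
  · refine Measurable.aemeasurable ?_
    exact (hkm.comp measurable_snd).enorm.mul
      ((hgm.comp measurable_fst).sub (hgm.comp (measurable_fst.sub measurable_snd))).enorm

lemma abs_mollifyCell_sub_le_space {L : ℝ} (hL : 0 < L) {M : ℕ} (hM : 1 ≤ M) (m : ℕ) {b : ℕ → ℝ}
    {C K : ℝ} (hC : 0 ≤ C) (hK : ∀ s s', |mollifier m s - mollifier m s'| ≤ K * |s - s'|)
    (h : ∀ i ∈ Finset.Icc 1 (2 * M), |b i| ≤ C) (x x' : ℝ) :
    |mollifyCell L M m b x - mollifyCell L M m b x'| ≤ 2 * L * C * K * |x - x'| := by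
  have e : mollifyCell L M m b x - mollifyCell L M m b x' =
      ∫ y in Ico (-L) L, cellFn L M b y * (mollifier m (x - y) - mollifier m (x' - y)) := by
    rw [mollifyCell, mollifyCell, ← integral_sub
      (integrable_cellFn_mul hL hM b (integrable_mollifier_sub m x))
      (integrable_cellFn_mul hL hM b (integrable_mollifier_sub m x')),
      setIntegral_eq_integral_of_forall_compl_eq_zero]
    · simp_rw [mul_sub]
    · intro y hy
      rw [cellFn_of_notMem hL hM hy, zero_mul]
  rw [e]
  have := norm_setIntegral_le_of_norm_le_const (μ := volume) (s := Ico (-L) L)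
    (f := fun y => cellFn L M b y * (mollifier m (x - y) - mollifier m (x' - y)))
    (C := C * (K * |x - x'|)) measure_Ico_lt_top (fun y _ => by
      rw [norm_mul]
      refine mul_le_mul (abs_cellFn_le hL hM hC h y) ?_ (norm_nonneg _) hC
      have := hK (x - y) (x' - y)
      rwa [sub_sub_sub_cancel_right] at this)
  rw [Real.volume_real_Ico_of_le (by linarith)] at this
  refine this.trans (le_of_eq ?_)
  ring

lemma abs_mollifyCell_sub_le_time {L : ℝ} (hL : 0 < L) {M : ℕ} (hM : 1 ≤ M) (m : ℕ)
    {b b' F : ℕ → ℝ} {τ K : ℝ} (hτ : 0 < τ)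
    (hK : ∀ s s', |mollifier m s - mollifier m s'| ≤ K * |s - s'|)
    (hF0 : F 0 = 0) (hFm : F (2 * M) = 0)
    (hstep : ∀ i ∈ Finset.Icc 1 (2 * M), b' i - b i = -(τ / stepX L M * (F i - F (i - 1))))
    (x : ℝ) : |mollifyCell L M m b' x - mollifyCell L M m b x| ≤
      K * ∑ i ∈ Finset.Ico 1 (2 * M), |F i| * stepX L M * τ := by
  have hX := stepX_pos hL hM
  set ζ : ℕ → ℝ := fun i => ∫ y in cell L M i, mollifier m (x - y) with hζ
  have hintg : ∀ i, IntegrableOn (fun y => mollifier m (x - y)) (cell L M i) := fun i =>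
    (integrable_mollifier_sub m x).integrableOn
  have hζd : ∀ i, |ζ (i + 1) - ζ i| ≤ K * stepX L M * stepX L M := by
    intro i
    simp only [hζ]
    rw [integral_cell_succ, ← integral_sub _ (hintg i)]
    · have := norm_setIntegral_le_of_norm_le_const (μ := volume) (s := cell L M i)
        (f := fun y => mollifier m (x - (y + stepX L M)) - mollifier m (x - y))
        (C := K * stepX L M) measure_Ico_lt_top (fun y _ => by
          have := hK (x - (y + stepX L M)) (x - y)
          rwa [show x - (y + stepX L M) - (x - y) = -stepX L M by ring, abs_neg,
            abs_of_pos hX] at this)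
      rwa [volume_real_cell hL hM] at this
    · have := (integrable_mollifier_sub m (x - stepX L M)).integrableOn (s := cell L M i)
      refine this.congr (Eventually.of_forall fun y => ?_)
      simp only
      congr 1; ring
  have e : mollifyCell L M m b' x - mollifyCell L M m b x =
      τ / stepX L M * ∑ i ∈ Finset.Ico 1 (2 * M), F i * (ζ (i + 1) - ζ i) := by
    rw [mollifyCell, mollifyCell, integral_cellFn_mul _ fun i _ => hintg i,
      integral_cellFn_mul _ fun i _ => hintg i, ← Finset.sum_sub_distrib]
    have e1 : ∀ i ∈ Finset.Icc 1 (2 * M), b' i * (∫ y in cell L M i, mollifier m (x - y))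
        - b i * (∫ y in cell L M i, mollifier m (x - y))
        = -(τ / stepX L M) * (ζ i * (F i - F (i - 1))) := by
      intro i hi
      rw [← sub_mul, hstep i hi]
      simp only [hζ]; ring
    rw [Finset.sum_congr rfl e1, ← Finset.mul_sum, sum_mul_div_eq_neg_sum_flux _ _ _ hF0 hFm,
      show Finset.Icc 1 (2 * M) = Finset.Ico 1 (2 * M + 1) from rfl,
      Finset.sum_Ico_succ_top (by omega), hFm]
    ring
  rw [e, abs_mul, abs_of_pos (div_pos hτ hX)]
  calc τ / stepX L M * |∑ i ∈ Finset.Ico 1 (2 * M), F i * (ζ (i + 1) - ζ i)|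
      ≤ τ / stepX L M * ∑ i ∈ Finset.Ico 1 (2 * M), |F i| * (K * stepX L M * stepX L M) := by
        refine mul_le_mul_of_nonneg_left ((Finset.abs_sum_le_sum_abs _ _).trans
          (Finset.sum_le_sum fun i _ => ?_)) (div_pos hτ hX).le
        rw [abs_mul]
        exact mul_le_mul_of_nonneg_left (hζd i) (abs_nonneg _)
    _ = K * ∑ i ∈ Finset.Ico 1 (2 * M), |F i| * stepX L M * τ := by
        rw [Finset.mul_sum, Finset.mul_sum]
        refine Finset.sum_congr rfl fun i _ => ?_
        field_simp

lemma flux_eq_upwindValue_mul {L : ℝ} {V W : ℝ → ℝ} {M : ℕ} {r : ℕ → ℕ → ℝ}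
    {n i : ℕ} (h1 : 1 ≤ i) (h2 : i < 2 * M) :
    flux L M boltzmann V W r n i = upwindValue (velocity L M boltzmann V W r n i)
      (r (n + 1) i) (r (n + 1) (i + 1)) * velocity L M boltzmann V W r n i := by
  rw [flux, if_pos ⟨h1, h2⟩, upwindValue_mul]

lemma GoodSol.abs_mollifyCell_sub_le {L T : ℝ} (hL : 0 < L) (hT : 0 < T) {V W ρ₀ : ℝ → ℝ}
    {lo hi K E : ℝ} (hlo : 0 < lo) {M N : ℕ} {r : ℕ → ℕ → ℝ}
    (h : GoodSol L T V W ρ₀ lo hi K M N r)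
    (hE : ∑ n ∈ Finset.range (N + 1), ∑ i ∈ Finset.Ico 1 (2 * M),
      velocity L M boltzmann V W r n i ^ 2 * stepX L M * stepT T N ≤ E)
    {m : ℕ} {C : ℝ} (hC0 : 0 ≤ C)
    (hC : ∀ s s', |mollifier m s - mollifier m s'| ≤ C * |s - s'|) {η : ℝ} (hη : 0 < η)
    {n n' : ℕ} (hnn : n ≤ n') (hn' : n' ≤ N) (x : ℝ) :
    |mollifyCell L M m (r (n + 1)) x - mollifyCell L M m (r (n' + 1)) x| ≤
      C * ((η * hi ^ 2 * E + 2 * L * (((n' : ℝ) - n) * stepT T N) / η) / 2) := by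
  have hX := stepX_pos hL h.one_le
  have hτ := stepT_pos hT N
  have hM := h.one_le
  have h1 := dist_le_Ico_sum_of_dist_le (f := fun l => mollifyCell L M m (r l) x)
    (m := n + 1) (n := n' + 1) (by omega)
    (d := fun l => C * ∑ i ∈ Finset.Ico 1 (2 * M),
      |flux L M boltzmann V W r l i| * stepX L M * stepT T N) (by
      intro l hl1 hl2
      rw [dist_comm]
      exact abs_mollifyCell_sub_le_time hL hM m hτ hC (flux_zero ..) (flux_last ..)
        (fun i hi => h.sol.increment hT (by omega) hi) x)
  refine h1.trans ?_
  rw [← Finset.mul_sum]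
  refine mul_le_mul_of_nonneg_left ?_ hC0
  have h2 : ∀ l ∈ Finset.Ico (n + 1) (n' + 1), ∑ i ∈ Finset.Ico 1 (2 * M),
      |flux L M boltzmann V W r l i| * stepX L M * stepT T N ≤
      η * hi ^ 2 / 2 * (∑ i ∈ Finset.Ico 1 (2 * M),
        velocity L M boltzmann V W r l i ^ 2 * stepX L M * stepT T N)
      + 2 * L * stepT T N / (2 * η) := by
    intro l hl
    rw [Finset.mem_Ico] at hl
    have h3 : ∀ i ∈ Finset.Ico 1 (2 * M), |flux L M boltzmann V W r l i| * stepX L M * stepT T N ≤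
        η * hi ^ 2 / 2 * (velocity L M boltzmann V W r l i ^ 2 * stepX L M * stepT T N)
          + stepX L M * stepT T N / (2 * η) := by
      intro i hi'
      rw [Finset.mem_Ico] at hi'
      have hm1 := h.mem (l + 1) (by omega) i (Finset.mem_Icc.2 ⟨hi'.1, by omega⟩)
      have hm2 := h.mem (l + 1) (by omega) (i + 1) (Finset.mem_Icc.2 ⟨by omega, by omega⟩)
      rw [flux_eq_upwindValue_mul hi'.1 hi'.2, abs_mul]
      set u := velocity L M boltzmann V W r l i
      have hv := upwindValue_mem (u := u) hm1 hm2
      rw [abs_of_nonneg (hlo.le.trans hv.1)]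
      have h4 : upwindValue u (r (l + 1) i) (r (l + 1) (i + 1)) * |u| ≤ hi * |u| :=
        mul_le_mul_of_nonneg_right hv.2 (abs_nonneg _)
      have h5 : hi * |u| ≤ η * hi ^ 2 / 2 * u ^ 2 + 1 / (2 * η) := by
        have : 0 ≤ (η * hi * |u| - 1) ^ 2 / (2 * η) := by positivity
        have e : (η * hi * |u| - 1) ^ 2 / (2 * η) =
          η * hi ^ 2 / 2 * |u| ^ 2 + 1 / (2 * η) - hi * |u| := by field_simp; ring
        rw [e, sq_abs] at this
        linarith
      have h6 := mul_le_mul_of_nonneg_right (h4.trans h5) (mul_pos hX hτ).le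
      calc _ = upwindValue u (r (l + 1) i) (r (l + 1) (i + 1)) * |u| * (stepX L M * stepT T N) := by
            ring
        _ ≤ _ := h6
        _ = _ := by field_simp
    refine (Finset.sum_le_sum h3).trans ?_
    rw [Finset.sum_add_distrib, ← Finset.mul_sum, Finset.sum_const, nsmul_eq_mul, Nat.card_Ico]
    have h7 : ((2 * M - 1 : ℕ) : ℝ) ≤ ((2 * M : ℕ) : ℝ) := by exact_mod_cast Nat.sub_le _ _
    have h8 : ((2 * M - 1 : ℕ) : ℝ) * (stepX L M * stepT T N / (2 * η)) ≤
        2 * L * stepT T N / (2 * η) := by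
      rw [← stepX_mul hM (L := L)]
      calc _ ≤ ((2 * M : ℕ) : ℝ) * (stepX L M * stepT T N / (2 * η)) :=
            mul_le_mul_of_nonneg_right h7 (by positivity)
        _ = _ := by ring
    linarith
  refine (Finset.sum_le_sum h2).trans ?_
  rw [Finset.sum_add_distrib, ← Finset.mul_sum, Finset.sum_const, nsmul_eq_mul, Nat.card_Ico]
  have h9 : ∑ l ∈ Finset.Ico (n + 1) (n' + 1), ∑ i ∈ Finset.Ico 1 (2 * M),
      velocity L M boltzmann V W r l i ^ 2 * stepX L M * stepT T N ≤ E := by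
    refine le_trans (Finset.sum_le_sum_of_subset_of_nonneg ?_ fun l _ _ => ?_) hE
    · intro l hl
      simp only [Finset.mem_Ico, Finset.mem_range] at hl ⊢
      omega
    · exact Finset.sum_nonneg fun i _ => by positivity
  have h10 : η * hi ^ 2 / 2 * (∑ l ∈ Finset.Ico (n + 1) (n' + 1), ∑ i ∈ Finset.Ico 1 (2 * M),
      velocity L M boltzmann V W r l i ^ 2 * stepX L M * stepT T N) ≤ η * hi ^ 2 / 2 * E :=
    mul_le_mul_of_nonneg_left h9 (by positivity)
  have e : ((n' + 1 - (n + 1) : ℕ) : ℝ) = (n' : ℝ) - n := by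
    rw [Nat.add_sub_add_right, Nat.cast_sub hnn]
  rw [e]
  calc _ ≤ η * hi ^ 2 / 2 * E + ((n' : ℝ) - n) * (2 * L * stepT T N / (2 * η)) := by gcongr
    _ = _ := by field_simp

/-- The interpolation of the new values: it equals `ρ_i^{n+1}` on `I^n × C_i`. -/
def interpNext (L T : ℝ) (M N : ℕ) (r : ℕ → ℕ → ℝ) : ℝ × ℝ → ℝ :=
  interp L T M N fun n i => r (n + 1) i

lemma GoodSol.abs_mollifyX_sub_le {L T : ℝ} (hL : 0 < L) (hT : 0 < T) {V W ρ₀ : ℝ → ℝ}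
    {lo hi K E : ℝ} (hlo : 0 < lo) {M N : ℕ} {r : ℕ → ℕ → ℝ}
    (h : GoodSol L T V W ρ₀ lo hi K M N r)
    (hE : ∑ n ∈ Finset.range (N + 1), ∑ i ∈ Finset.Ico 1 (2 * M),
      velocity L M boltzmann V W r n i ^ 2 * stepX L M * stepT T N ≤ E)
    {m : ℕ} {C : ℝ} (hC0 : 0 ≤ C)
    (hC : ∀ s s', |mollifier m s - mollifier m s'| ≤ C * |s - s'|) {η : ℝ} (hη : 0 < η)
    {t t' : ℝ} (ht : t ∈ Ico 0 T) (ht' : t' ∈ Ico 0 T) (x x' : ℝ) :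
    |mollifyX m (interpNext L T M N r) (t, x) - mollifyX m (interpNext L T M N r) (t', x')| ≤
      C * ((η * hi ^ 2 * E + 2 * L * (|t - t'| + stepT T N) / η) / 2)
        + 2 * L * hi * C * |x - x'| := by
  have hM := h.one_le
  have hτ := stepT_pos hT N
  obtain ⟨n, hn, hmem⟩ := exists_mem_timeCell hT N ht
  obtain ⟨n', hn', hmem'⟩ := exists_mem_timeCell hT N ht'
  rw [interpNext, mollifyX_interp hL hT hM m hn (z := (t, x)) hmem,
    mollifyX_interp hL hT hM m hn' (z := (t', x')) hmem']
  have hhi : 0 ≤ hi := by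
    have := h.mem 0 (by omega) 1 (Finset.mem_Icc.2 ⟨le_rfl, by omega⟩)
    linarith
  have hsp := abs_mollifyCell_sub_le_space hL hM m (b := r (n' + 1)) hhi hC (fun i hi' => by
    have := h.mem (n' + 1) (by omega) i hi'
    rw [abs_of_nonneg (hlo.le.trans this.1)]; exact this.2) x x'
  have htm : |mollifyCell L M m (r (n + 1)) x - mollifyCell L M m (r (n' + 1)) x| ≤
      C * ((η * hi ^ 2 * E + 2 * L * (|t - t'| + stepT T N) / η) / 2) := by
    rcases le_total n n' with hnn | hnn
    · refine (h.abs_mollifyCell_sub_le hL hT hlo hE hC0 hC hη hnn hn' x).trans ?_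
      have : ((n' : ℝ) - n) * stepT T N ≤ |t - t'| + stepT T N := by
        have := neg_abs_le (t - t')
        nlinarith [hmem.2, hmem'.1]
      gcongr
    · rw [abs_sub_comm]
      refine (h.abs_mollifyCell_sub_le hL hT hlo hE hC0 hC hη hnn hn x).trans ?_
      have : ((n : ℝ) - n') * stepT T N ≤ |t - t'| + stepT T N := by
        have := le_abs_self (t - t')
        nlinarith [hmem'.2, hmem.1]
      gcongr
  exact (abs_sub_le _ (mollifyCell L M m (r (n' + 1)) x) _).trans (add_le_add htm hsp)

/-- A sequence of solutions on refining meshes, with uniform bounds. -/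
structure GoodSeq (L T : ℝ) (V W ρ₀ : ℝ → ℝ) (lo hi K : ℝ) (M N : ℕ → ℕ)
    (r : ℕ → ℕ → ℕ → ℝ) : Prop where
  good : ∀ k, GoodSol L T V W ρ₀ lo hi K (M k) (N k) (r k)
  stepX_tendsto : Tendsto (fun k => stepX L (M k)) atTop (𝓝 0)
  stepT_tendsto : Tendsto (fun k => stepT T (N k)) atTop (𝓝 0)

lemma GoodSeq.comp {L T : ℝ} {V W ρ₀ : ℝ → ℝ} {lo hi K : ℝ} {M N : ℕ → ℕ} {r : ℕ → ℕ → ℕ → ℝ}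
    (h : GoodSeq L T V W ρ₀ lo hi K M N r) {σ : ℕ → ℕ} (hσ : StrictMono σ) :
    GoodSeq L T V W ρ₀ lo hi K (fun k => M (σ k)) (fun k => N (σ k)) (fun k => r (σ k)) :=
  ⟨fun k => h.good (σ k), h.stepX_tendsto.comp hσ.tendsto_atTop,
    h.stepT_tendsto.comp hσ.tendsto_atTop⟩

lemma GoodSol.abs_le {L T : ℝ} {V W ρ₀ : ℝ → ℝ} {lo hi K : ℝ} (hlo : 0 < lo) {M N : ℕ}
    {r : ℕ → ℕ → ℝ} (h : GoodSol L T V W ρ₀ lo hi K M N r) :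
    ∀ n ≤ N + 1, ∀ i ∈ Finset.Icc 1 (2 * M), |r n i| ≤ hi := fun n hn i hi' => by
  have := h.mem n hn i hi'
  rw [abs_of_nonneg (hlo.le.trans this.1)]; exact this.2

lemma GoodSeq.exists_subseq_mollifyX {L T : ℝ} (hL : 0 < L) (hT : 0 < T) {V W ρ₀ : ℝ → ℝ}
    {lo hi K : ℝ} (hlo : 0 < lo) (hhi : 0 < hi) {M N : ℕ → ℕ} {r : ℕ → ℕ → ℕ → ℝ}
    (h : GoodSeq L T V W ρ₀ lo hi K M N r) :
    ∃ σ : ℕ → ℕ, StrictMono σ ∧ ∀ m : ℕ, ∀ t ∈ Ico 0 T, ∀ x, ∃ l, Tendsto (fun k =>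
      mollifyX m (interpNext L T (M (σ k)) (N (σ k)) (r (σ k))) (t, x)) atTop (𝓝 l) := by
  obtain ⟨E, hE0, hE⟩ := exists_energy_bound hL hT V W ρ₀ (K := K) hlo hhi
  have H := exists_subseq_tendsto_of_asymptotic_equicontinuity (X := ℕ × Ico (0 : ℝ) T × ℝ)
    (fun k p => mollifyX p.1 (interpNext L T (M k) (N k) (r k)) (p.2.1, p.2.2)) hi
  refine (H ?_ ?_).imp fun σ hσ => ⟨hσ.1, fun m t ht x => hσ.2 (m, ⟨t, ht⟩, x)⟩
  · rintro k ⟨m, ⟨t, ht⟩, x⟩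
    have hg := h.good k
    obtain ⟨n, hn, hmem⟩ := exists_mem_timeCell hT (N k) ht
    simp only
    rw [interpNext, mollifyX_interp hL hT hg.one_le m hn (z := (t, x)) hmem]
    exact abs_mollifyCell_le hL hg.one_le m hhi.le (hg.abs_le hlo (n + 1) (by omega)) x
  · rintro ⟨m, ⟨t, ht⟩, x⟩ ε hε
    obtain ⟨C, hC0, hC⟩ := exists_lipschitz_mollifier m
    obtain ⟨η, hη, hη'⟩ : ∃ η > 0, C * (hi ^ 2 * E) / 2 * η ≤ ε / 3 := by
      refine ⟨ε / 3 / (C * (hi ^ 2 * E) / 2 + 1), by positivity, ?_⟩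
      rw [← mul_div_assoc, div_le_iff₀ (by positivity)]
      nlinarith
    obtain ⟨δ, hδ, hδ'⟩ : ∃ δ > 0, C * (2 * L) / η * δ ≤ ε / 3 := by
      refine ⟨ε / 3 / (C * (2 * L) / η + 1), by positivity, ?_⟩
      rw [← mul_div_assoc, div_le_iff₀ (by positivity)]
      nlinarith
    obtain ⟨κ, hκ, hκ'⟩ : ∃ κ > 0, 2 * L * hi * C * κ ≤ ε / 3 := by
      refine ⟨ε / 3 / (2 * L * hi * C + 1), by positivity, ?_⟩
      rw [← mul_div_assoc, div_le_iff₀ (by positivity)]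
      nlinarith
    obtain ⟨k₀, hk₀⟩ := eventually_atTop.1 (h.stepT_tendsto.eventually (gt_mem_nhds hδ))
    refine ⟨{m} ×ˢ (Metric.ball (⟨t, ht⟩ : Ico (0 : ℝ) T) δ ×ˢ Metric.ball x κ), ?_, k₀, ?_⟩
    · exact prod_mem_nhds (by simp) (prod_mem_nhds (Metric.ball_mem_nhds _ hδ)
        (Metric.ball_mem_nhds _ hκ))
    · rintro k hk ⟨m', ⟨t', ht'⟩, x'⟩ ⟨hm', htt, hxx⟩
      simp only [mem_singleton_iff] at hm'
      subst hm'
      have hg := h.good k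
      have htt' : |t - t'| < δ := by
        have : dist t' t < δ := htt
        rwa [dist_comm, Real.dist_eq] at this
      have hxx' : |x - x'| < κ := by
        have : dist x' x < κ := hxx
        rwa [dist_comm, Real.dist_eq] at this
      refine (hg.abs_mollifyX_sub_le hL hT hlo (hE _ _ _ hg).2.2 hC0 hC hη ht ht' x x').trans ?_
      have hτ := hk₀ k hk
      calc C * ((η * hi ^ 2 * E + 2 * L * (|t - t'| + stepT T (N k)) / η) / 2)
          + 2 * L * hi * C * |x - x'|
          ≤ C * ((η * hi ^ 2 * E + 2 * L * (δ + δ) / η) / 2) + 2 * L * hi * C * κ := by gcongr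
        _ = C * (hi ^ 2 * E) / 2 * η + C * (2 * L) / η * δ + 2 * L * hi * C * κ := by
            field_simp; ring
        _ ≤ ε := by linarith

lemma measurable_mollifyX (m : ℕ) {f : ℝ × ℝ → ℝ} (hf : Measurable f) :
    Measurable (mollifyX m f) := by
  have h1 : Measurable fun p : (ℝ × ℝ) × ℝ => f (p.1.1, p.2) * mollifier m (p.1.2 - p.2) :=
    (hf.comp ((measurable_fst.comp measurable_fst).prodMk measurable_snd)).mul
      ((continuous_mollifier m).measurable.comp
        ((measurable_snd.comp measurable_fst).sub measurable_snd))
  exact (h1.stronglyMeasurable.integral_prod_right' (ν := volume)).measurable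

lemma GoodSol.sum_cellVariation_le {L T : ℝ} (hL : 0 < L) (hT : 0 < T) {V W ρ₀ : ℝ → ℝ}
    {lo hi K E : ℝ} (hlo : 0 < lo) {M N : ℕ} {r : ℕ → ℕ → ℝ}
    (h : GoodSol L T V W ρ₀ lo hi K M N r)
    (hE : ∑ n ∈ Finset.range (N + 1), ∑ i ∈ Finset.Ico 1 (2 * M),
      (r (n + 1) (i + 1) - r (n + 1) i) ^ 2 / stepX L M * stepT T N ≤ E) :
    ∑ n ∈ Finset.range (N + 1), cellVariation M (r (n + 1)) * stepT T N ≤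
      (E + 2 * L * T) / 2 + 2 * hi * T := by
  have hM := h.one_le
  have hX := stepX_pos hL hM
  have hτ := stepT_pos hT N
  have h1 : ∀ n ∈ Finset.range (N + 1), cellVariation M (r (n + 1)) * stepT T N ≤
      (∑ i ∈ Finset.Ico 1 (2 * M),
        (r (n + 1) (i + 1) - r (n + 1) i) ^ 2 / stepX L M * stepT T N) / 2
      + (L + 2 * hi) * stepT T N := by
    intro n hn
    rw [Finset.mem_range] at hn
    have a1 := h.abs_le hlo (n + 1) (by omega) 1 (Finset.mem_Icc.2 ⟨le_rfl, by omega⟩)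
    have a2 := h.abs_le hlo (n + 1) (by omega) (2 * M) (Finset.mem_Icc.2 ⟨by omega, le_rfl⟩)
    have a3 : ∑ i ∈ Finset.Ico 1 (2 * M), |r (n + 1) (i + 1) - r (n + 1) i| ≤
        ∑ i ∈ Finset.Ico 1 (2 * M),
          ((r (n + 1) (i + 1) - r (n + 1) i) ^ 2 / stepX L M / 2 + stepX L M / 2) := by
      refine Finset.sum_le_sum fun i _ => ?_
      set d := r (n + 1) (i + 1) - r (n + 1) i
      have : 0 ≤ (|d| - stepX L M) ^ 2 / (2 * stepX L M) := by positivity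
      have e : (|d| - stepX L M) ^ 2 / (2 * stepX L M) =
        |d| ^ 2 / stepX L M / 2 + stepX L M / 2 - |d| := by field_simp; ring
      rw [e, sq_abs] at this
      linarith
    rw [Finset.sum_add_distrib, Finset.sum_const, nsmul_eq_mul, Nat.card_Ico,
      ← Finset.sum_div] at a3
    have h7 : ((2 * M - 1 : ℕ) : ℝ) ≤ ((2 * M : ℕ) : ℝ) := by exact_mod_cast Nat.sub_le _ _
    have h8 : ((2 * M - 1 : ℕ) : ℝ) * (stepX L M / 2) ≤ L := by
      calc _ ≤ ((2 * M : ℕ) : ℝ) * (stepX L M / 2) :=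
            mul_le_mul_of_nonneg_right h7 (by positivity)
        _ = L := by linarith [stepX_mul hM (L := L)]
    rw [← Finset.sum_mul]
    calc cellVariation M (r (n + 1)) * stepT T N ≤
        ((∑ i ∈ Finset.Ico 1 (2 * M), (r (n + 1) (i + 1) - r (n + 1) i) ^ 2 / stepX L M) / 2
          + L + hi + hi) * stepT T N := by
          refine mul_le_mul_of_nonneg_right ?_ hτ.le
          unfold cellVariation
          linarith
      _ = _ := by ring
  refine (Finset.sum_le_sum h1).trans ?_
  rw [Finset.sum_add_distrib, ← Finset.sum_div, Finset.sum_const, Finset.card_range, nsmul_eq_mul]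
  have := stepT_mul T N
  push_cast
  have e : ((N : ℝ) + 1) * ((L + 2 * hi) * stepT T N) = (L + 2 * hi) * T := by
    linear_combination (L + 2 * hi) * this
  rw [e]
  linarith

lemma GoodSol.lintegral_sub_mollifyX_le {L T : ℝ} (hL : 0 < L) (hT : 0 < T) {V W ρ₀ : ℝ → ℝ}
    {lo hi K E : ℝ} (hlo : 0 < lo) {M N : ℕ} {r : ℕ → ℕ → ℝ}
    (h : GoodSol L T V W ρ₀ lo hi K M N r)
    (hE : ∑ n ∈ Finset.range (N + 1), ∑ i ∈ Finset.Ico 1 (2 * M),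
      (r (n + 1) (i + 1) - r (n + 1) i) ^ 2 / stepX L M * stepT T N ≤ E) (m : ℕ) :
    ∫⁻ z in halfCyl L T, ‖interpNext L T M N r z - mollifyX m (interpNext L T M N r) z‖ₑ ≤
      ENNReal.ofReal (1 / ((m : ℝ) + 1) * ((E + 2 * L * T) / 2 + 2 * hi * T)) := by
  have hM := h.one_le
  have hτ := stepT_pos hT N
  have hmeas : Measurable fun z : ℝ × ℝ =>
      ‖interpNext L T M N r z - mollifyX m (interpNext L T M N r) z‖ₑ :=
    ((measurable_interp ..).sub (measurable_mollifyX m (measurable_interp ..))).enorm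
  have hvar : ∀ n, 0 ≤ 1 / ((m : ℝ) + 1) * cellVariation M (r (n + 1)) := fun n => by
    unfold cellVariation; positivity
  have h1 : ∀ t ∈ Ico 0 T, ∫⁻ x in Ico (-L) L,
      ‖interpNext L T M N r (t, x) - mollifyX m (interpNext L T M N r) (t, x)‖ₑ ≤
      ∑ n ∈ Finset.range (N + 1), (timeCell T N n).indicator
        (fun _ => ENNReal.ofReal (1 / ((m : ℝ) + 1) * cellVariation M (r (n + 1)))) t := by
    intro t ht
    obtain ⟨n, hn, hmem⟩ := exists_mem_timeCell hT N ht
    refine (setLIntegral_le_lintegral _ _).trans ?_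
    simp_rw [interpNext, mollifyX_interp hL hT hM m hn (z := (t, _)) hmem,
      interp_eq_cellFn hL hT hM hn hmem]
    refine (lintegral_sub_mollifyCell_le hL hM m (r (n + 1))).trans ?_
    refine le_trans (le_of_eq ?_) (Finset.single_le_sum (fun _ _ => zero_le)
      (Finset.mem_range.2 (Nat.lt_succ_of_le hn)))
    rw [indicator_of_mem hmem]
  rw [halfCyl, Measure.volume_eq_prod, ← Measure.prod_restrict, lintegral_prod _ hmeas.aemeasurable]
  refine (setLIntegral_mono' measurableSet_Ico h1).trans ?_
  refine (setLIntegral_le_lintegral _ _).trans ?_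
  rw [lintegral_finsetSum _ fun n _ => measurable_const.indicator (measurableSet_timeCell T N n)]
  have hvol : ∀ n, volume (timeCell T N n) = ENNReal.ofReal (stepT T N) := fun n => by
    rw [timeCell, Real.volume_Ico]; congr 1; ring
  simp_rw [lintegral_indicator_const (measurableSet_timeCell T N _), hvol]
  simp_rw [← ENNReal.ofReal_mul (hvar _)]
  rw [← ENNReal.ofReal_sum_of_nonneg fun n _ => mul_nonneg (hvar n) hτ.le]
  refine ENNReal.ofReal_le_ofReal ?_
  have e : ∀ n, 1 / ((m : ℝ) + 1) * cellVariation M (r (n + 1)) * stepT T N =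
      1 / ((m : ℝ) + 1) * (cellVariation M (r (n + 1)) * stepT T N) := fun n => mul_assoc _ _ _
  simp_rw [e]
  rw [← Finset.mul_sum]
  exact mul_le_mul_of_nonneg_left (h.sum_cellVariation_le hL hT hlo hE) (by positivity)

/-- A sequence that is uniformly close in `L¹` to sequences converging almost everywhere has a
subsequence converging almost everywhere. -/
lemma exists_subseq_ae_tendsto_of_approx {α : Type*} [MeasurableSpace α] (μ : Measure α)
    [IsFiniteMeasure μ] {f : ℕ → α → ℝ} {A : ℕ → ℕ → α → ℝ} {B C : ℝ}
    (hf : ∀ k, Measurable (f k)) (hfB : ∀ k z, |f k z| ≤ B)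
    (hA : ∀ m k, Measurable (A m k)) (hAB : ∀ m k, ∀ᵐ z ∂μ, |A m k z| ≤ B)
    (hlim : ∀ m, ∀ᵐ z ∂μ, ∃ l, Tendsto (fun k => A m k z) atTop (𝓝 l))
    (hclose : ∀ m k, ∫⁻ z, ‖f k z - A m k z‖ₑ ∂μ ≤ ENNReal.ofReal (1 / ((m : ℝ) + 1) * C)) :
    ∃ (σ : ℕ → ℕ) (g : α → ℝ), StrictMono σ ∧ Measurable g ∧
      ∀ᵐ z ∂μ, Tendsto (fun k => f (σ k) z) atTop (𝓝 (g z)) := by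
  have hmem : ∀ k, MemLp (f k) 1 μ := fun k =>
    MemLp.of_bound (hf k).aestronglyMeasurable B (Eventually.of_forall (hfB k))
  have hcau : CauchySeq fun k => (hmem k).toLp (f k) := by
    rw [EMetric.cauchySeq_iff]
    intro ε hε
    obtain ⟨m, hm⟩ : ∃ m : ℕ, ENNReal.ofReal (1 / ((m : ℝ) + 1) * C) < ε / 4 := by
      have h1 : Tendsto (fun m : ℕ => ENNReal.ofReal (1 / ((m : ℝ) + 1) * C)) atTop (𝓝 0) := by
        have := (tendsto_one_div_add_atTop_nhds_zero_nat (𝕜 := ℝ)).mul_const C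
        rw [zero_mul] at this
        simpa using ENNReal.tendsto_ofReal this
      exact (h1.eventually (gt_mem_nhds (ENNReal.div_pos hε.ne' (by norm_num)))).exists
    obtain ⟨G, hG, hGl⟩ := measurable_limit_of_tendsto_metrizable_ae
      (fun k => (hA m k).aemeasurable) (hlim m)
    have hd : Tendsto (fun k => ∫⁻ z, ‖A m k z - G z‖ₑ ∂μ) atTop (𝓝 0) := by
      have := tendsto_lintegral_of_dominated_convergence' (μ := μ)
        (F := fun k z => ‖A m k z - G z‖ₑ) (f := fun _ => 0) (fun _ => ENNReal.ofReal (B + B))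
        (fun k => ((hA m k).sub hG).enorm.aemeasurable) (fun k => ?_) ?_ ?_
      · simpa using this
      · have hall : ∀ᵐ z ∂μ, ∀ k, |A m k z| ≤ B := ae_all_iff.2 (hAB m)
        filter_upwards [hGl, hall] with z hz hB
        have hGB : |G z| ≤ B := le_of_tendsto hz.abs (Eventually.of_forall hB)
        rw [Real.enorm_eq_ofReal_abs]
        exact ENNReal.ofReal_le_ofReal ((abs_sub _ _).trans (add_le_add (hB k) hGB))
      · rw [lintegral_const]
        exact (ENNReal.mul_lt_top ENNReal.ofReal_lt_top (measure_lt_top μ univ)).ne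
      · filter_upwards [hGl] with z hz
        have := (hz.sub_const (G z)).enorm
        simpa using this
    obtain ⟨k₀, hk₀⟩ := eventually_atTop.1
      (hd.eventually (gt_mem_nhds (ENNReal.div_pos hε.ne' (by norm_num : (4 : ℝ≥0∞) ≠ ⊤))))
    refine ⟨k₀, fun k hk j hj => ?_⟩
    rw [Lp.edist_toLp_toLp, eLpNorm_one_eq_lintegral_enorm]
    have hm1 : Measurable fun z => ‖f k z - A m k z‖ₑ := ((hf k).sub (hA m k)).enorm
    have hm2 : Measurable fun z => ‖A m k z - G z‖ₑ := ((hA m k).sub hG).enorm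
    have hm3 : Measurable fun z => ‖A m j z - G z‖ₑ := ((hA m j).sub hG).enorm
    calc ∫⁻ z, ‖(f k - f j) z‖ₑ ∂μ
        ≤ ∫⁻ z, (‖f k z - A m k z‖ₑ + (‖A m k z - G z‖ₑ + (‖A m j z - G z‖ₑ
          + ‖f j z - A m j z‖ₑ))) ∂μ := by
          refine lintegral_mono fun z => ?_
          have e : (f k - f j) z = (f k z - A m k z) + ((A m k z - G z)
            + (-(A m j z - G z) + -(f j z - A m j z))) := by
            simp only [Pi.sub_apply]; ring
          rw [e]
          refine (enorm_add_le _ _).trans ?_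
          gcongr
          refine (enorm_add_le _ _).trans ?_
          gcongr
          refine (enorm_add_le _ _).trans ?_
          rw [enorm_neg, enorm_neg]
      _ = ∫⁻ z, ‖f k z - A m k z‖ₑ ∂μ + (∫⁻ z, ‖A m k z - G z‖ₑ ∂μ
          + (∫⁻ z, ‖A m j z - G z‖ₑ ∂μ + ∫⁻ z, ‖f j z - A m j z‖ₑ ∂μ)) := by
          rw [lintegral_add_left hm1, lintegral_add_left hm2, lintegral_add_left hm3]
      _ < ε / 4 + (ε / 4 + (ε / 4 + ε / 4)) :=
          ENNReal.add_lt_add ((hclose m k).trans_lt hm) (ENNReal.add_lt_add (hk₀ k hk)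
            (ENNReal.add_lt_add (hk₀ j hj) ((hclose m j).trans_lt hm)))
      _ = ε := by
          rw [← add_assoc]
          have : ε / 4 + ε / 4 = ε / 2 := by
            rw [← ENNReal.add_halves (ε / 2), ENNReal.div_eq_inv_mul, ENNReal.div_eq_inv_mul,
              ENNReal.div_eq_inv_mul, ← mul_assoc, ← ENNReal.mul_inv (by simp) (by simp)]
            norm_num
          rw [this, ENNReal.add_halves]
  obtain ⟨G, hG⟩ := cauchySeq_tendsto_of_complete hcau
  obtain ⟨σ, hσ, hl⟩ := (tendstoInMeasure_of_tendsto_Lp hG).exists_seq_tendsto_ae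
  refine ⟨σ, _, hσ, (Lp.stronglyMeasurable G).measurable, ?_⟩
  have hall : ∀ᵐ z ∂μ, ∀ k, (hmem k).toLp (f k) z = f k z :=
    ae_all_iff.2 fun k => (hmem k).coeFn_toLp
  filter_upwards [hl, hall] with z hz hz'
  simpa only [hz'] using hz

lemma exists_subseq_ae_tendsto_zero {α : Type*} [MeasurableSpace α] (μ : Measure α)
    {f : ℕ → α → ℝ} (hf : ∀ k, Measurable (f k)) (hintg : ∀ k, Integrable (fun z => f k z ^ 2) μ)
    {c : ℕ → ℝ} (hc : Tendsto c atTop (𝓝 0)) (h : ∀ k, ∫ z, f k z ^ 2 ∂μ ≤ c k) :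
    ∃ σ : ℕ → ℕ, StrictMono σ ∧ ∀ᵐ z ∂μ, Tendsto (fun k => f (σ k) z) atTop (𝓝 0) := by
  have h1 : Tendsto (fun k => eLpNorm ((fun z => f k z ^ 2) - 0) 1 μ) atTop (𝓝 0) := by
    refine tendsto_of_tendsto_of_tendsto_of_le_of_le tendsto_const_nhds
      (by simpa using ENNReal.tendsto_ofReal hc) (fun _ => zero_le) fun k => ?_
    rw [sub_zero, eLpNorm_one_eq_lintegral_enorm, ← ofReal_integral_norm_eq_lintegral_enorm (hintg k)]
    refine ENNReal.ofReal_le_ofReal (le_trans (le_of_eq ?_) (h k))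
    exact integral_congr_ae (Eventually.of_forall fun z => Real.norm_of_nonneg (sq_nonneg _))
  obtain ⟨σ, hσ, hl⟩ := (tendstoInMeasure_of_tendsto_eLpNorm one_ne_zero
    (fun k => ((hf k).pow_const 2).aestronglyMeasurable) aestronglyMeasurable_zero
    h1).exists_seq_tendsto_ae
  refine ⟨σ, hσ, ?_⟩
  filter_upwards [hl] with z hz
  have := hz.sqrt
  simp only [Real.sqrt_sq_eq_abs, Pi.zero_apply, Real.sqrt_zero] at this
  exact (tendsto_zero_iff_abs_tendsto_zero _).2 this

lemma interp_comp {L T : ℝ} (hL : 0 < L) (hT : 0 < T) {M N : ℕ} (hM : 1 ≤ M) (a : ℕ → ℕ → ℝ)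
    {f : ℝ → ℝ} (hf : f 0 = 0) (z : ℝ × ℝ) :
    interp L T M N (fun n i => f (a n i)) z = f (interp L T M N a z) := by
  by_cases hz : z ∈ halfCyl L T
  · obtain ⟨n, i, -, -, -, -, e⟩ := exists_index hL hT N hM hz
    rw [e, e]
  · rw [interp_of_notMem hL hT hM hz, interp_of_notMem hL hT hM hz, hf]

lemma interp_sub {L T : ℝ} (hL : 0 < L) (hT : 0 < T) {M N : ℕ} (hM : 1 ≤ M) (a b : ℕ → ℕ → ℝ)
    (z : ℝ × ℝ) : interp L T M N (fun n i => a n i - b n i) z =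
      interp L T M N a z - interp L T M N b z := by
  by_cases hz : z ∈ halfCyl L T
  · obtain ⟨n, i, -, -, -, -, e⟩ := exists_index hL hT N hM hz
    rw [e, e, e]
  · simp only [interp_of_notMem hL hT hM hz, sub_zero]

lemma exists_abs_interp_le {L T : ℝ} (hL : 0 < L) (hT : 0 < T) {M : ℕ} (N : ℕ) (hM : 1 ≤ M)
    (a : ℕ → ℕ → ℝ) : ∃ C, ∀ z, ‖interp L T M N a z‖ ≤ C := by
  refine ⟨∑ n ∈ Finset.range (N + 1), ∑ i ∈ Finset.Icc 1 (2 * M), |a n i|,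
    abs_interp_le hL hT hM (by positivity) fun n hn i hi => ?_⟩
  refine (Finset.single_le_sum (f := fun i => |a n i|) (fun _ _ => abs_nonneg _) hi).trans ?_
  exact Finset.single_le_sum (f := fun n => ∑ i ∈ Finset.Icc 1 (2 * M), |a n i|)
    (fun _ _ => by positivity) (Finset.mem_range.2 (Nat.lt_succ_of_le hn))

lemma memLp_interp {L T : ℝ} (hL : 0 < L) (hT : 0 < T) {M : ℕ} (N : ℕ) (hM : 1 ≤ M)
    (a : ℕ → ℕ → ℝ) (p : ℝ≥0∞) : MemLp (interp L T M N a) p (volume.restrict (halfCyl L T)) := by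
  obtain ⟨C, hC⟩ := exists_abs_interp_le hL hT N hM a
  exact MemLp.of_bound (measurable_interp ..).aestronglyMeasurable C (Eventually.of_forall hC)

lemma integral_interp_sq {L T : ℝ} (hL : 0 < L) (hT : 0 < T) {M N : ℕ} (hM : 1 ≤ M)
    (a : ℕ → ℕ → ℝ) :
    ∫ z in halfCyl L T, interp L T M N a z ^ 2 =
      ∑ n ∈ Finset.range (N + 1), ∑ i ∈ Finset.Icc 1 (2 * M),
        a n i ^ 2 * (stepT T N * stepX L M) := by
  rw [← integral_interp hL hT hM]
  simp_rw [interp_comp hL hT hM a (f := fun s => s ^ 2) (by simp)]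

/-- An array on the interior faces, extended by zero to the last cell. -/
def faceExt (M : ℕ) (a : ℕ → ℕ → ℝ) (n i : ℕ) : ℝ := if i < 2 * M then a n i else 0

lemma sum_faceExt (M : ℕ) (hM : 1 ≤ M) (g : ℕ → ℝ) :
    ∑ i ∈ Finset.Icc 1 (2 * M), (if i < 2 * M then g i else 0) =
      ∑ i ∈ Finset.Ico 1 (2 * M), g i := by
  rw [show Finset.Icc 1 (2 * M) = Finset.Ico 1 (2 * M + 1) from rfl,
    Finset.sum_Ico_succ_top (by omega), if_neg (lt_irrefl _), add_zero]
  exact Finset.sum_congr rfl fun i hi => if_pos (Finset.mem_Ico.1 hi).2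

lemma integral_interp_faceExt_sq {L T : ℝ} (hL : 0 < L) (hT : 0 < T) {M N : ℕ} (hM : 1 ≤ M)
    (a : ℕ → ℕ → ℝ) :
    ∫ z in halfCyl L T, interp L T M N (faceExt M a) z ^ 2 =
      ∑ n ∈ Finset.range (N + 1), ∑ i ∈ Finset.Ico 1 (2 * M),
        a n i ^ 2 * (stepT T N * stepX L M) := by
  rw [integral_interp_sq hL hT hM]
  refine Finset.sum_congr rfl fun n _ => ?_
  rw [← sum_faceExt M hM]
  refine Finset.sum_congr rfl fun i _ => ?_
  unfold faceExt
  split_ifs <;> simp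

/-- The jumps `ρ_{i+1}^{n+1} - ρ_i^{n+1}`. -/
def jump (r : ℕ → ℕ → ℝ) (n i : ℕ) : ℝ := r (n + 1) (i + 1) - r (n + 1) i

/-- The limit `ρ` of the interpolations, together with everything that converges almost
everywhere. -/
structure GoodLimit (L T lo hi : ℝ) (M N : ℕ → ℕ) (r : ℕ → ℕ → ℕ → ℝ) (ρ : ℝ × ℝ → ℝ) : Prop where
  meas : Measurable ρ
  mem : ∀ z, lo ≤ ρ z ∧ ρ z ≤ hi
  next : ∀ᵐ z ∂volume.restrict (halfCyl L T),
    Tendsto (fun k => interpNext L T (M k) (N k) (r k) z) atTop (𝓝 (ρ z))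
  prev : ∀ᵐ z ∂volume.restrict (halfCyl L T),
    Tendsto (fun k => interp L T (M k) (N k) (r k) z) atTop (𝓝 (ρ z))
  jump : ∀ᵐ z ∂volume.restrict (halfCyl L T),
    Tendsto (fun k => interp L T (M k) (N k) (faceExt (M k) (jump (r k))) z) atTop (𝓝 0)

theorem GoodSeq.exists_limit {L T : ℝ} (hL : 0 < L) (hT : 0 < T) {V W ρ₀ : ℝ → ℝ}
    {lo hi K : ℝ} (hlo : 0 < lo) (hhi : 0 < hi) {M N : ℕ → ℕ} {r : ℕ → ℕ → ℕ → ℝ}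
    (h : GoodSeq L T V W ρ₀ lo hi K M N r) :
    ∃ (σ : ℕ → ℕ) (ρ : ℝ × ℝ → ℝ), StrictMono σ ∧
      GoodLimit L T lo hi (fun k => M (σ k)) (fun k => N (σ k)) (fun k => r (σ k)) ρ := by
  obtain ⟨E, hE0, hE⟩ := exists_energy_bound hL hT V W ρ₀ (K := K) hlo hhi
  have hlohi : lo ≤ hi := by
    have := (h.good 0).mem 0 (by omega) 1 (Finset.mem_Icc.2 ⟨le_rfl, by
      have := (h.good 0).one_le; omega⟩)
    linarith
  obtain ⟨σ₁, hσ₁, hm⟩ := h.exists_subseq_mollifyX hL hT hlo hhi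
  have h₁ := h.comp hσ₁
  obtain ⟨σ₂, g, hσ₂, hg, hgl⟩ := exists_subseq_ae_tendsto_of_approx
    (volume.restrict (halfCyl L T))
    (f := fun k => interpNext L T (M (σ₁ k)) (N (σ₁ k)) (r (σ₁ k)))
    (A := fun m k => mollifyX m (interpNext L T (M (σ₁ k)) (N (σ₁ k)) (r (σ₁ k)))) (B := hi)
    (C := (E + 2 * L * T) / 2 + 2 * hi * T)
    (fun k => measurable_interp ..)
    (fun k z => abs_interp_le hL hT (h₁.good k).one_le hhi.le
      (fun n hn i hi' => (h₁.good k).abs_le hlo (n + 1) (by omega) i hi') z)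
    (fun m k => measurable_mollifyX m (measurable_interp ..))
    (fun m k => by
      filter_upwards [ae_restrict_mem (measurableSet_halfCyl L T)] with z hz
      obtain ⟨n, hn, hmem⟩ := exists_mem_timeCell hT (N (σ₁ k)) hz.1
      rw [interpNext, mollifyX_interp hL hT (h₁.good k).one_le m hn hmem]
      exact abs_mollifyCell_le hL (h₁.good k).one_le m hhi.le
        ((h₁.good k).abs_le hlo (n + 1) (by omega)) _)
    (fun m => by
      filter_upwards [ae_restrict_mem (measurableSet_halfCyl L T)] with z hz
      exact hm m z.1 hz.1 z.2)
    (fun m k => (h₁.good k).lintegral_sub_mollifyX_le hL hT hlo (hE _ _ _ (h₁.good k)).2.1 m)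
  have h₂ := h₁.comp hσ₂
  obtain ⟨σ₃, hσ₃, hd⟩ := exists_subseq_ae_tendsto_zero (volume.restrict (halfCyl L T))
    (f := fun k => interp L T (M (σ₁ (σ₂ k))) (N (σ₁ (σ₂ k)))
      fun n i => r (σ₁ (σ₂ k)) (n + 1) i - r (σ₁ (σ₂ k)) n i)
    (c := fun k => E * stepT T (N (σ₁ (σ₂ k))))
    (fun k => measurable_interp ..)
    (fun k => (memLp_interp hL hT _ (h₂.good k).one_le _ 2).integrable_sq)
    (by simpa using h₂.stepT_tendsto.const_mul E)
    (fun k => by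
      rw [integral_interp_sq hL hT (h₂.good k).one_le]
      refine le_trans (le_of_eq ?_) (mul_le_mul_of_nonneg_right (hE _ _ _ (h₂.good k)).1
        (stepT_pos hT _).le)
      simp_rw [Finset.sum_mul]
      refine Finset.sum_congr rfl fun n _ => Finset.sum_congr rfl fun i _ => ?_
      ring)
  have h₃ := h₂.comp hσ₃
  obtain ⟨σ₄, hσ₄, hj⟩ := exists_subseq_ae_tendsto_zero (volume.restrict (halfCyl L T))
    (f := fun k => interp L T (M (σ₁ (σ₂ (σ₃ k)))) (N (σ₁ (σ₂ (σ₃ k))))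
      (faceExt (M (σ₁ (σ₂ (σ₃ k)))) (AggDiff.jump (r (σ₁ (σ₂ (σ₃ k)))))))
    (c := fun k => E * stepX L (M (σ₁ (σ₂ (σ₃ k)))) ^ 2)
    (fun k => measurable_interp ..)
    (fun k => (memLp_interp hL hT _ (h₃.good k).one_le _ 2).integrable_sq)
    (by simpa using (h₃.stepX_tendsto.pow 2).const_mul E)
    (fun k => by
      have hX := stepX_pos hL (h₃.good k).one_le
      rw [integral_interp_faceExt_sq hL hT (h₃.good k).one_le]
      refine le_trans (le_of_eq ?_) (mul_le_mul_of_nonneg_right (hE _ _ _ (h₃.good k)).2.1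
        (sq_nonneg _))
      simp_rw [Finset.sum_mul]
      refine Finset.sum_congr rfl fun n _ => Finset.sum_congr rfl fun i _ => ?_
      unfold AggDiff.jump
      field_simp)
  refine ⟨fun k => σ₁ (σ₂ (σ₃ (σ₄ k))), fun z => max lo (min hi (g z)),
    hσ₁.comp (hσ₂.comp (hσ₃.comp hσ₄)), ?_⟩
  have hgo := h₃.comp hσ₄
  have hnext : ∀ᵐ z ∂volume.restrict (halfCyl L T), Tendsto (fun k =>
      interpNext L T (M (σ₁ (σ₂ (σ₃ (σ₄ k))))) (N (σ₁ (σ₂ (σ₃ (σ₄ k)))))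
        (r (σ₁ (σ₂ (σ₃ (σ₄ k))))) z) atTop (𝓝 (max lo (min hi (g z)))) := by
    filter_upwards [hgl, ae_restrict_mem (measurableSet_halfCyl L T)] with z hz hzm
    have h1 := hz.comp (hσ₃.comp hσ₄).tendsto_atTop
    have h2 : ∀ k, lo ≤ interpNext L T (M (σ₁ (σ₂ (σ₃ (σ₄ k))))) (N (σ₁ (σ₂ (σ₃ (σ₄ k)))))
        (r (σ₁ (σ₂ (σ₃ (σ₄ k))))) z ∧ interpNext L T (M (σ₁ (σ₂ (σ₃ (σ₄ k)))))
        (N (σ₁ (σ₂ (σ₃ (σ₄ k))))) (r (σ₁ (σ₂ (σ₃ (σ₄ k))))) z ≤ hi := by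
      intro k
      obtain ⟨n, i, hn, hi', -, -, e⟩ := exists_index hL hT (N (σ₁ (σ₂ (σ₃ (σ₄ k)))))
        (hgo.good k).one_le hzm
      rw [interpNext, e]
      exact (hgo.good k).mem (n + 1) (by omega) i hi'
    have h3 : lo ≤ g z := ge_of_tendsto' h1 fun k => (h2 k).1
    have h4 : g z ≤ hi := le_of_tendsto' h1 fun k => (h2 k).2
    rw [min_eq_right h4, max_eq_right h3]
    exact h1
  refine ⟨measurable_const.max (measurable_const.min hg), fun z => ⟨le_max_left _ _,
    max_le hlohi (min_le_left _ _)⟩, hnext, ?_, hj⟩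
  filter_upwards [hnext, hd] with z hz hdz
  have := hz.sub (hdz.comp hσ₄.tendsto_atTop)
  rw [sub_zero] at this
  refine this.congr fun k => ?_
  simp only [Function.comp]
  rw [interp_sub hL hT (hgo.good k).one_le, interpNext]
  ring

lemma tendsto_eLpNorm_of_ae_of_bounded {α : Type*} [MeasurableSpace α] {μ : Measure α}
    [IsFiniteMeasure μ] {f : ℕ → α → ℝ} {g : α → ℝ} {B : ℝ} (hf : ∀ k, Measurable (f k))
    (hg : Measurable g) (hfB : ∀ k z, |f k z| ≤ B) (hgB : ∀ z, |g z| ≤ B)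
    (h : ∀ᵐ z ∂μ, Tendsto (fun k => f k z) atTop (𝓝 (g z))) {p : ℝ≥0∞} (hp : 1 ≤ p)
    (hp' : p < ⊤) : Tendsto (fun k => eLpNorm (fun z => f k z - g z) p μ) atTop (𝓝 0) := by
  have hp0 : p ≠ 0 := (zero_lt_one.trans_le hp).ne'
  have hpr : 0 < p.toReal := ENNReal.toReal_pos hp0 hp'.ne
  have h1 : Tendsto (fun k => ∫⁻ z, ‖f k z - g z‖ₑ ^ p.toReal ∂μ) atTop (𝓝 0) := by
    have := tendsto_lintegral_of_dominated_convergence' (μ := μ)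
      (F := fun k z => ‖f k z - g z‖ₑ ^ p.toReal) (f := fun _ => 0)
      (fun _ => ENNReal.ofReal (B + B) ^ p.toReal)
      (fun k => (((hf k).sub hg).enorm.pow_const _).aemeasurable) (fun k => ?_) ?_ ?_
    · simpa using this
    · refine Eventually.of_forall fun z => ?_
      simp only
      rw [Real.enorm_eq_ofReal_abs]
      gcongr
      exact (abs_sub _ _).trans (add_le_add (hfB k z) (hgB z))
    · rw [lintegral_const]
      exact (ENNReal.mul_lt_top (ENNReal.rpow_lt_top_of_nonneg hpr.le ENNReal.ofReal_ne_top)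
        (measure_lt_top μ univ)).ne
    · filter_upwards [h] with z hz
      have := ((hz.sub_const (g z)).enorm).ennrpow_const p.toReal
      simpa [hpr] using this
  simp_rw [eLpNorm_eq_lintegral_rpow_enorm_toReal hp0 hp'.ne]
  have := h1.ennrpow_const (1 / p.toReal)
  rwa [ENNReal.zero_rpow_of_pos (by positivity)] at this

/-! ### Weak compactness in `L²` -/

section WeakLimit

variable {α : Type*} [MeasurableSpace α] {μ : Measure α}

lemma inner_toLp {f g : α → ℝ} (hf : MemLp f 2 μ) (hg : MemLp g 2 μ) :
    inner ℝ (hf.toLp f) (hg.toLp g) = ∫ z, f z * g z ∂μ := by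
  rw [L2.inner_def]
  refine integral_congr_ae ?_
  filter_upwards [hf.coeFn_toLp, hg.coeFn_toLp] with z h1 h2
  rw [h1, h2]
  simp [mul_comm]

lemma norm_toLp_sq {f : α → ℝ} (hf : MemLp f 2 μ) : ‖hf.toLp f‖ ^ 2 = ∫ z, f z ^ 2 ∂μ := by
  rw [← real_inner_self_eq_norm_sq, inner_toLp]
  simp_rw [sq]

lemma abs_integral_mul_le {f g : α → ℝ} (hf : MemLp f 2 μ) (hg : MemLp g 2 μ) :
    |∫ z, f z * g z ∂μ| ≤ √(∫ z, f z ^ 2 ∂μ) * √(∫ z, g z ^ 2 ∂μ) := by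
  rw [← inner_toLp hf hg, ← norm_toLp_sq hf, ← norm_toLp_sq hg, Real.sqrt_sq (norm_nonneg _),
    Real.sqrt_sq (norm_nonneg _)]
  exact abs_real_inner_le_norm _ _

/-- Bounded sequences in `L²` have weak limits along a finer filter. -/
theorem exists_weak_limit {w : ℕ → α → ℝ} (hw : ∀ k, MemLp (w k) 2 μ) {E : ℝ}
    (hE : ∀ k, ∫ z, w k z ^ 2 ∂μ ≤ E) :
    ∃ l : Filter ℕ, l.NeBot ∧ l ≤ atTop ∧ ∃ g : α → ℝ, MemLp g 2 μ ∧
      ∀ f, MemLp f 2 μ →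
        Tendsto (fun k => ∫ z, w k z * f z ∂μ) l (𝓝 (∫ z, g z * f z ∂μ)) := by
  let D : ℕ → WeakDual ℝ (Lp ℝ 2 μ) := fun k =>
    StrongDual.toWeakDual (InnerProductSpace.toDual ℝ (Lp ℝ 2 μ) ((hw k).toLp (w k)))
  have hcpt := WeakDual.isCompact_closedBall (𝕜 := ℝ) (0 : StrongDual ℝ (Lp ℝ 2 μ)) (√E)
  have hD : ∀ k, D k ∈ WeakDual.toStrongDual ⁻¹' Metric.closedBall
      (0 : StrongDual ℝ (Lp ℝ 2 μ)) (√E) := by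
    intro k
    rw [mem_preimage, mem_closedBall_zero_iff]
    have e : WeakDual.toStrongDual (D k) =
      InnerProductSpace.toDual ℝ (Lp ℝ 2 μ) ((hw k).toLp (w k)) := rfl
    rw [e, LinearIsometryEquiv.norm_map]
    refine Real.le_sqrt_of_sq_le ?_
    rw [norm_toLp_sq]
    exact hE k
  obtain ⟨x, -, hx⟩ := isCompact_iff_ultrafilter_le_nhds'.1 hcpt
    ((Ultrafilter.of (atTop : Filter ℕ)).map D)
    (by rw [Ultrafilter.mem_map]; exact Eventually.of_forall hD)
  let G : Lp ℝ 2 μ := (InnerProductSpace.toDual ℝ (Lp ℝ 2 μ)).symm (WeakDual.toStrongDual x)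
  refine ⟨Ultrafilter.of (atTop : Filter ℕ), inferInstance, Ultrafilter.of_le _, G, Lp.memLp G,
    fun f hf => ?_⟩
  have h1 : Tendsto (fun k => D k (hf.toLp f)) (Ultrafilter.of (atTop : Filter ℕ))
      (𝓝 (x (hf.toLp f))) :=
    ((WeakDual.eval_continuous (hf.toLp f)).tendsto x).comp (show Tendsto D _ _ from hx)
  have e1 : ∀ k, D k (hf.toLp f) = ∫ z, w k z * f z ∂μ := fun k => inner_toLp (hw k) hf
  have e2 : x (hf.toLp f) = ∫ z, G z * f z ∂μ := by
    have h2 : inner ℝ G (hf.toLp f) = x (hf.toLp f) := by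
      have := InnerProductSpace.toDual_apply_apply (𝕜 := ℝ) (x := G) (y := hf.toLp f)
      rw [← this, LinearIsometryEquiv.apply_symm_apply]
      rfl
    rw [← h2, ← inner_toLp (Lp.memLp G) hf, Lp.toLp_coeFn]
  simp_rw [e1] at h1
  rwa [e2] at h1

lemma tendsto_integral_of_ae_of_bounded [IsFiniteMeasure μ] {f : ℕ → α → ℝ} {g : α → ℝ} {B : ℝ}
    (hf : ∀ k, AEStronglyMeasurable (f k) μ) (hfB : ∀ k, ∀ᵐ z ∂μ, |f k z| ≤ B)
    (h : ∀ᵐ z ∂μ, Tendsto (fun k => f k z) atTop (𝓝 (g z))) :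
    Tendsto (fun k => ∫ z, f k z ∂μ) atTop (𝓝 (∫ z, g z ∂μ)) :=
  tendsto_integral_of_dominated_convergence (fun _ => B) hf (integrable_const B) hfB h

lemma ae_abs_le_of_tendsto {f : ℕ → α → ℝ} {g : α → ℝ} {B : ℝ}
    (hfB : ∀ k, ∀ᵐ z ∂μ, |f k z| ≤ B)
    (h : ∀ᵐ z ∂μ, Tendsto (fun k => f k z) atTop (𝓝 (g z))) : ∀ᵐ z ∂μ, |g z| ≤ B := by
  filter_upwards [ae_all_iff.2 hfB, h] with z h1 h2
  exact le_of_tendsto' h2.abs h1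

lemma memLp_of_tendsto_of_bounded [IsFiniteMeasure μ] {f : ℕ → α → ℝ} {g : α → ℝ} {B : ℝ}
    (hf : ∀ k, AEStronglyMeasurable (f k) μ) (hfB : ∀ k, ∀ᵐ z ∂μ, |f k z| ≤ B)
    (h : ∀ᵐ z ∂μ, Tendsto (fun k => f k z) atTop (𝓝 (g z))) (p : ℝ≥0∞) : MemLp g p μ :=
  MemLp.of_bound (aestronglyMeasurable_of_tendsto_ae _ hf h) B (ae_abs_le_of_tendsto hfB h)

/-- The product of a weakly convergent sequence and a bounded, almost everywhere convergent one. -/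
theorem tendsto_integral_weak_mul [IsFiniteMeasure μ] {w : ℕ → α → ℝ}
    (hw : ∀ k, MemLp (w k) 2 μ) {E : ℝ} (hE : ∀ k, ∫ z, w k z ^ 2 ∂μ ≤ E) {l : Filter ℕ}
    (hl : l ≤ atTop) {g : α → ℝ}
    (hg : ∀ f, MemLp f 2 μ → Tendsto (fun k => ∫ z, w k z * f z ∂μ) l (𝓝 (∫ z, g z * f z ∂μ)))
    {f : ℕ → α → ℝ} {f' : α → ℝ} {B : ℝ} (hf : ∀ k, AEStronglyMeasurable (f k) μ)
    (hfB : ∀ k, ∀ᵐ z ∂μ, |f k z| ≤ B)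
    (h : ∀ᵐ z ∂μ, Tendsto (fun k => f k z) atTop (𝓝 (f' z))) :
    Tendsto (fun k => ∫ z, w k z * f k z ∂μ) l (𝓝 (∫ z, g z * f' z ∂μ)) := by
  have hf' : MemLp f' 2 μ := memLp_of_tendsto_of_bounded hf hfB h 2
  have hfm : ∀ k, MemLp (f k) 2 μ := fun k => MemLp.of_bound (hf k) B (hfB k)
  have hd : ∀ k, MemLp (fun z => f k z - f' z) 2 μ := fun k => (hfm k).sub hf'
  have h1 : Tendsto (fun k => ∫ z, (f k z - f' z) ^ 2 ∂μ) atTop (𝓝 0) := by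
    have := tendsto_integral_of_ae_of_bounded (μ := μ) (f := fun k z => (f k z - f' z) ^ 2)
      (g := fun _ => 0) (B := (B + B) ^ 2) (fun k => (hd k).1.pow 2) (fun k => ?_) ?_
    · simpa using this
    · filter_upwards [hfB k, ae_abs_le_of_tendsto hfB h] with z h1 h2
      rw [abs_pow]
      gcongr
      exact (abs_sub _ _).trans (add_le_add h1 h2)
    · filter_upwards [h] with z hz
      have := (hz.sub_const (f' z)).pow 2
      simpa using this
  have h2 : Tendsto (fun k => ∫ z, w k z * (f k z - f' z) ∂μ) atTop (𝓝 0) := by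
    refine squeeze_zero_norm (a := fun k => √E * √(∫ z, (f k z - f' z) ^ 2 ∂μ)) (fun k => ?_) ?_
    · refine (abs_integral_mul_le (hw k) (hd k)).trans ?_
      gcongr
      exact hE k
    · simpa using h1.sqrt.const_mul (√E)
  have h3 := (h2.mono_left hl).add (hg f' hf')
  rw [zero_add] at h3
  refine h3.congr fun k => ?_
  rw [← integral_add (f := fun z => w k z * (f k z - f' z)) (g := fun z => w k z * f' z)
    ((hw k).integrable_mul (hd k)) ((hw k).integrable_mul hf')]
  refine integral_congr_ae (Eventually.of_forall fun z => ?_)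
  simp only
  ring

end WeakLimit

/-! ### The limit of the entropy variable -/

lemma abs_average_cell_sub_le {L : ℝ} (hL : 0 < L) {M : ℕ} (hM : 1 ≤ M) {i : ℕ} {f : ℝ → ℝ}
    {c C : ℝ} (hf : IntegrableOn f (cell L M i)) (h : ∀ x ∈ cell L M i, |f x - c| ≤ C) :
    |(⨍ x in cell L M i, f x) - c| ≤ C := by
  have hX := stepX_pos hL hM
  have e : (⨍ _ in cell L M i, c) = c := by
    have h1 := average_cell hL hM i fun _ => c
    rw [setIntegral_const, volume_real_cell hL hM, smul_eq_mul] at h1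
    exact mul_left_cancel₀ hX.ne' h1
  have h2 := average_cell_sub M hf (g := fun _ => c) (integrableOn_const measure_Ico_lt_top.ne)
  rw [e] at h2
  rw [h2]
  exact abs_average_cell_le hL hM h

lemma abs_sub_le_of_mem_cell {L : ℝ} {M i : ℕ} {x y : ℝ} (hx : x ∈ cell L M i)
    (hy : y ∈ cell L M i) : |x - y| ≤ stepX L M := by
  rw [abs_le]
  constructor <;> nlinarith [hx.1, hx.2, hy.1, hy.2]

lemma integrableOn_comp_sub {L : ℝ} {W : ℝ → ℝ} (hW : ContinuousOn W (Icc (-(2 * L)) (2 * L)))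
    {c : ℝ} (hc : c ∈ Ico (-L) L) : IntegrableOn (fun s => W (c - s)) (Ico (-L) L) := by
  have h1 : ContinuousOn (fun s => W (c - s)) (Icc (-L) L) := by
    refine hW.comp (by fun_prop) fun s hs => ?_
    constructor <;> linarith [hc.1, hc.2, hs.1, hs.2]
  exact (h1.integrableOn_compact isCompact_Icc).mono_set Ico_subset_Icc_self

lemma discConv_eq_integral {L : ℝ} (hL : 0 < L) {M : ℕ} (hM : 1 ≤ M) {W : ℝ → ℝ}
    (hW : ContinuousOn W (Icc (-(2 * L)) (2 * L))) {i : ℕ} (hi : i ∈ Finset.Icc 1 (2 * M))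
    (θ : ℕ → ℝ) :
    discConv L M W θ i = ∫ s in Ico (-L) L, cellFn L M θ s * W (centre L M i - s) := by
  have hintg := integrableOn_comp_sub hW (cell_subset hL hM hi (centre_mem_cell hL hM i))
  rw [setIntegral_eq_integral_of_forall_compl_eq_zero fun s hs => by
    rw [cellFn_of_notMem hL hM hs, zero_mul],
    integral_cellFn_mul θ fun j hj => hintg.mono_set (cell_subset hL hM hj)]
  refine Finset.sum_congr rfl fun j _ => ?_
  rw [← average_cell hL hM, avgW]
  ring

lemma abs_discConv_sub_le {L : ℝ} (hL : 0 < L) {M : ℕ} (hM : 1 ≤ M) {W : ℝ → ℝ}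
    (hW : ContinuousOn W (Icc (-(2 * L)) (2 * L))) {K C : ℝ} (hK : 0 ≤ K) (hC : 0 ≤ C)
    (hWK : ∀ x ∈ Icc (-(2 * L)) (2 * L), ∀ y ∈ Icc (-(2 * L)) (2 * L), |W x - W y| ≤ K * |x - y|)
    {i : ℕ} (hi : i ∈ Finset.Icc 1 (2 * M)) {θ : ℕ → ℝ}
    (hθ : ∀ j ∈ Finset.Icc 1 (2 * M), |θ j| ≤ C) {x : ℝ} (hx : x ∈ cell L M i) :
    |discConv L M W θ i - ∫ s in Ico (-L) L, cellFn L M θ s * W (x - s)| ≤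
      C * K * (2 * L) * stepX L M := by
  have hc := cell_subset hL hM hi (centre_mem_cell hL hM i)
  have hx' := cell_subset hL hM hi hx
  have hintg : ∀ c ∈ Ico (-L) L, IntegrableOn (fun s => cellFn L M θ s * W (c - s)) (Ico (-L) L) :=
    fun c hc => (integrableOn_comp_sub hW hc).bdd_mul (c := C)
      (measurable_cellFn L M θ).aestronglyMeasurable
      (Eventually.of_forall (abs_cellFn_le hL hM hC hθ))
  rw [discConv_eq_integral hL hM hW hi, ← integral_sub (hintg _ hc) (hintg _ hx')]
  have := norm_setIntegral_le_of_norm_le_const (μ := volume) (s := Ico (-L) L)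
    (f := fun s => cellFn L M θ s * W (centre L M i - s) - cellFn L M θ s * W (x - s))
    (C := C * (K * stepX L M)) measure_Ico_lt_top (fun s hs => by
      rw [← mul_sub, norm_mul]
      refine mul_le_mul (abs_cellFn_le hL hM hC hθ s) ?_ (norm_nonneg _) hC
      refine (hWK _ ?_ _ ?_).trans (mul_le_mul_of_nonneg_left ?_ hK)
      · constructor <;> linarith [hc.1, hc.2, hs.1, hs.2]
      · constructor <;> linarith [hx'.1, hx'.2, hs.1, hs.2]
      · rw [sub_sub_sub_cancel_right]
        exact abs_sub_le_of_mem_cell (centre_mem_cell hL hM i) hx)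
  rw [Real.volume_real_Ico_of_le (by linarith)] at this
  refine this.trans (le_of_eq ?_)
  ring

lemma abs_discConv_le {L : ℝ} (hL : 0 < L) {M : ℕ} (hM : 1 ≤ M) {W : ℝ → ℝ}
    (hW : ContinuousOn W (Icc (-(2 * L)) (2 * L))) {K C : ℝ} (hC : 0 ≤ C)
    (hWK : ∀ x ∈ Icc (-(2 * L)) (2 * L), |W x| ≤ K)
    {i : ℕ} (hi : i ∈ Finset.Icc 1 (2 * M)) {θ : ℕ → ℝ}
    (hθ : ∀ j ∈ Finset.Icc 1 (2 * M), |θ j| ≤ C) : |discConv L M W θ i| ≤ C * K * (2 * L) := by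
  have hc := cell_subset hL hM hi (centre_mem_cell hL hM i)
  rw [discConv_eq_integral hL hM hW hi]
  have := norm_setIntegral_le_of_norm_le_const (μ := volume) (s := Ico (-L) L)
    (f := fun s => cellFn L M θ s * W (centre L M i - s))
    (C := C * K) measure_Ico_lt_top (fun s hs => by
      rw [norm_mul]
      refine mul_le_mul (abs_cellFn_le hL hM hC hθ s) (hWK _ ?_) (norm_nonneg _) hC
      constructor <;> linarith [hc.1, hc.2, hs.1, hs.2])
  rw [Real.volume_real_Ico_of_le (by linarith)] at this
  refine this.trans (le_of_eq ?_)
  ring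

lemma ae_ae_of_ae_halfCyl {L T : ℝ} {P : ℝ × ℝ → Prop}
    (h : ∀ᵐ z ∂volume.restrict (halfCyl L T), P z) :
    ∀ᵐ z ∂volume.restrict (halfCyl L T), ∀ᵐ s ∂volume.restrict (Ico (-L) L), P (z.1, s) := by
  rw [halfCyl, Measure.volume_eq_prod, ← Measure.prod_restrict] at h ⊢
  exact Measure.quasiMeasurePreserving_fst.ae (Measure.ae_ae_of_ae_prod h)

section Limits

variable {L T : ℝ} {V W ρ₀ : ℝ → ℝ} {lo hi K : ℝ} {M N : ℕ → ℕ} {r : ℕ → ℕ → ℕ → ℝ}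
  {ρ : ℝ × ℝ → ℝ}

lemma GoodSol.abs_mean_le {M N : ℕ} {r : ℕ → ℕ → ℝ} (hlo : 0 < lo)
    (h : GoodSol L T V W ρ₀ lo hi K M N r) {n : ℕ} (hn : n ≤ N) :
    ∀ j ∈ Finset.Icc 1 (2 * M), |(r n j + r (n + 1) j) / 2| ≤ hi := fun j hj => by
  have h1 := h.mem n (by omega) j hj
  have h2 := h.mem (n + 1) (by omega) j hj
  rw [abs_of_nonneg (by linarith)]
  linarith

lemma tendsto_interp_discConv (hL : 0 < L) (hT : 0 < T)
    (hW : ContDiffOn ℝ 2 W (Icc (-(2 * L)) (2 * L))) (hlo : 0 < lo) (hhi : 0 < hi)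
    (h : GoodSeq L T V W ρ₀ lo hi K M N r) (hρ : GoodLimit L T lo hi M N r ρ) :
    ∀ᵐ z ∂volume.restrict (halfCyl L T), Tendsto (fun k => interp L T (M k) (N k)
      (fun n i => discConv L (M k) W (fun j => (r k n j + r k (n + 1) j) / 2) i) z)
      atTop (𝓝 (conv L W ρ z)) := by
  obtain ⟨C, hC, hC0, hC1, -⟩ := exists_difference_bounds (by linarith : -(2 * L) < 2 * L) hW
  filter_upwards [ae_ae_of_ae_halfCyl (hρ.prev.and hρ.next),
    ae_restrict_mem (measurableSet_halfCyl L T)] with z hz hzm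
  obtain ⟨t, x⟩ := z
  have hx : x ∈ Ico (-L) L := hzm.2
  set J : ℕ → ℝ := fun k => ∫ s in Ico (-L) L, (interp L T (M k) (N k) (r k) (t, s)
    + interpNext L T (M k) (N k) (r k) (t, s)) / 2 * W (x - s) with hJ
  have hJlim : Tendsto J atTop (𝓝 (conv L W ρ (t, x))) := by
    have e : conv L W ρ (t, x) = ∫ s in Ico (-L) L, ρ (t, s) * W (x - s) := by
      rw [conv, dom, integral_Ico_eq_integral_Ioo]
      simp_rw [mul_comm]
    rw [e]
    refine tendsto_integral_of_ae_of_bounded (B := hi * C) (fun k => ?_) (fun k => ?_) ?_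
    · refine AEStronglyMeasurable.mul ?_ (integrableOn_comp_sub hW.continuousOn hx).1
      exact ((((measurable_interp ..).comp measurable_prodMk_left).add
        ((measurable_interp ..).comp measurable_prodMk_left)).div_const 2).aestronglyMeasurable
    · filter_upwards [ae_restrict_mem measurableSet_Ico] with s hs
      rw [abs_mul]
      have hM := (h.good k).one_le
      have b1 := abs_interp_le hL hT hM hhi.le (fun n hn i hi' =>
        (h.good k).abs_le hlo n (Nat.le_succ_of_le hn) i hi') (t, s)
      have b2 := abs_interp_le (N := N k) (a := fun n i => r k (n + 1) i) hL hT hM hhi.le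
        (fun n hn i hi' => (h.good k).abs_le hlo (n + 1) (by omega) i hi') (t, s)
      refine mul_le_mul ?_ (hC0 _ ?_) (abs_nonneg _) hhi.le
      · rw [abs_div, abs_two, div_le_iff₀ two_pos]
        refine (abs_add_le _ _).trans ?_
        rw [interpNext]
        linarith
      · constructor <;> linarith [hx.1, hx.2, hs.1, hs.2]
    · filter_upwards [hz] with s hs
      have := ((hs.1.add hs.2).div_const 2).mul_const (W (x - s))
      convert this using 2
      ring
  have hdiff : Tendsto (fun k => interp L T (M k) (N k)
      (fun n i => discConv L (M k) W (fun j => (r k n j + r k (n + 1) j) / 2) i) (t, x) - J k)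
      atTop (𝓝 0) := by
    refine squeeze_zero_norm (a := fun k => hi * C * (2 * L) * stepX L (M k)) (fun k => ?_)
      (by simpa using h.stepX_tendsto.const_mul (hi * C * (2 * L)))
    have hM := (h.good k).one_le
    obtain ⟨n, i, hn, hi', ht, hxi, e⟩ := exists_index hL hT (N k) hM hzm
    rw [e]
    have e2 : J k = ∫ s in Ico (-L) L,
        cellFn L (M k) (fun j => (r k n j + r k (n + 1) j) / 2) s * W (x - s) := by
      refine integral_congr_ae ?_
      filter_upwards [ae_restrict_mem measurableSet_Ico] with s hs
      obtain ⟨j, hj, hsj⟩ := exists_mem_cell hL hM hs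
      rw [interpNext, interp_of_mem hL hT hM hn hj (z := (t, s)) ⟨ht, hsj⟩,
        interp_of_mem hL hT hM hn hj (z := (t, s)) ⟨ht, hsj⟩, cellFn_of_mem hL hM hj hsj]
    rw [e2]
    exact abs_discConv_sub_le hL hM hW.continuousOn hC hhi.le hC1 hi'
      ((h.good k).abs_mean_le hlo hn) hxi
  have := hdiff.add hJlim
  simpa using this

lemma tendsto_interp_avgV (hL : 0 < L) (hT : 0 < T) (hV : ContDiffOn ℝ 2 V (Icc (-L) L))
    (h : GoodSeq L T V W ρ₀ lo hi K M N r) {z : ℝ × ℝ} (hz : z ∈ halfCyl L T) :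
    Tendsto (fun k => interp L T (M k) (N k) (fun _ i => avgV L (M k) V i) z)
      atTop (𝓝 (V z.2)) := by
  obtain ⟨C, hC, -, hC1, -⟩ := exists_difference_bounds (by linarith : -L < L) hV
  rw [tendsto_iff_norm_sub_tendsto_zero]
  refine squeeze_zero (fun _ => norm_nonneg _) (g := fun k => C * stepX L (M k)) (fun k => ?_)
    (by simpa using h.stepX_tendsto.const_mul C)
  have hM := (h.good k).one_le
  obtain ⟨n, i, hn, hi', ht, hxi, e⟩ := exists_index hL hT (N k) hM hz
  rw [e]
  have hsub : ∀ s ∈ cell L (M k) i, s ∈ Icc (-L) L := fun s hs =>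
    Ico_subset_Icc_self (cell_subset hL hM hi' hs)
  refine abs_average_cell_sub_le hL hM
    ((hV.continuousOn.integrableOn_compact isCompact_Icc).mono_set hsub) fun s hs => ?_
  exact (hC1 _ (hsub _ hs) _ (hsub _ hxi)).trans
    (mul_le_mul_of_nonneg_left (abs_sub_le_of_mem_cell hs hxi) hC)

lemma tendsto_interp_entropyVar (hL : 0 < L) (hT : 0 < T) (hV : ContDiffOn ℝ 2 V (Icc (-L) L))
    (hW : ContDiffOn ℝ 2 W (Icc (-(2 * L)) (2 * L))) (hlo : 0 < lo) (hhi : 0 < hi)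
    (h : GoodSeq L T V W ρ₀ lo hi K M N r) (hρ : GoodLimit L T lo hi M N r ρ) :
    ∀ᵐ z ∂volume.restrict (halfCyl L T), Tendsto (fun k => interp L T (M k) (N k)
      (entropyVar L (M k) boltzmann V W (r k)) z)
      atTop (𝓝 (deriv boltzmann (ρ z) + V z.2 + conv L W ρ z)) := by
  filter_upwards [tendsto_interp_discConv hL hT hW hlo hhi h hρ, hρ.next,
    ae_restrict_mem (measurableSet_halfCyl L T)] with z h1 h2 hz
  have hpos : 0 < ρ z := hlo.trans_le (hρ.mem z).1
  rw [deriv_boltzmann hpos]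
  have h3 := (h2.log hpos.ne').add (tendsto_interp_avgV hL hT hV h hz) |>.add h1
  refine h3.congr fun k => ?_
  obtain ⟨n, i, hn, hi', -, -, e⟩ := exists_index hL hT (N k) (h.good k).one_le hz
  have hp : 0 < r k (n + 1) i := hlo.trans_le ((h.good k).mem (n + 1) (by omega) i hi').1
  rw [interpNext, e, e, e, e, entropyVar, deriv_boltzmann hp]

lemma exists_entropyVar_bound (hL : 0 < L) (hV : ContDiffOn ℝ 2 V (Icc (-L) L))
    (hW : ContDiffOn ℝ 2 W (Icc (-(2 * L)) (2 * L))) (hlo : 0 < lo) (hhi : 0 < hi) :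
    ∃ B, 0 ≤ B ∧ ∀ (M N : ℕ) (r : ℕ → ℕ → ℝ), GoodSol L T V W ρ₀ lo hi K M N r →
      ∀ n ≤ N, ∀ i ∈ Finset.Icc 1 (2 * M), |entropyVar L M boltzmann V W r n i| ≤ B := by
  obtain ⟨C₁, hC₁, hb₁, -, -⟩ := exists_difference_bounds (by linarith : -L < L) hV
  obtain ⟨C₂, hC₂, hb₂, -, -⟩ := exists_difference_bounds (by linarith : -(2 * L) < 2 * L) hW
  refine ⟨max |Real.log lo| |Real.log hi| + C₁ + hi * C₂ * (2 * L), by positivity,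
    fun M N r h n hn i hi' => ?_⟩
  have hM := h.one_le
  have hm := h.mem (n + 1) (by omega) i hi'
  have hp : 0 < r (n + 1) i := hlo.trans_le hm.1
  rw [entropyVar, deriv_boltzmann hp]
  refine (abs_add_le _ _).trans (add_le_add ((abs_add_le _ _).trans (add_le_add ?_ ?_)) ?_)
  · exact abs_le_max_abs_abs (Real.log_le_log hlo hm.1) (Real.log_le_log hp hm.2)
  · exact abs_average_cell_le hL hM fun x hx =>
      hb₁ x (Ico_subset_Icc_self (cell_subset hL hM hi' hx))
  · exact abs_discConv_le hL hM hW.continuousOn hhi.le hb₂ hi' (h.abs_mean_le hlo hn)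

end Limits

/-! ### The weak derivative -/

lemma lt_of_mem_cell {L : ℝ} (hL : 0 < L) {M : ℕ} (hM : 1 ≤ M) {i : ℕ}
    (hi : i ∈ Finset.Icc 1 (2 * M)) {x : ℝ} (hx : x ∈ cell L M i) (hxL : x < L - stepX L M) :
    i < 2 * M := by
  have hX := stepX_pos hL hM
  rcases (Finset.mem_Icc.1 hi).2.lt_or_eq with h | h
  · exact h
  · exfalso
    have h3 := hx.1
    have h4 := stepX_mul (L := L) hM
    rw [h] at h3
    nlinarith

lemma integral_interp_slope_mul {L T : ℝ} (hL : 0 < L) (hT : 0 < T) {M N : ℕ} (hM : 1 ≤ M)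
    (a : ℕ → ℕ → ℝ) {ψ : ℝ × ℝ → ℝ} (hψ : Integrable ψ)
    (hsupp : ∀ z, ψ z ≠ 0 → -L < z.2 ∧ z.2 < L - stepX L M) :
    ∫ z in halfCyl L T, interp L T M N
        (faceExt M fun n i => (a n (i + 1) - a n i) / stepX L M) z * ψ z =
      -∫ z in halfCyl L T, interp L T M N a z * ((ψ z - ψ (z - (0, stepX L M))) / stepX L M) := by
  have hX := stepX_pos hL hM
  set v : ℝ × ℝ := (0, stepX L M) with hv
  have hz0 : ∀ (b : ℕ → ℕ → ℝ) (f : ℝ × ℝ → ℝ), ∫ z in halfCyl L T, interp L T M N b z * f z =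
      ∫ z, interp L T M N b z * f z := fun b f =>
    setIntegral_eq_integral_of_forall_compl_eq_zero fun z hz => by
      rw [interp_of_notMem hL hT hM hz, zero_mul]
  rw [hz0, hz0]
  obtain ⟨C, hC⟩ := exists_abs_interp_le hL hT N hM a
  have hAm := measurable_interp L T M N a
  have i1 : Integrable fun z => interp L T M N a z * ψ z :=
    hψ.bdd_mul (c := C) hAm.aestronglyMeasurable (Eventually.of_forall hC)
  have i2 : Integrable fun z => interp L T M N a (z + v) * ψ z :=
    hψ.bdd_mul (c := C) (hAm.comp (measurable_add_const v)).aestronglyMeasurable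
      (Eventually.of_forall fun z => hC (z + v))
  have i3 : Integrable fun z => interp L T M N a z * ψ (z - v) :=
    (hψ.comp_sub_right v).bdd_mul (c := C) hAm.aestronglyMeasurable (Eventually.of_forall hC)
  have e1 : ∀ z, interp L T M N (faceExt M fun n i => (a n (i + 1) - a n i) / stepX L M) z * ψ z =
      (interp L T M N a (z + v) * ψ z - interp L T M N a z * ψ z) / stepX L M := by
    intro z
    by_cases hψz : ψ z = 0
    · simp [hψz]
    obtain ⟨h1, h2⟩ := hsupp z hψz
    by_cases ht : z.1 ∈ Ico 0 T
    · have hz : z ∈ halfCyl L T := ⟨ht, h1.le, by linarith⟩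
      obtain ⟨n, i, hn, hi, htn, hxi, e⟩ := exists_index hL hT N hM hz
      have hi2 := lt_of_mem_cell hL hM hi hxi h2
      have hi1 : i + 1 ∈ Finset.Icc 1 (2 * M) := Finset.mem_Icc.2 ⟨by omega, by omega⟩
      have hmem : z + v ∈ timeCell T N n ×ˢ cell L M (i + 1) := by
        refine ⟨by simpa [hv] using htn, ?_⟩
        have h3 := hxi.1
        have h4 := hxi.2
        constructor <;> simp only [hv, Prod.snd_add] <;> push_cast <;> nlinarith
      rw [e, e, interp_of_mem hL hT hM hn hi1 hmem, faceExt, if_pos hi2]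
      ring
    · have hz : z ∉ halfCyl L T := fun h => ht h.1
      have hz' : z + v ∉ halfCyl L T := fun h => ht (by simpa [hv] using h.1)
      rw [interp_of_notMem hL hT hM hz, interp_of_notMem hL hT hM hz,
        interp_of_notMem hL hT hM hz']
      simp
  have e2 : ∫ z, interp L T M N a (z + v) * ψ z = ∫ z, interp L T M N a z * ψ (z - v) := by
    rw [← integral_add_right_eq_self (fun z => interp L T M N a z * ψ (z - v)) v]
    simp_rw [add_sub_cancel_right]
  simp_rw [e1]
  rw [integral_div, integral_sub i2 i1, e2, ← integral_sub i3 i1, ← integral_div, ← integral_neg]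
  refine integral_congr_ae (Eventually.of_forall fun z => ?_)
  simp only
  ring

lemma tendsto_backward_quotient {ψ : ℝ × ℝ → ℝ} {z : ℝ × ℝ} (hψ : DifferentiableAt ℝ ψ z)
    {h : ℕ → ℝ} (hpos : ∀ k, 0 < h k) (h0 : Tendsto h atTop (𝓝 0)) :
    Tendsto (fun k => (ψ z - ψ (z - (0, h k))) / h k) atTop (𝓝 (partialX ψ z)) := by
  have h1 : DifferentiableAt ℝ (fun y => ψ (z.1, y)) z.2 :=
    DifferentiableAt.comp z.2 (g := ψ) (f := fun y => (z.1, y)) hψ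
      ((differentiableAt_const _).prodMk differentiableAt_id)
  have h2 := h1.hasDerivAt.tendsto_slope_zero
  have h3 : Tendsto (fun k => -h k) atTop (𝓝[≠] 0) := by
    refine tendsto_nhdsWithin_iff.2 ⟨by simpa using h0.neg, Eventually.of_forall fun k => ?_⟩
    simpa using (hpos k).ne'
  refine (h2.comp h3).congr fun k => ?_
  have e : z - (0, h k) = (z.1, z.2 + -h k) := by
    ext <;> simp [sub_eq_add_neg]
  simp only [Function.comp, e, smul_eq_mul]
  rw [inv_neg]
  ring

section WeakDerivative

variable {L T : ℝ} {V W ρ₀ : ℝ → ℝ} {lo hi K : ℝ} {M N : ℕ → ℕ} {r : ℕ → ℕ → ℕ → ℝ}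
  {ρ : ℝ × ℝ → ℝ}

/-- The discrete gradient of the entropy variable. -/
def entropySlope (L T : ℝ) (M N : ℕ) (V W : ℝ → ℝ) (r : ℕ → ℕ → ℝ) : ℝ × ℝ → ℝ :=
  interp L T M N (faceExt M fun n i => -velocity L M boltzmann V W r n i)

theorem isWeakPartialX_of_weak_limit (hL : 0 < L) (hT : 0 < T)
    (hV : ContDiffOn ℝ 2 V (Icc (-L) L)) (hW : ContDiffOn ℝ 2 W (Icc (-(2 * L)) (2 * L)))
    (hlo : 0 < lo) (hhi : 0 < hi)
    (h : GoodSeq L T V W ρ₀ lo hi K M N r) (hρ : GoodLimit L T lo hi M N r ρ)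
    {l : Filter ℕ} [l.NeBot] (hl : l ≤ atTop) {g : ℝ × ℝ → ℝ}
    (hg2 : MemLp g 2 (volume.restrict (halfCyl L T)))
    (hg : ∀ f, MemLp f 2 (volume.restrict (halfCyl L T)) →
      Tendsto (fun k => ∫ z in halfCyl L T, entropySlope L T (M k) (N k) V W (r k) z * f z) l
        (𝓝 (∫ z in halfCyl L T, g z * f z))) :
    IsWeakPartialX (cyl L T) (fun z => deriv boltzmann (ρ z) + V z.2 + conv L W ρ z) g := by
  obtain ⟨B, hB0, hB⟩ := exists_entropyVar_bound (T := T) (ρ₀ := ρ₀) (K := K) hL hV hW hlo hhi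
  have hbd : ∀ k z, |interp L T (M k) (N k) (entropyVar L (M k) boltzmann V W (r k)) z| ≤ B :=
    fun k z => abs_interp_le hL hT (h.good k).one_le hB0 (hB _ _ _ (h.good k)) z
  have hlim := tendsto_interp_entropyVar hL hT hV hW hlo hhi h hρ
  have hξ := memLp_of_tendsto_of_bounded (μ := volume.restrict (halfCyl L T))
    (fun k => (measurable_interp L T (M k) (N k) _).aestronglyMeasurable)
    (fun k => Eventually.of_forall (hbd k)) hlim 1
  refine ⟨?_, ?_, fun ψ hψ hcs hts => ?_⟩
  · refine IntegrableOn.locallyIntegrableOn ?_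
    rw [IntegrableOn, restrict_cyl]
    exact memLp_one_iff_integrable.1 hξ
  · refine IntegrableOn.locallyIntegrableOn ?_
    rw [IntegrableOn, restrict_cyl]
    exact hg2.integrable (by norm_num)
  rw [restrict_cyl]
  have hψi : Integrable ψ := hψ.continuous.integrable_of_hasCompactSupport hcs
  have hψ2 : MemLp ψ 2 (volume.restrict (halfCyl L T)) :=
    (hψ.continuous.memLp_of_hasCompactSupport hcs).restrict _
  obtain ⟨Kψ, hKψ⟩ := ContDiff.lipschitzWith_of_hasCompactSupport (𝕂 := ℝ) hcs hψ (by simp)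
  obtain ⟨δ, hδ, hδs⟩ := hcs.isCompact.exists_forall_le' (f := fun z : ℝ × ℝ => L - z.2)
    (by fun_prop) (a := 0) (fun z hz => by have := (hts hz).2.2; linarith)
  have hlimR : Tendsto (fun k => ∫ z in halfCyl L T,
      interp L T (M k) (N k) (entropyVar L (M k) boltzmann V W (r k)) z *
        ((ψ z - ψ (z - (0, stepX L (M k)))) / stepX L (M k))) atTop
      (𝓝 (∫ z in halfCyl L T, (deriv boltzmann (ρ z) + V z.2 + conv L W ρ z) * partialX ψ z)) := by
    refine tendsto_integral_of_ae_of_bounded (B := B * Kψ) (fun k => ?_) (fun k => ?_) ?_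
    · refine ((measurable_interp ..).mul ?_).aestronglyMeasurable
      exact ((hψ.continuous.sub (hψ.continuous.comp (continuous_id.sub continuous_const))).div_const
        _).measurable
    · refine Eventually.of_forall fun z => ?_
      have hX := stepX_pos hL (h.good k).one_le
      rw [abs_mul]
      refine mul_le_mul (hbd k z) ?_ (abs_nonneg _) hB0
      rw [abs_div, abs_of_pos hX, div_le_iff₀ hX]
      have := hKψ.dist_le_mul z (z - (0, stepX L (M k)))
      rw [Real.dist_eq, dist_eq_norm, sub_sub_cancel, Prod.norm_def] at this
      simpa [abs_of_pos hX, hX.le] using this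
    · filter_upwards [hlim] with z hz
      exact hz.mul (tendsto_backward_quotient (hψ.differentiable (by simp) z)
        (fun k => stepX_pos hL (h.good k).one_le) h.stepX_tendsto)
  have hev : ∀ᶠ k in atTop, ∫ z in halfCyl L T, entropySlope L T (M k) (N k) V W (r k) z * ψ z =
      -∫ z in halfCyl L T, interp L T (M k) (N k) (entropyVar L (M k) boltzmann V W (r k)) z *
        ((ψ z - ψ (z - (0, stepX L (M k)))) / stepX L (M k)) := by
    filter_upwards [h.stepX_tendsto.eventually (gt_mem_nhds hδ)] with k hk
    rw [← integral_interp_slope_mul hL hT (h.good k).one_le _ hψi]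
    · simp only [entropySlope, velocity, neg_neg]
    · intro z hz
      have hz' := subset_tsupport ψ hz
      have := hδs z hz'
      exact ⟨(hts hz').2.1, by linarith⟩
  have h1 := (hg ψ hψ2).congr' (hl hev)
  have := tendsto_nhds_unique h1 (hlimR.neg.mono_left hl)
  linarith

end WeakDerivative

/-! ### Test functions -/

section TestFunction

variable {L T : ℝ} {φ : ℝ × ℝ → ℝ}

lemma exists_lipschitzOn_closedCyl (hφ : ContDiffOn ℝ ∞ φ (Icc 0 T ×ˢ Icc (-L) L)) :
    ∃ K : NNReal, LipschitzOnWith K φ (Icc 0 T ×ˢ Icc (-L) L) :=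
  LocallyLipschitzOn.exists_lipschitzOnWith_of_compact (isCompact_Icc.prod isCompact_Icc)
    (ContDiffOn.locallyLipschitzOn ((convex_Icc _ _).prod (convex_Icc _ _))
      (hφ.of_le (by exact_mod_cast le_top)))

lemma isOpen_cyl (L T : ℝ) : IsOpen (cyl L T) := isOpen_Ioo.prod isOpen_Ioo

lemma cyl_subset_closedCyl (L T : ℝ) : cyl L T ⊆ Icc 0 T ×ˢ Icc (-L) L :=
  prod_mono Ioo_subset_Icc_self Ioo_subset_Icc_self

lemma closedCyl_mem_nhds {z : ℝ × ℝ} (hz : z ∈ cyl L T) : Icc 0 T ×ˢ Icc (-L) L ∈ 𝓝 z :=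
  Filter.mem_of_superset ((isOpen_cyl L T).mem_nhds hz) (cyl_subset_closedCyl L T)

lemma hasStrictFDerivAt_of_mem_cyl (hφ : ContDiffOn ℝ ∞ φ (Icc 0 T ×ˢ Icc (-L) L)) {z : ℝ × ℝ}
    (hz : z ∈ cyl L T) : HasStrictFDerivAt φ (fderiv ℝ φ z) z :=
  (hφ.contDiffAt (closedCyl_mem_nhds hz)).hasStrictFDerivAt (by simp)

lemma hasDerivAt_time (hφ : ContDiffOn ℝ ∞ φ (Icc 0 T ×ˢ Icc (-L) L)) {z : ℝ × ℝ}
    (hz : z ∈ cyl L T) : HasDerivAt (fun s => φ (s, z.2)) (fderiv ℝ φ z (1, 0)) z.1 :=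
  HasFDerivAt.comp_hasDerivAt z.1 (l := φ) (f := fun s => (s, z.2))
    (hasStrictFDerivAt_of_mem_cyl hφ hz).hasFDerivAt
    ((hasDerivAt_id z.1).prodMk (hasDerivAt_const z.1 z.2))

lemma hasDerivAt_space (hφ : ContDiffOn ℝ ∞ φ (Icc 0 T ×ˢ Icc (-L) L)) {z : ℝ × ℝ}
    (hz : z ∈ cyl L T) : HasDerivAt (fun y => φ (z.1, y)) (fderiv ℝ φ z (0, 1)) z.2 :=
  HasFDerivAt.comp_hasDerivAt z.2 (l := φ) (f := fun y => (z.1, y))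
    (hasStrictFDerivAt_of_mem_cyl hφ hz).hasFDerivAt
    ((hasDerivAt_const z.2 z.1).prodMk (hasDerivAt_id z.2))

lemma partialT_eq (hφ : ContDiffOn ℝ ∞ φ (Icc 0 T ×ˢ Icc (-L) L)) {z : ℝ × ℝ}
    (hz : z ∈ cyl L T) : partialT φ z = fderiv ℝ φ z (1, 0) := (hasDerivAt_time hφ hz).deriv

lemma partialX_eq (hφ : ContDiffOn ℝ ∞ φ (Icc 0 T ×ˢ Icc (-L) L)) {z : ℝ × ℝ}
    (hz : z ∈ cyl L T) : partialX φ z = fderiv ℝ φ z (0, 1) := (hasDerivAt_space hφ hz).deriv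

lemma aestronglyMeasurable_partialT (hφ : ContDiffOn ℝ ∞ φ (Icc 0 T ×ˢ Icc (-L) L)) :
    AEStronglyMeasurable (partialT φ) (volume.restrict (halfCyl L T)) := by
  rw [← restrict_cyl]
  have h1 : ContinuousOn (fun z => fderiv ℝ φ z (1, 0)) (cyl L T) :=
    ((hφ.mono (cyl_subset_closedCyl L T)).continuousOn_fderiv_of_isOpen (isOpen_cyl L T)
      (by simp)).clm_apply continuousOn_const
  refine (h1.aestronglyMeasurable (isOpen_cyl L T).measurableSet).congr ?_
  filter_upwards [ae_restrict_mem (isOpen_cyl L T).measurableSet] with z hz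
  exact (partialT_eq hφ hz).symm

lemma ae_mem_cyl (L T : ℝ) : ∀ᵐ z ∂volume.restrict (halfCyl L T), z ∈ cyl L T := by
  rw [← restrict_cyl]
  exact ae_restrict_mem (isOpen_cyl L T).measurableSet

lemma abs_partialT_le (hφ : ContDiffOn ℝ ∞ φ (Icc 0 T ×ˢ Icc (-L) L)) {K : NNReal}
    (hK : LipschitzOnWith K φ (Icc 0 T ×ˢ Icc (-L) L)) {z : ℝ × ℝ} (hz : z ∈ cyl L T) :
    |partialT φ z| ≤ K := by
  rw [partialT_eq hφ hz]
  refine (ContinuousLinearMap.le_of_opNorm_le _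
    (norm_fderiv_le_of_lipschitzOn ℝ (closedCyl_mem_nhds hz) hK) _).trans (le_of_eq ?_)
  simp

lemma integrableOn_partialT (hφ : ContDiffOn ℝ ∞ φ (Icc 0 T ×ˢ Icc (-L) L)) :
    IntegrableOn (partialT φ) (halfCyl L T) := by
  obtain ⟨K, hK⟩ := exists_lipschitzOn_closedCyl hφ
  refine Integrable.mono' (g := fun _ => (K : ℝ)) (integrable_const _)
    (aestronglyMeasurable_partialT hφ) ?_
  filter_upwards [ae_mem_cyl L T] with z hz using abs_partialT_le hφ hK hz

lemma node_mem {T : ℝ} (hT : 0 < T) {N n : ℕ} (hn : n ≤ N + 1) : (n : ℝ) * stepT T N ∈ Icc 0 T := by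
  have hτ := stepT_pos hT N
  have h1 := stepT_mul T N
  have h2 : (n : ℝ) ≤ (N : ℝ) + 1 := by exact_mod_cast hn
  exact ⟨by positivity, by nlinarith⟩

lemma integrableOn_slice (hφ : ContDiffOn ℝ ∞ φ (Icc 0 T ×ˢ Icc (-L) L)) {s : ℝ}
    (hs : s ∈ Icc 0 T) : IntegrableOn (fun x => φ (s, x)) (Icc (-L) L) := by
  have : ContinuousOn (fun x => φ (s, x)) (Icc (-L) L) :=
    hφ.continuousOn.comp (by fun_prop) fun x hx => ⟨hs, hx⟩
  exact this.integrableOn_compact isCompact_Icc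

lemma integrableOn_slice_cell (hL : 0 < L) (hφ : ContDiffOn ℝ ∞ φ (Icc 0 T ×ˢ Icc (-L) L)) {s : ℝ}
    (hs : s ∈ Icc 0 T) {M : ℕ} (hM : 1 ≤ M) {i : ℕ} (hi : i ∈ Finset.Icc 1 (2 * M)) :
    IntegrableOn (fun x => φ (s, x)) (cell L M i) :=
  (integrableOn_slice hφ hs).mono_set ((cell_subset hL hM hi).trans Ico_subset_Icc_self)

lemma integral_partialT_cell (hL : 0 < L) (hT : 0 < T)
    (hφ : ContDiffOn ℝ ∞ φ (Icc 0 T ×ˢ Icc (-L) L)) {M N : ℕ} (hM : 1 ≤ M) {n : ℕ} (hn : n ≤ N)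
    {i : ℕ} (hi : i ∈ Finset.Icc 1 (2 * M)) :
    ∫ z in timeCell T N n ×ˢ cell L M i, partialT φ z =
      (∫ x in cell L M i, φ (((n + 1 : ℕ) : ℝ) * stepT T N, x))
        - ∫ x in cell L M i, φ ((n : ℝ) * stepT T N, x) := by
  have hτ := stepT_pos hT N
  have hn0 := node_mem hT (N := N) (n := n) (by omega)
  have hn1 := node_mem hT (N := N) (n := n + 1) (by omega)
  have hle : (n : ℝ) * stepT T N ≤ ((n + 1 : ℕ) : ℝ) * stepT T N := by push_cast; nlinarith
  have hintg : IntegrableOn (partialT φ) (timeCell T N n ×ˢ cell L M i) :=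
    (integrableOn_partialT hφ).mono_set (prod_mono (timeCell_subset hT hn) (cell_subset hL hM hi))
  rw [IntegrableOn, Measure.volume_eq_prod, ← Measure.prod_restrict] at hintg
  rw [Measure.volume_eq_prod, ← Measure.prod_restrict, integral_prod_symm _ hintg,
    ← integral_sub (integrableOn_slice_cell hL hφ hn1 hM hi)
      (integrableOn_slice_cell hL hφ hn0 hM hi)]
  refine integral_congr_ae ?_
  have hdom : ∀ᵐ x ∂volume.restrict (cell L M i), x ∈ dom L :=
    ae_restrict_cell hL hM hi (ae_restrict_mem measurableSet_Ioo)
  filter_upwards [hintg.prod_left_ae, hdom] with x h1 h2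
  have e : timeCell T N n = Ico ((n : ℝ) * stepT T N) (((n + 1 : ℕ) : ℝ) * stepT T N) := by
    rw [timeCell]; push_cast; rfl
  rw [e] at h1 ⊢
  rw [integral_Ico_eq_integral_Ioc, ← intervalIntegral.integral_of_le hle]
  refine intervalIntegral.integral_eq_sub_of_hasDerivAt_of_le hle
    (f := fun s => φ (s, x)) ?_ (fun s hs => ?_)
    ((intervalIntegrable_iff_integrableOn_Ico_of_le hle).2 h1)
  · refine hφ.continuousOn.comp (by fun_prop) fun s hs => ⟨⟨hn0.1.trans hs.1, hs.2.trans hn1.2⟩, ?_⟩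
    exact Ioo_subset_Icc_self h2
  · have hz : (s, x) ∈ cyl L T := ⟨⟨hn0.1.trans_lt hs.1, hs.2.trans_le hn1.2⟩, h2⟩
    rw [partialT_eq hφ hz]
    exact hasDerivAt_time hφ hz

/-- The difference quotient of the cell averages of `φ(s, ·)`. -/
def avgQuotient (L : ℝ) (M : ℕ) (φ : ℝ × ℝ → ℝ) (s : ℝ) (i : ℕ) : ℝ :=
  ((⨍ x in cell L M (i + 1), φ (s, x)) - ⨍ x in cell L M i, φ (s, x)) / stepX L M

lemma abs_avgQuotient_sub_le (hL : 0 < L) (hφ : ContDiffOn ℝ ∞ φ (Icc 0 T ×ˢ Icc (-L) L)) {s : ℝ}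
    (hs : s ∈ Icc 0 T) {M : ℕ} (hM : 1 ≤ M) {i : ℕ} (h1 : 1 ≤ i) (h2 : i < 2 * M) {c ε : ℝ}
    (h : ∀ x ∈ cell L M i, |φ (s, x + stepX L M) - φ (s, x) - c * stepX L M| ≤ ε * stepX L M) :
    |avgQuotient L M φ s i - c| ≤ ε := by
  have hX := stepX_pos hL hM
  have hi : i ∈ Finset.Icc 1 (2 * M) := Finset.mem_Icc.2 ⟨h1, h2.le⟩
  have hi' : i + 1 ∈ Finset.Icc 1 (2 * M) := Finset.mem_Icc.2 ⟨by omega, h2⟩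
  have i1 := integrableOn_slice_cell hL hφ hs hM hi
  have i2 : IntegrableOn (fun x => φ (s, x + stepX L M)) (cell L M i) := by
    have hc : ContinuousOn (fun x => φ (s, x)) (Icc (-L) L) :=
      hφ.continuousOn.comp (by fun_prop) fun x hx => ⟨hs, hx⟩
    have := integrableOn_cell_of_continuousOn (L := L) (M := M) (j := i) hc (c := stepX L M) (e := 1)
      (fun x hx => by
        refine Ico_subset_Icc_self (cell_subset hL hM hi' ?_)
        constructor <;> push_cast <;> nlinarith [hx.1, hx.2])
    refine this.congr (Eventually.of_forall fun x => ?_)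
    simp only
    rw [one_mul, add_comm]
  have h3 := abs_average_cell_sub_le hL hM (i2.sub i1) (c := c * stepX L M) (C := ε * stepX L M) h
  have e : avgQuotient L M φ s i - c = ((⨍ x in cell L M i, ((fun x => φ (s, x + stepX L M))
      - fun x => φ (s, x)) x) - c * stepX L M) / stepX L M := by
    rw [avgQuotient, average_cell_succ hL hM, average_cell_sub M i2 i1]
    simp only [Pi.sub_apply]
    field_simp
  rw [e, abs_div, abs_of_pos hX, div_le_iff₀ hX]
  exact h3

lemma abs_avgQuotient_le (hL : 0 < L) (hφ : ContDiffOn ℝ ∞ φ (Icc 0 T ×ˢ Icc (-L) L))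
    {K : NNReal} (hK : LipschitzOnWith K φ (Icc 0 T ×ˢ Icc (-L) L)) {s : ℝ}
    (hs : s ∈ Icc 0 T) {M : ℕ} (hM : 1 ≤ M) {i : ℕ} (h1 : 1 ≤ i) (h2 : i < 2 * M) :
    |avgQuotient L M φ s i| ≤ K := by
  have hX := stepX_pos hL hM
  have hi : i ∈ Finset.Icc 1 (2 * M) := Finset.mem_Icc.2 ⟨h1, h2.le⟩
  have hi' : i + 1 ∈ Finset.Icc 1 (2 * M) := Finset.mem_Icc.2 ⟨by omega, h2⟩
  have := abs_avgQuotient_sub_le (c := 0) (ε := K) hL hφ hs hM h1 h2 fun x hx => ?_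
  · simpa using this
  · have m1 : x ∈ Icc (-L) L := Ico_subset_Icc_self (cell_subset hL hM hi hx)
    have m2 : x + stepX L M ∈ Icc (-L) L := by
      refine Ico_subset_Icc_self (cell_subset hL hM hi' ?_)
      constructor <;> push_cast <;> nlinarith [hx.1, hx.2]
    have h3 := hK.dist_le_mul (s, x + stepX L M) ⟨hs, m2⟩ (s, x) ⟨hs, m1⟩
    rw [zero_mul, sub_zero]
    rw [Real.dist_eq, Prod.dist_eq] at h3
    simpa [Real.dist_eq, abs_of_pos hX, hX.le] using h3

end TestFunction

/-! ### The discrete weak formulation -/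

lemma sum_range_mul_sub (a b : ℕ → ℝ) (n : ℕ) :
    ∑ k ∈ Finset.range n, a k * (b (k + 1) - b k) =
      a n * b n - a 0 * b 0 - ∑ k ∈ Finset.range n, (a (k + 1) - a k) * b (k + 1) := by
  induction n with
  | zero => simp
  | succ n ih => rw [Finset.sum_range_succ, Finset.sum_range_succ, ih]; ring

/-- The upwind values of a discrete density. -/
def upwindDensity (L : ℝ) (M : ℕ) (V W : ℝ → ℝ) (r : ℕ → ℕ → ℝ) (n i : ℕ) : ℝ :=
  upwindValue (velocity L M boltzmann V W r n i) (r (n + 1) i) (r (n + 1) (i + 1))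

lemma interp_mul {L T : ℝ} (hL : 0 < L) (hT : 0 < T) {M N : ℕ} (hM : 1 ≤ M) (a b : ℕ → ℕ → ℝ)
    (z : ℝ × ℝ) : interp L T M N (fun n i => a n i * b n i) z =
      interp L T M N a z * interp L T M N b z := by
  by_cases hz : z ∈ halfCyl L T
  · obtain ⟨n, i, -, -, -, -, e⟩ := exists_index hL hT N hM hz
    rw [e, e, e]
  · simp only [interp_of_notMem hL hT hM hz, mul_zero]

/-- The discrete counterpart of `ρ ∂ₓφ`. -/
def upwindTest (L T : ℝ) (M N : ℕ) (V W : ℝ → ℝ) (r : ℕ → ℕ → ℝ) (φ : ℝ × ℝ → ℝ) : ℝ × ℝ → ℝ :=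
  interp L T M N (faceExt M fun n i => upwindDensity L M V W r n i *
    avgQuotient L M φ (((n + 1 : ℕ) : ℝ) * stepT T N) i)

lemma IsSchemeSol.integral_interp_mul_partialT {L T : ℝ} (hL : 0 < L) (hT : 0 < T) {M N : ℕ}
    (hM : 1 ≤ M) {V W ρ₀ : ℝ → ℝ} {r : ℕ → ℕ → ℝ} (h : IsSchemeSol L T M N boltzmann V W ρ₀ r)
    {φ : ℝ × ℝ → ℝ} (hφ : ContDiffOn ℝ ∞ φ (Icc 0 T ×ˢ Icc (-L) L))
    (hφT : ∀ x ∈ Icc (-L) L, φ (T, x) = 0) :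
    ∫ z in halfCyl L T, interp L T M N r z * partialT φ z =
      -(∑ i ∈ Finset.Icc 1 (2 * M), r 0 i * ∫ x in cell L M i, φ (0, x))
      + ∫ z in halfCyl L T, entropySlope L T M N V W r z * upwindTest L T M N V W r φ z := by
  have hX := stepX_pos hL hM
  set P : ℕ → ℕ → ℝ := fun n i => ∫ x in cell L M i, φ ((n : ℝ) * stepT T N, x) with hP
  set F := fun n i => flux L M boltzmann V W r n i with hF
  have hPT : ∀ i ∈ Finset.Icc 1 (2 * M), P (N + 1) i = 0 := by
    intro i hi
    simp only [hP]
    rw [Nat.cast_succ, stepT_mul]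
    refine (setIntegral_congr_fun (measurableSet_cell L M i) fun x hx => ?_).trans
      (integral_zero _ _)
    exact hφT x (Ico_subset_Icc_self (cell_subset hL hM hi hx))
  have hP0 : ∀ i, P 0 i = ∫ x in cell L M i, φ (0, x) := by
    intro i; simp only [hP, Nat.cast_zero, zero_mul]
  have e1 : ∫ z in halfCyl L T, interp L T M N r z * partialT φ z =
      ∑ i ∈ Finset.Icc 1 (2 * M), ∑ n ∈ Finset.range (N + 1), r n i * (P (n + 1) i - P n i) := by
    rw [integral_interp_mul hL hT hM r (integrableOn_partialT hφ), Finset.sum_comm]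
    refine Finset.sum_congr rfl fun i hi => Finset.sum_congr rfl fun n hn => ?_
    rw [integral_partialT_cell hL hT hφ hM (Nat.lt_succ_iff.1 (Finset.mem_range.1 hn)) hi]
  have e2 : ∀ n ∈ Finset.range (N + 1), ∑ i ∈ Finset.Icc 1 (2 * M),
      (r (n + 1) i - r n i) * P (n + 1) i =
      stepT T N / stepX L M * ∑ i ∈ Finset.Ico 1 (2 * M),
        F n i * (P (n + 1) (i + 1) - P (n + 1) i) := by
    intro n hn
    have e3 : ∀ i ∈ Finset.Icc 1 (2 * M), (r (n + 1) i - r n i) * P (n + 1) i =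
        -(stepT T N / stepX L M) * (P (n + 1) i * (F n i - F n (i - 1))) := by
      intro i hi
      rw [h.increment hT (Nat.lt_succ_iff.1 (Finset.mem_range.1 hn)) hi]
      ring
    have hlast : F n (2 * M) = 0 := flux_last ..
    rw [Finset.sum_congr rfl e3, ← Finset.mul_sum,
      sum_mul_div_eq_neg_sum_flux (2 * M) (F n) (P (n + 1)) (flux_zero ..) hlast,
      show Finset.Icc 1 (2 * M) = Finset.Ico 1 (2 * M + 1) from rfl,
      Finset.sum_Ico_succ_top (by omega), hlast]
    ring
  have e4 : ∫ z in halfCyl L T, entropySlope L T M N V W r z * upwindTest L T M N V W r φ z =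
      -∑ n ∈ Finset.range (N + 1), stepT T N / stepX L M * ∑ i ∈ Finset.Ico 1 (2 * M),
        F n i * (P (n + 1) (i + 1) - P (n + 1) i) := by
    simp_rw [entropySlope, upwindTest, ← interp_mul hL hT hM]
    rw [integral_interp hL hT hM, ← Finset.sum_neg_distrib]
    refine Finset.sum_congr rfl fun n _ => ?_
    have e5 : ∀ i, faceExt M (fun n i => -velocity L M boltzmann V W r n i) n i *
        faceExt M (fun n i => upwindDensity L M V W r n i *
          avgQuotient L M φ (((n + 1 : ℕ) : ℝ) * stepT T N) i) n i * (stepT T N * stepX L M) =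
        if i < 2 * M then -velocity L M boltzmann V W r n i * (upwindDensity L M V W r n i *
          avgQuotient L M φ (((n + 1 : ℕ) : ℝ) * stepT T N) i) * (stepT T N * stepX L M)
        else 0 := by
      intro i
      unfold faceExt
      split_ifs <;> simp
    simp_rw [e5]
    rw [sum_faceExt M hM, Finset.mul_sum, ← Finset.sum_neg_distrib]
    refine Finset.sum_congr rfl fun i hi => ?_
    obtain ⟨hi1, hi2⟩ := Finset.mem_Ico.1 hi
    simp only [hF, hP, avgQuotient, upwindDensity]
    rw [flux_eq_upwindValue_mul hi1 hi2, ← average_cell hL hM (i + 1), ← average_cell hL hM i]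
    field_simp
  rw [e1, e4]
  rw [Finset.sum_congr rfl fun i _ => sum_range_mul_sub (fun n => r n i) (fun n => P n i) (N + 1),
    Finset.sum_sub_distrib, Finset.sum_sub_distrib, Finset.sum_comm, Finset.sum_congr rfl e2,
    Finset.sum_congr rfl fun i hi => by rw [hPT i hi, mul_zero], Finset.sum_const_zero]
  simp_rw [hP0]
  ring

/-! ### Passage to the limit -/

section Passage

variable {L T : ℝ} {V W ρ₀ : ℝ → ℝ} {lo hi K : ℝ} {M N : ℕ → ℕ} {r : ℕ → ℕ → ℕ → ℝ}
  {ρ φ : ℝ × ℝ → ℝ}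

lemma GoodSol.abs_upwindTest_le {M N : ℕ} {r : ℕ → ℕ → ℝ} (hL : 0 < L) (hT : 0 < T) (hlo : 0 < lo)
    (hhi : 0 < hi) (h : GoodSol L T V W ρ₀ lo hi K M N r)
    (hφ : ContDiffOn ℝ ∞ φ (Icc 0 T ×ˢ Icc (-L) L)) {C : NNReal}
    (hC : LipschitzOnWith C φ (Icc 0 T ×ˢ Icc (-L) L)) (z : ℝ × ℝ) :
    |upwindTest L T M N V W r φ z| ≤ hi * C := by
  refine abs_interp_le hL hT h.one_le (by positivity) (fun n hn i hi' => ?_) z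
  unfold faceExt
  split_ifs with hi2
  · have hi1 := (Finset.mem_Icc.1 hi').1
    have hm := upwindValue_mem (u := velocity L M boltzmann V W r n i)
      (h.mem (n + 1) (by omega) i hi')
      (h.mem (n + 1) (by omega) (i + 1) (Finset.mem_Icc.2 ⟨by omega, hi2⟩))
    rw [abs_mul]
    refine mul_le_mul ?_ (abs_avgQuotient_le hL hφ hC (node_mem hT (by omega)) h.one_le hi1 hi2)
      (abs_nonneg _) hhi.le
    rw [upwindDensity, abs_of_nonneg (hlo.le.trans hm.1)]
    exact hm.2
  · rw [abs_zero]; positivity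

lemma tendsto_interp_avgQuotient (hL : 0 < L) (hT : 0 < T)
    (h : GoodSeq L T V W ρ₀ lo hi K M N r) (hφ : ContDiffOn ℝ ∞ φ (Icc 0 T ×ˢ Icc (-L) L))
    {z : ℝ × ℝ} (hz : z ∈ cyl L T) :
    Tendsto (fun k => interp L T (M k) (N k) (faceExt (M k) fun n i =>
      avgQuotient L (M k) φ (((n + 1 : ℕ) : ℝ) * stepT T (N k)) i) z) atTop
      (𝓝 (partialX φ z)) := by
  rw [Metric.tendsto_atTop]
  intro ε hε
  have h1 := ((hasStrictFDerivAt_of_mem_cyl hφ hz).isLittleO.def (half_pos hε))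
  obtain ⟨δ, hδ, hball⟩ := Metric.eventually_nhds_iff.1 h1
  have hzL : 0 < L - z.2 := by linarith [hz.2.2]
  obtain ⟨k₀, hk₀⟩ := eventually_atTop.1
    ((h.stepX_tendsto.eventually (gt_mem_nhds (half_pos hδ))).and
      ((h.stepT_tendsto.eventually (gt_mem_nhds hδ)).and
        (h.stepX_tendsto.eventually (gt_mem_nhds hzL))))
  refine ⟨k₀, fun k hk => ?_⟩
  obtain ⟨hX', hτ', hXL⟩ := hk₀ k hk
  have hM := (h.good k).one_le
  have hX := stepX_pos hL hM
  have hτ := stepT_pos hT (N k)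
  obtain ⟨n, i, hn, hi', ht, hxi, e⟩ := exists_index hL hT (N k) hM (cyl_subset_halfCyl L T hz)
  have hi2 := lt_of_mem_cell hL hM hi' hxi (by linarith)
  rw [e, faceExt, if_pos hi2, Real.dist_eq, partialX_eq hφ hz]
  refine lt_of_le_of_lt (abs_avgQuotient_sub_le hL hφ (node_mem hT (by omega)) hM
    (Finset.mem_Icc.1 hi').1 hi2 (ε := ε / 2) fun x hx => ?_) (half_lt_self hε)
  set s := ((n + 1 : ℕ) : ℝ) * stepT T (N k) with hs
  have hst : |s - z.1| ≤ stepT T (N k) := by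
    rw [hs, abs_le]
    push_cast
    constructor <;> nlinarith [ht.1, ht.2]
  have hxx := abs_sub_le_of_mem_cell hx hxi
  have hxx' : |x + stepX L (M k) - z.2| ≤ 2 * stepX L (M k) := by
    have : x + stepX L (M k) - z.2 = (x - z.2) + stepX L (M k) := by ring
    rw [this]
    refine (abs_add_le _ _).trans ?_
    rw [abs_of_pos hX]
    linarith
  have h2 := @hball ((s, x + stepX L (M k)), (s, x)) (by
    rw [Prod.dist_eq, Prod.dist_eq, Prod.dist_eq, Real.dist_eq, Real.dist_eq, Real.dist_eq]
    simp only [max_lt_iff]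
    exact ⟨⟨by linarith, by linarith⟩, by linarith, by linarith⟩)
  have e2 : ((s, x + stepX L (M k)) : ℝ × ℝ) - (s, x) = stepX L (M k) • ((0 : ℝ), (1 : ℝ)) := by
    ext <;> simp
  simp only [e2, map_smul, smul_eq_mul] at h2
  rw [norm_smul, Real.norm_of_nonneg hX.le, Prod.norm_def] at h2
  simp only [norm_zero, norm_one, zero_le_one, sup_of_le_right, mul_one] at h2
  rw [mul_comm (fderiv ℝ φ z (0, 1))]
  exact h2

lemma tendsto_upwindTest (hL : 0 < L) (hT : 0 < T)
    (h : GoodSeq L T V W ρ₀ lo hi K M N r) (hρ : GoodLimit L T lo hi M N r ρ)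
    (hφ : ContDiffOn ℝ ∞ φ (Icc 0 T ×ˢ Icc (-L) L)) :
    ∀ᵐ z ∂volume.restrict (halfCyl L T),
      Tendsto (fun k => upwindTest L T (M k) (N k) V W (r k) φ z) atTop
        (𝓝 (ρ z * partialX φ z)) := by
  filter_upwards [hρ.next, hρ.jump, ae_mem_cyl L T] with z h1 h2 hz
  have hzh := cyl_subset_halfCyl L T hz
  have hzL : 0 < L - z.2 := by linarith [hz.2.2]
  have hU : Tendsto (fun k => interp L T (M k) (N k)
      (faceExt (M k) (upwindDensity L (M k) V W (r k))) z) atTop (𝓝 (ρ z)) := by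
    have h3 : Tendsto (fun k => interp L T (M k) (N k)
        (faceExt (M k) (upwindDensity L (M k) V W (r k))) z
        - interpNext L T (M k) (N k) (r k) z) atTop (𝓝 0) := by
      refine squeeze_zero_norm' ?_ (by simpa using h2.abs)
      filter_upwards [h.stepX_tendsto.eventually (gt_mem_nhds hzL)] with k hk
      have hM := (h.good k).one_le
      obtain ⟨n, i, hn, hi', ht, hxi, e⟩ := exists_index hL hT (N k) hM hzh
      have hi2 := lt_of_mem_cell hL hM hi' hxi (by linarith)
      rw [interpNext, e, e, e, faceExt, faceExt, if_pos hi2, if_pos hi2]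
      exact abs_upwindValue_sub_le _ _ _
    simpa using h3.add h1
  refine (hU.mul (tendsto_interp_avgQuotient hL hT h hφ hz)).congr fun k => ?_
  rw [upwindTest, ← interp_mul hL hT (h.good k).one_le]
  congr 1
  ext n i
  unfold faceExt
  split_ifs <;> simp

lemma tendsto_initial (hL : 0 < L) (hT : 0 < T) (hρ₀ : IntegrableOn ρ₀ (dom L))
    (h : GoodSeq L T V W ρ₀ lo hi K M N r) (hφ : ContDiffOn ℝ ∞ φ (Icc 0 T ×ˢ Icc (-L) L)) :
    Tendsto (fun k => ∑ i ∈ Finset.Icc 1 (2 * M k), r k 0 i * ∫ x in cell L (M k) i, φ (0, x))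
      atTop (𝓝 (∫ x in dom L, ρ₀ x * φ (0, x))) := by
  obtain ⟨C, hC⟩ := exists_lipschitzOn_closedCyl hφ
  have h0 : (0 : ℝ) ∈ Icc 0 T := ⟨le_rfl, hT.le⟩
  have hcont : ContinuousOn (fun x => φ (0, x)) (Icc (-L) L) :=
    hφ.continuousOn.comp (by fun_prop) fun x hx => ⟨h0, hx⟩
  obtain ⟨B, hB⟩ := (isCompact_Icc (a := -L) (b := L)).exists_bound_of_continuousOn hcont
  have hintg : IntegrableOn (fun x => ρ₀ x * φ (0, x)) (dom L) := by
    refine Integrable.mul_bdd (c := B) hρ₀ ?_ ?_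
    · exact (hcont.mono Ioo_subset_Icc_self).aestronglyMeasurable measurableSet_Ioo
    · filter_upwards [ae_restrict_mem measurableSet_Ioo] with x hx
      exact hB x (Ioo_subset_Icc_self hx)
  rw [tendsto_iff_norm_sub_tendsto_zero]
  refine squeeze_zero (fun _ => norm_nonneg _)
    (g := fun k => C * stepX L (M k) * ∫ x in dom L, ‖ρ₀ x‖) (fun k => ?_)
    (by simpa using (h.stepX_tendsto.const_mul (C : ℝ)).mul_const (∫ x in dom L, ‖ρ₀ x‖))
  have hM := (h.good k).one_le
  have hX := stepX_pos hL hM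
  rw [← sum_integral_cell hL hM hintg, ← Finset.sum_sub_distrib,
    ← sum_integral_cell hL hM hρ₀.norm, Finset.mul_sum]
  refine (norm_sum_le _ _).trans (Finset.sum_le_sum fun i hi' => ?_)
  have hsub : ∀ x ∈ cell L (M k) i, x ∈ Icc (-L) L := fun x hx =>
    Ico_subset_Icc_self (cell_subset hL hM hi' hx)
  have hρi := integrableOn_cell hL hM hi' hρ₀
  have e : r k 0 i * (∫ x in cell L (M k) i, φ (0, x)) =
      ∫ x in cell L (M k) i, ρ₀ x * ⨍ y in cell L (M k) i, φ (0, y) := by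
    rw [integral_mul_const, (h.good k).sol.init i hi', ← average_cell hL hM, ← average_cell hL hM]
    ring
  rw [e, ← integral_sub (hρi.mul_const _) (integrableOn_cell hL hM hi' hintg), ← integral_const_mul]
  refine norm_integral_le_of_norm_le (hρi.norm.const_mul _) ?_
  filter_upwards [ae_restrict_mem (measurableSet_cell L (M k) i)] with x hx
  rw [← mul_sub, norm_mul, mul_comm]
  refine mul_le_mul_of_nonneg_right ?_ (norm_nonneg _)
  refine abs_average_cell_sub_le hL hM (integrableOn_slice_cell hL hφ h0 hM hi') fun y hy => ?_
  have h3 := hC.dist_le_mul (0, y) ⟨h0, hsub y hy⟩ (0, x) ⟨h0, hsub x hx⟩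
  rw [Real.dist_eq, Prod.dist_eq] at h3
  refine h3.trans (mul_le_mul_of_nonneg_left ?_ C.2)
  simpa [Real.dist_eq] using abs_sub_le_of_mem_cell hy hx

theorem weak_formulation (hL : 0 < L) (hT : 0 < T) (hlo : 0 < lo) (hhi : 0 < hi)
    (hρ₀ : IntegrableOn ρ₀ (dom L))
    (h : GoodSeq L T V W ρ₀ lo hi K M N r) (hρ : GoodLimit L T lo hi M N r ρ) {E : ℝ}
    (hw : ∀ k, MemLp (entropySlope L T (M k) (N k) V W (r k)) 2 (volume.restrict (halfCyl L T)))
    (hE : ∀ k, ∫ z in halfCyl L T, entropySlope L T (M k) (N k) V W (r k) z ^ 2 ≤ E)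
    {l : Filter ℕ} [l.NeBot] (hl : l ≤ atTop) {g : ℝ × ℝ → ℝ}
    (hg2 : MemLp g 2 (volume.restrict (halfCyl L T)))
    (hg : ∀ f, MemLp f 2 (volume.restrict (halfCyl L T)) →
      Tendsto (fun k => ∫ z in halfCyl L T, entropySlope L T (M k) (N k) V W (r k) z * f z) l
        (𝓝 (∫ z in halfCyl L T, g z * f z)))
    (hφ : ContDiffOn ℝ ∞ φ (Icc 0 T ×ˢ Icc (-L) L)) (hφT : ∀ x ∈ Icc (-L) L, φ (T, x) = 0) :
    ∫ z in cyl L T, (ρ z * partialT φ z - ρ z * partialX φ z * g z)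
      = -∫ x in dom L, ρ₀ x * φ (0, x) := by
  obtain ⟨C, hC⟩ := exists_lipschitzOn_closedCyl hφ
  have hm : ∀ k, AEStronglyMeasurable (upwindTest L T (M k) (N k) V W (r k) φ)
      (volume.restrict (halfCyl L T)) := fun k => (measurable_interp ..).aestronglyMeasurable
  have hbd : ∀ k, ∀ᵐ z ∂volume.restrict (halfCyl L T),
      |upwindTest L T (M k) (N k) V W (r k) φ z| ≤ hi * C := fun k =>
    Eventually.of_forall ((h.good k).abs_upwindTest_le hL hT hlo hhi hφ hC)
  have hq := tendsto_upwindTest hL hT h hρ hφ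
  have h1 := tendsto_integral_weak_mul hw hE hl hg hm hbd hq
  have hm2 : ∀ k, AEStronglyMeasurable (fun z => interp L T (M k) (N k) (r k) z * partialT φ z)
      (volume.restrict (halfCyl L T)) := fun k =>
    (measurable_interp ..).aestronglyMeasurable.mul (aestronglyMeasurable_partialT hφ)
  have hbd2 : ∀ k, ∀ᵐ z ∂volume.restrict (halfCyl L T),
      |interp L T (M k) (N k) (r k) z * partialT φ z| ≤ hi * C := fun k => by
    filter_upwards [ae_mem_cyl L T] with z hz
    rw [abs_mul]
    exact mul_le_mul (abs_interp_le hL hT (h.good k).one_le hhi.le (fun n hn i hi' =>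
      (h.good k).abs_le hlo n (Nat.le_succ_of_le hn) i hi') z) (abs_partialT_le hφ hC hz)
      (abs_nonneg _) hhi.le
  have hlim2 : ∀ᵐ z ∂volume.restrict (halfCyl L T), Tendsto
      (fun k => interp L T (M k) (N k) (r k) z * partialT φ z) atTop
      (𝓝 (ρ z * partialT φ z)) := by
    filter_upwards [hρ.prev] with z hz using hz.mul_const _
  have h2 := tendsto_integral_of_ae_of_bounded hm2 hbd2 hlim2
  have h3 := tendsto_initial hL hT hρ₀ h hφ
  have h4 := (h3.neg.mono_left hl).add h1
  have h5 := h4.congr fun k =>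
    ((h.good k).sol.integral_interp_mul_partialT hL hT (h.good k).one_le hφ hφT).symm
  have h6 := tendsto_nhds_unique (h2.mono_left hl) h5
  have i1 : Integrable (fun z => ρ z * partialT φ z) (volume.restrict (halfCyl L T)) :=
    memLp_one_iff_integrable.1 (memLp_of_tendsto_of_bounded hm2 hbd2 hlim2 1)
  have i2 : Integrable (fun z => g z * (ρ z * partialX φ z)) (volume.restrict (halfCyl L T)) :=
    hg2.integrable_mul (memLp_of_tendsto_of_bounded hm hbd hq 2)
  rw [restrict_cyl]
  have e : ∀ z, ρ z * partialT φ z - ρ z * partialX φ z * g z =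
      ρ z * partialT φ z - g z * (ρ z * partialX φ z) := fun z => by ring
  simp_rw [e]
  rw [integral_sub i1 i2, h6]
  ring

end Passage

/-- The limit of the interpolations is a weak solution. -/
theorem GoodSeq.isWeakSol {L T : ℝ} (hL : 0 < L) (hT : 0 < T) {V W ρ₀ : ℝ → ℝ}
    (hV : ContDiffOn ℝ 2 V (Icc (-L) L)) (hW : ContDiffOn ℝ 2 W (Icc (-(2 * L)) (2 * L)))
    (hρ₀ : IntegrableOn ρ₀ (dom L)) {lo hi K : ℝ} (hlo : 0 < lo) (hhi : 0 < hi) {M N : ℕ → ℕ}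
    {r : ℕ → ℕ → ℕ → ℝ} {ρ : ℝ × ℝ → ℝ} (h : GoodSeq L T V W ρ₀ lo hi K M N r)
    (hρ : GoodLimit L T lo hi M N r ρ) : IsWeakSol L T boltzmann V W ρ₀ ρ := by
  obtain ⟨E, -, hE⟩ := exists_energy_bound hL hT V W ρ₀ (K := K) hlo hhi
  have hw : ∀ k, MemLp (entropySlope L T (M k) (N k) V W (r k)) 2
      (volume.restrict (halfCyl L T)) := fun k => memLp_interp hL hT _ (h.good k).one_le _ 2
  have hwE : ∀ k, ∫ z in halfCyl L T, entropySlope L T (M k) (N k) V W (r k) z ^ 2 ≤ E := by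
    intro k
    simp only [entropySlope]
    rw [integral_interp_faceExt_sq hL hT (h.good k).one_le]
    refine le_trans (le_of_eq ?_) (hE _ _ _ (h.good k)).2.2
    refine Finset.sum_congr rfl fun n _ => Finset.sum_congr rfl fun i _ => ?_
    ring
  obtain ⟨l, hne, hl, g, hg2, hg⟩ := exists_weak_limit hw hwE
  refine ⟨?_, g, ?_, isWeakPartialX_of_weak_limit hL hT hV hW hlo hhi h hρ hl hg2 hg,
    fun φ hφ hφT => weak_formulation hL hT hlo hhi hρ₀ h hρ hw hwE hl hg2 hg hφ hφT⟩
  · rw [restrict_cyl]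
    refine MemLp.of_bound hρ.meas.aestronglyMeasurable hi (Eventually.of_forall fun z => ?_)
    rw [Real.norm_of_nonneg (hlo.le.trans (hρ.mem z).1)]
    exact (hρ.mem z).2
  · rwa [restrict_cyl]

/-- Convergence of a subsequence of the interpolations to a weak solution. -/
theorem exists_subseq_tendsto_weakSol {L T : ℝ} (hL : 0 < L) (hT : 0 < T) {V W ρ₀ : ℝ → ℝ}
    (hV : ContDiffOn ℝ 2 V (Icc (-L) L)) (hW : ContDiffOn ℝ 2 W (Icc (-(2 * L)) (2 * L)))
    (hρ₀ : MemLp ρ₀ ∞ (volume.restrict (dom L)))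
    (hpos : ∃ ε : ℝ, 0 < ε ∧ ∀ᵐ x ∂(volume.restrict (dom L)), ε ≤ ρ₀ x)
    {M N : ℕ → ℕ} {r : ℕ → ℕ → ℕ → ℝ} (hM : ∀ k, 1 ≤ M k)
    (hX : Tendsto (fun k => stepX L (M k)) atTop (𝓝 0))
    (hτ : Tendsto (fun k => stepT T (N k)) atTop (𝓝 0))
    (hsol : ∀ k, IsSchemeSol L T (M k) (N k) boltzmann V W ρ₀ (r k))
    (hrpos : ∀ k, IsPositive (M k) (N k) (r k)) :
    ∃ (σ : ℕ → ℕ) (ρ : ℝ × ℝ → ℝ), StrictMono σ ∧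
      (∀ p : ℝ≥0∞, 1 ≤ p → p < ⊤ → Tendsto (fun k => eLpNorm
        (fun z => interp L T (M (σ k)) (N (σ k)) (r (σ k)) z - ρ z) p
        (volume.restrict (cyl L T))) atTop (𝓝 0)) ∧
      (∀ᵐ z ∂(volume.restrict (cyl L T)), 0 < ρ z) ∧ IsWeakSol L T boltzmann V W ρ₀ ρ := by
  obtain ⟨lo, hi, δ, K, hlo, hhi, hδ, -, hb⟩ := exists_uniform_bounds hL hT hV hW hρ₀ hpos
  obtain ⟨k₀, hk₀⟩ := eventually_atTop.1
    ((hX.eventually (gt_mem_nhds hδ)).and (hτ.eventually (gt_mem_nhds hδ)))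
  have hshift : StrictMono fun k : ℕ => k + k₀ := fun a b hab => Nat.add_lt_add_right hab k₀
  have hgood : GoodSeq L T V W ρ₀ lo hi K (fun k => M (k + k₀)) (fun k => N (k + k₀))
      (fun k => r (k + k₀)) := by
    refine ⟨fun k => ?_, hX.comp hshift.tendsto_atTop, hτ.comp hshift.tendsto_atTop⟩
    obtain ⟨h1, h2⟩ := hk₀ (k + k₀) (Nat.le_add_left _ _)
    obtain ⟨h3, h4⟩ := hb _ _ _ (hM _) h1.le h2.le (hsol _) (hrpos (k + k₀))
    exact ⟨hM _, hsol _, h3, h4⟩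
  obtain ⟨σ, ρ, hσ, hρ⟩ := hgood.exists_limit hL hT hlo hhi
  have hgood' := hgood.comp hσ
  have hbound : ∀ z, |ρ z| ≤ hi := fun z => by
    rw [abs_of_nonneg (hlo.le.trans (hρ.mem z).1)]; exact (hρ.mem z).2
  refine ⟨fun k => σ k + k₀, ρ, hshift.comp hσ, fun p hp hp' => ?_,
    Eventually.of_forall fun z => hlo.trans_le (hρ.mem z).1,
    hgood'.isWeakSol hL hT hV hW (integrableOn_dom_of_memLp_top hρ₀) hlo hhi hρ⟩
  rw [restrict_cyl]
  exact tendsto_eLpNorm_of_ae_of_bounded (fun k => measurable_interp ..) hρ.meas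
    (fun k z => abs_interp_le hL hT (hgood'.good k).one_le hhi.le
      (fun n hn i hi' => (hgood'.good k).abs_le hlo n (Nat.le_succ_of_le hn) i hi') z)
    hbound hρ.prev hp hp'

end AggDiff

end

theorem mainTheorem2 (L T : ℝ) (hL : 0 < L) (hT : 0 < T) (V W : ℝ → ℝ)
    (hV : ContDiffOn ℝ 2 V (Set.Icc (-L) L))
    (hW : ContDiffOn ℝ 2 W (Set.Icc (-(2 * L)) (2 * L)))
    (ρ₀ : ℝ → ℝ) (hρ₀ : MemLp ρ₀ ∞ (volume.restrict (AggDiff.dom L)))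
    (hpos : ∃ ε : ℝ, 0 < ε ∧ ∀ᵐ x ∂(volume.restrict (AggDiff.dom L)), ε ≤ ρ₀ x) :
    -- (i) existence of a strictly positive, mass-preserving solution on every mesh
    (∀ M N : ℕ, 1 ≤ M → ∃ r : ℕ → ℕ → ℝ,
      AggDiff.IsSchemeSol L T M N AggDiff.boltzmann V W ρ₀ r ∧
      AggDiff.IsPositive M N r ∧
      ∀ n ≤ N + 1, ∑ i ∈ Finset.Icc 1 (2 * M), r n i * AggDiff.stepX L M
        = ∫ x in AggDiff.dom L, ρ₀ x) ∧
    -- (ii), (iii) convergence of a subsequence, to a weak solution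
    (∀ (c : ℝ) (M N : ℕ → ℕ) (r : ℕ → ℕ → ℕ → ℝ), 0 < c →
      (∀ k, 1 ≤ M k) →
      (∀ k, AggDiff.stepX L (M k) = c * AggDiff.stepT T (N k)) →
      Tendsto (fun k => AggDiff.stepX L (M k)) atTop (𝓝 0) →
      (∀ k, AggDiff.constV2 L V W ρ₀ * AggDiff.stepT T (N k) < 1) →
      (∀ k, AggDiff.IsSchemeSol L T (M k) (N k) AggDiff.boltzmann V W ρ₀ (r k)) →
      (∀ k, AggDiff.IsPositive (M k) (N k) (r k)) →
      ∃ (σ : ℕ → ℕ) (ρ : ℝ × ℝ → ℝ), StrictMono σ ∧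
        (∀ p : ℝ≥0∞, 1 ≤ p → p < ⊤ →
          Tendsto (fun k => eLpNorm
              (fun z => AggDiff.interp L T (M (σ k)) (N (σ k)) (r (σ k)) z - ρ z) p
              (volume.restrict (AggDiff.cyl L T)))
            atTop (𝓝 0)) ∧
        (∀ᵐ z ∂(volume.restrict (AggDiff.cyl L T)), 0 < ρ z) ∧
        AggDiff.IsWeakSol L T AggDiff.boltzmann V W ρ₀ ρ) := by
  refine ⟨AggDiff.exists_isSchemeSol hL hT V W hρ₀ hpos,
    fun c M N r hc hM hstep hX _ hsol hrpos => ?_⟩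
  have hτ : Tendsto (fun k => AggDiff.stepT T (N k)) atTop (𝓝 0) := by
    have h1 : ∀ k, AggDiff.stepT T (N k) = c⁻¹ * AggDiff.stepX L (M k) := fun k => by
      rw [hstep k, inv_mul_cancel_left₀ hc.ne']
    simp_rw [h1]
    simpa using hX.const_mul c⁻¹
  exact AggDiff.exists_subseq_tendsto_weakSol hL hT hV hW hρ₀ hpos hM hX hτ hsol hrpos
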